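/- **Definitions.** For a group $B$ of homeomorphisms of a space $X$ and a homeomorphism $h$ of $X$, let $\mathrm{sing}(h)$ be the set of points $p\in X$ such that $h$ agrees with no element of $B$ on any neighborhood of $p$. Thompson's group $T$ is the group of all piecewise-linear homeomorphisms of the circle $S^1=\mathbb{R}/\mathbb{Z}$ whose breakpoints are dyadic and whose linear segments have the form $t\mapsto 2^nt+b$ with $n\in\mathbb{Z}$ and $b\in\mathbb{Z}[\tfrac12]$. The group $T\mathcal{A}$ consists of all homeomorphisms $f$ of $S^1$ such that $\mathrm{sing}(f)$ (relative to $B=T$) is a finite set of dyadic points and, for each $p\in\mathrm{sing}(f)$, $L_{f(p)}\circ f$ agrees with $f\circ L_p$ in a neighborhood of $p$, where $L_p$ is the linear map near $p$ that fixes $p$ and has slope $2$. Thompson's group $V$ is the group of all homeomorphisms $f$ of the Cantor set $\mathfrak{C}_2=\{0,1\}^\omega$ such that near each point $p$, $f$ agrees with a prefix replacement $\alpha\psi\mapsto\beta\psi$, where $\alpha,\beta$ are finite prefixes of $p$ and $f(p)$. The group $V\mathcal{A}$ consists of all homeomorphisms $f$ of $\mathfrak{C}_2$ such that $\mathrm{sing}(f)$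 (relative to $B=V$) is finite, each $p\in\mathrm{sing}(f)$ ends in $\overline{0}=000\cdots$ or $\overline{1}=111\cdots$, and each $p\in\mathrm{sing}(f)$ has a neighborhood on which $f$ preserves the lexicographic order and $L_{f(p)}\circ f$ agrees with $f\circ L_p$; here $L_p$ is the prefix replacement $\alpha 0\psi\mapsto\alpha\psi$ if $p=\alpha\overline{0}$, and $\alpha1\psi\mapsto\alpha\psi$ if $p=\alpha\overline{1}$ (in particular, $f(p)$ also ends in $\overline 0$ or $\overline 1$). Brin's group $\mathcal{A}$ is the group of all homeomorphisms $f$ of $\mathbb{R}$ that are piecewise-linear with a locally finite set of breakpoints, all of them in $\mathbb{Z}[\tfrac12]$, whose linear segments have the form $t\mapsto 2^nt+b$ with $n\in\mathbb{Z}$, $b\in\mathbb{Z}[\tfrac12]$, and for which there is an $N>0$ with $f(t+1)=f(t)+1$ whenever $|t|\ge N$. **Theorem.** 1. $T\mathcal{A}$ contains $\bigoplus_\omega\mathbb{Q}$. More precisely, there are an injective homomorphism $i\colon\mathbb{Q}\to\mathcal{A}$, injective homomorphisms $\alpha_n\colon\mathcal{A}\to T\mathcal{A}$ ($n\in\mathbb{N}$)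 such that elements of the images of $\alpha_m$ and $\alpha_n$ have disjoint (closed) supports whenever $m\neq n$, and an injective homomorphism $\bigoplus_\omega\mathbb{Q}\to T\mathcal{A}$ whose restriction to the $n$-th summand is $\alpha_n\circ i$. 2. $V\mathcal{A}$ contains $\bigoplus_\omega(\mathbb{Q}\oplus\mathbb{Q}/\mathbb{Z})$. More precisely, there are injective homomorphisms $i\colon\mathbb{Q}\to\mathcal{A}$ and $j\colon\mathbb{Q}/\mathbb{Z}\to V$, injective homomorphisms $\alpha_n\colon\mathcal{A}\to V\mathcal{A}$ and $\beta_n\colon V\to V\mathcal{A}$ ($n\in\mathbb{N}$) such that elements of the images of any two different ones of the maps $\alpha_0,\beta_0,\alpha_1,\beta_1,\dots$ have disjoint (closed) supports, and an injective homomorphism $\bigoplus_\omega(\mathbb{Q}\oplus\mathbb{Q}/\mathbb{Z})\to V\mathcal{A}$ whose restriction to the $n$-th summand is $(r,s)\mapsto\alpha_n(i(r))\,\beta_n(j(s))$. 3. Every countable torsion-free abelian group embeds into $T\mathcal{A}$. 4. Every countable abelian group embeds into $V\mathcal{A}$. -/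

import Mathlib

open Set Filter Topology
open scoped DirectSum

/-! ### Dyadic numbers and dyadic piecewise-linear maps -/

/-- The ring `ℤ[1/2]` of dyadic rationals, inside `ℝ`. -/
def dyadics : Subring ℝ := Subring.closure {(1 / 2 : ℝ)}

/-- `f : X → X` is piecewise-linear, read in the coordinate `q : ℝ → X`, with a locally finite set
of breakpoints, all of them dyadic, and with all linear segments of the form `t ↦ 2 ^ n * t + b`
with `n ∈ ℤ` and `b` dyadic.  That is: at every `x` the map is such a linear map on a left
neighbourhood and on a right neighbourhood of `x`, and the two linear maps coincide unless `x` is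
dyadic.  Used for `X = ℝ` with `q = id`, and for the circle `X = ℝ / ℤ` with `q` the projection
(where, by compactness, there are only finitely many breakpoints). -/
def IsDyadicPL {X : Type} (q : ℝ → X) (f : X → X) : Prop :=
  ∀ x : ℝ, ∃ (m n : ℤ) (b c : ℝ), b ∈ dyadics ∧ c ∈ dyadics ∧
    (∀ᶠ t in 𝓝[≤] x, f (q t) = q (2 ^ m * t + b)) ∧
    (∀ᶠ t in 𝓝[≥] x, f (q t) = q (2 ^ n * t + c)) ∧
    (x ∉ dyadics → m = n ∧ b = c)

theorem half_mem_dyadics : (1 / 2 : ℝ) ∈ dyadics := Subring.subset_closure (mem_singleton _)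

theorem two_zpow_mem_dyadics (n : ℤ) : (2 : ℝ) ^ n ∈ dyadics := by
  rcases n with n | n
  · have h : (2 : ℝ) ∈ dyadics := by exact_mod_cast natCast_mem dyadics 2
    simpa using pow_mem h n
  · have := pow_mem half_mem_dyadics (n + 1)
    rw [zpow_negSucc]
    simpa using this

theorem affine_mem_dyadics_iff {n : ℤ} {b x : ℝ} (hb : b ∈ dyadics) :
    2 ^ n * x + b ∈ dyadics ↔ x ∈ dyadics := by
  constructor
  · intro h
    have h1 := mul_mem (two_zpow_mem_dyadics (-n)) (sub_mem h hb)
    have h0 : (2 : ℝ) ^ n ≠ 0 := by positivity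
    rw [zpow_neg] at h1
    have h2 : ((2 : ℝ) ^ n)⁻¹ * (2 ^ n * x + b - b) = x := by field_simp; ring
    rwa [h2] at h1
  · intro h
    exact add_mem (mul_mem (two_zpow_mem_dyadics n) h) hb

theorem tendsto_affine_le (n : ℤ) (b x : ℝ) :
    Tendsto (fun t : ℝ => 2 ^ n * t + b) (𝓝[≤] x) (𝓝[≤] (2 ^ n * x + b)) := by
  have hc : Continuous fun t : ℝ => 2 ^ n * t + b := by fun_prop
  refine tendsto_nhdsWithin_iff.2 ⟨(hc.tendsto x).mono_left nhdsWithin_le_nhds, ?_⟩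
  filter_upwards [self_mem_nhdsWithin] with t (ht : t ≤ x)
  have : (0 : ℝ) < 2 ^ n := by positivity
  simp only [mem_Iic]
  nlinarith

theorem tendsto_affine_ge (n : ℤ) (b x : ℝ) :
    Tendsto (fun t : ℝ => 2 ^ n * t + b) (𝓝[≥] x) (𝓝[≥] (2 ^ n * x + b)) := by
  have hc : Continuous fun t : ℝ => 2 ^ n * t + b := by fun_prop
  refine tendsto_nhdsWithin_iff.2 ⟨(hc.tendsto x).mono_left nhdsWithin_le_nhds, ?_⟩
  filter_upwards [self_mem_nhdsWithin] with t (ht : x ≤ t)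
  have : (0 : ℝ) < 2 ^ n := by positivity
  simp only [mem_Ici]
  nlinarith

theorem IsDyadicPL.id {X : Type} (q : ℝ → X) : IsDyadicPL q (fun y => y) := fun _ =>
  ⟨0, 0, 0, 0, zero_mem _, zero_mem _, by simp, by simp, fun _ => ⟨rfl, rfl⟩⟩

theorem IsDyadicPL.comp {X : Type} {q : ℝ → X} {f g : X → X} (hf : IsDyadicPL q f)
    (hg : IsDyadicPL q g) : IsDyadicPL q (fun y => f (g y)) := by
  intro x
  obtain ⟨m, n, b, c, hb, hc, hl, hr, hx⟩ := hg x
  obtain ⟨m₁, n₁, b₁, c₁, hb₁, hc₁, hl₁, -, hx₁⟩ := hf (2 ^ m * x + b)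
  obtain ⟨m₂, n₂, b₂, c₂, hb₂, hc₂, -, hr₂, -⟩ := hf (2 ^ n * x + c)
  have h20 : (2 : ℝ) ≠ 0 := two_ne_zero
  by_cases hd : x ∈ dyadics
  · refine ⟨m₁ + m, n₂ + n, 2 ^ m₁ * b + b₁, 2 ^ n₂ * c + c₂,
      add_mem (mul_mem (two_zpow_mem_dyadics _) hb) hb₁,
      add_mem (mul_mem (two_zpow_mem_dyadics _) hc) hc₂, ?_, ?_, fun h => absurd hd h⟩
    · filter_upwards [hl, (tendsto_affine_le m b x).eventually hl₁] with t h1 h2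
      rw [h1, h2, zpow_add₀ h20]; congr 1; ring
    · filter_upwards [hr, (tendsto_affine_ge n c x).eventually hr₂] with t h1 h2
      rw [h1, h2, zpow_add₀ h20]; congr 1; ring
  · obtain ⟨m₁, n₁, b₁, c₁, hb₁, hc₁, hl₁, hr₁, hx₁⟩ := hf (2 ^ m * x + b)
    obtain ⟨rfl, rfl⟩ := hx hd
    obtain ⟨rfl, rfl⟩ := hx₁ (by rwa [affine_mem_dyadics_iff hb])
    refine ⟨m₁ + m, m₁ + m, 2 ^ m₁ * b + b₁, 2 ^ m₁ * b + b₁,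
      add_mem (mul_mem (two_zpow_mem_dyadics _) hb) hb₁,
      add_mem (mul_mem (two_zpow_mem_dyadics _) hb) hb₁, ?_, ?_, fun _ => ⟨rfl, rfl⟩⟩
    · filter_upwards [hl, (tendsto_affine_le m b x).eventually hl₁] with t h1 h2
      rw [h1, h2, zpow_add₀ h20]; congr 1; ring
    · filter_upwards [hr, (tendsto_affine_ge m b x).eventually hr₁] with t h1 h2
      rw [h1, h2, zpow_add₀ h20]; congr 1; ring

theorem IsDyadicPL.inv {X : Type} {q : ℝ → X} (hq : Function.Surjective q)
    (hk : ∀ u v, q u = q v → ∃ k ∈ dyadics, v = u + k ∧ ∀ t, q (t + k) = q t)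
    {f g : X → X} (hf : IsDyadicPL q f) (hgf : ∀ y, g (f y) = y) (hfg : ∀ y, f (g y) = y) :
    IsDyadicPL q g := by
  intro y
  obtain ⟨x, hx⟩ := hq (g (q y))
  obtain ⟨m, n, b, c, hb, hc, hl, hr, hd⟩ := hf x
  have hfx : f (q x) = q y := by rw [hx, hfg]
  obtain ⟨k, hkd, hky, hkq⟩ := hk _ _ ((hl.self_of_nhdsWithin self_mem_Iic).symm.trans hfx)
  obtain ⟨l, hld, hly, hlq⟩ := hk _ _ ((hr.self_of_nhdsWithin self_mem_Ici).symm.trans hfx)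
  have key : ∀ (n : ℤ) (c l : ℝ), y = 2 ^ n * x + c + l →
      2 ^ (-n) * y + -(2 ^ (-n) * (c + l)) = x ∧
      ∀ t : ℝ, 2 ^ n * (2 ^ (-n) * t + -(2 ^ (-n) * (c + l))) + c + l = t := by
    intro n c l h
    have h0 : (2 : ℝ) ^ n ≠ 0 := by positivity
    constructor
    · rw [h, zpow_neg]; field_simp; ring
    · intro t; rw [zpow_neg]; field_simp; ring
  obtain ⟨hb1, hb2⟩ := key m b k hky
  obtain ⟨hc1, hc2⟩ := key n c l hly
  have hbk := mul_mem (two_zpow_mem_dyadics (-m)) (add_mem hb hkd)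
  have hcl := mul_mem (two_zpow_mem_dyadics (-n)) (add_mem hc hld)
  have hL : ∀ᶠ t in 𝓝[≤] y, g (q t) = q (2 ^ (-m) * t + -(2 ^ (-m) * (b + k))) := by
    have := tendsto_affine_le (-m) (-(2 ^ (-m) * (b + k))) y
    rw [hb1] at this
    filter_upwards [this.eventually hl] with t ht
    have h2 := congrArg q (hb2 t)
    rw [hkq, ← ht] at h2
    rw [← h2, hgf]
  have hR : ∀ᶠ t in 𝓝[≥] y, g (q t) = q (2 ^ (-n) * t + -(2 ^ (-n) * (c + l))) := by
    have := tendsto_affine_ge (-n) (-(2 ^ (-n) * (c + l))) y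
    rw [hc1] at this
    filter_upwards [this.eventually hr] with t ht
    have h2 := congrArg q (hc2 t)
    rw [hlq, ← ht] at h2
    rw [← h2, hgf]
  refine ⟨-m, -n, _, _, neg_mem hbk, neg_mem hcl, hL, hR, fun hy => ?_⟩
  have hxd : x ∉ dyadics := by
    intro h
    apply hy
    rw [hky, add_assoc]
    exact (affine_mem_dyadics_iff (add_mem hb hkd)).2 h
  obtain ⟨rfl, rfl⟩ := hd hxd
  have : k = l := by linarith
  subst this
  exact ⟨rfl, rfl⟩

/-! ### Brin's group `𝒜` -/

/-- Brin's group `𝒜`: the homeomorphisms of `ℝ` that are piecewise-linear with a locally finite set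
of dyadic breakpoints, have linear segments of the form `t ↦ 2 ^ n * t + b` with `n ∈ ℤ` and `b`
dyadic, and commute with `t ↦ t + 1` where `|t|` is large. -/
def BrinA : Subgroup (ℝ ≃ₜ ℝ) where
  carrier := {f | IsDyadicPL (fun t : ℝ => t) f ∧
    ∃ N : ℝ, 0 < N ∧ ∀ t : ℝ, N ≤ |t| → f (t + 1) = f t + 1}
  one_mem' := ⟨IsDyadicPL.id _, 1, one_pos, fun _ _ => rfl⟩
  mul_mem' := by
    rintro f g ⟨hf, N, hN, hfN⟩ ⟨hg, M, hM, hgM⟩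
    refine ⟨hf.comp hg, ?_⟩
    have hcomp : IsCompact (g.symm '' Icc (-N) N) := isCompact_Icc.image g.symm.continuous
    obtain ⟨R, hR⟩ := hcomp.isBounded.subset_closedBall 0
    refine ⟨max M (R + 1), lt_max_of_lt_left hM, fun t ht => ?_⟩
    rw [Homeomorph.mul_apply, Homeomorph.mul_apply, hgM t (le_trans (le_max_left _ _) ht), hfN]
    by_contra h
    have h1 : t ∈ g.symm '' Icc (-N) N :=
      ⟨g t, abs_le.1 (not_le.1 h).le, g.symm_apply_apply t⟩
    have h2 := hR h1
    rw [mem_closedBall_zero_iff, Real.norm_eq_abs] at h2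
    have := le_trans (le_max_right _ _) ht
    linarith
  inv_mem' := by
    rintro f ⟨hf, N, hN, hfN⟩
    refine ⟨hf.inv (fun x => ⟨x, rfl⟩)
      (fun u v h => ⟨0, zero_mem _, by simpa using h.symm, by simp⟩)
      f.symm_apply_apply f.apply_symm_apply, ?_⟩
    have hcomp : IsCompact (f '' Icc (-N) N) := isCompact_Icc.image f.continuous
    obtain ⟨R, hR⟩ := hcomp.isBounded.subset_closedBall 0
    refine ⟨max 1 (R + 1), lt_max_of_lt_left one_pos, fun t ht => ?_⟩
    have h3 : N ≤ |f.symm t| := by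
      by_contra h
      have h1 : t ∈ f '' Icc (-N) N :=
        ⟨f.symm t, abs_le.1 (not_le.1 h).le, f.apply_symm_apply t⟩
      have h2 := hR h1
      rw [mem_closedBall_zero_iff, Real.norm_eq_abs] at h2
      have := le_trans (le_max_right _ _) ht
      linarith
    change f.symm (t + 1) = f.symm t + 1
    rw [Homeomorph.symm_apply_eq, hfN _ h3, Homeomorph.apply_symm_apply]

/-! ### Singular points -/

/-- The singular points of a homeomorphism `h` relative to a base group `B`: the points on no
neighbourhood of which `h` agrees with an element of `B`. -/
def sing {X : Type} [TopologicalSpace X] (B : Subgroup (X ≃ₜ X)) (h : X ≃ₜ X) : Set X :=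
  {p | ¬ ∃ b ∈ B, ∀ᶠ x in 𝓝 p, h x = b x}

theorem sing_of_mem {X : Type} [TopologicalSpace X] {B : Subgroup (X ≃ₜ X)} {f : X ≃ₜ X}
    (hf : f ∈ B) : sing B f = ∅ := by
  ext p
  simp only [sing, mem_ofPred_eq, mem_empty_iff_false, iff_false, not_not]
  exact ⟨f, hf, Eventually.of_forall fun _ => rfl⟩

theorem sing_mul_subset {X : Type} [TopologicalSpace X] (B : Subgroup (X ≃ₜ X)) (f g : X ≃ₜ X) :
    sing B (f * g) ⊆ sing B g ∪ g.symm '' sing B f := by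
  intro p hp
  by_contra h
  simp only [mem_union, not_or] at h
  obtain ⟨h1, h2⟩ := h
  have h3 : g p ∉ sing B f := fun h => h2 ⟨g p, h, g.symm_apply_apply p⟩
  simp only [sing, mem_ofPred_eq, not_not] at h1 h3
  obtain ⟨b, hb, hgb⟩ := h1
  obtain ⟨a, ha, hfa⟩ := h3
  refine hp ⟨a * b, mul_mem ha hb, ?_⟩
  filter_upwards [hgb, (g.continuous.tendsto p).eventually hfa] with x h1 h2
  rw [Homeomorph.mul_apply, Homeomorph.mul_apply, h2, h1]

theorem sing_inv_subset {X : Type} [TopologicalSpace X] (B : Subgroup (X ≃ₜ X)) (f : X ≃ₜ X) :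
    sing B f⁻¹ ⊆ f '' sing B f := by
  intro p hp
  by_contra h
  have h1 : f.symm p ∉ sing B f := fun h' => h ⟨_, h', f.apply_symm_apply p⟩
  simp only [sing, mem_ofPred_eq, not_not] at h1
  obtain ⟨b, hb, hfb⟩ := h1
  refine hp ⟨b⁻¹, inv_mem hb, ?_⟩
  filter_upwards [(f.symm.continuous.tendsto p).eventually hfb] with x hx
  rw [Homeomorph.inv_apply, Homeomorph.inv_apply, Homeomorph.eq_symm_apply, ← hx,
    Homeomorph.apply_symm_apply]

/-! ### Thompson's group `T` and the group `T𝒜` on the circle `ℝ / ℤ` -/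

/-- The projection from `ℝ` to the circle `ℝ / ℤ`. -/
def toCircle (t : ℝ) : UnitAddCircle := (t : UnitAddCircle)

/-- The dyadic points of the circle. -/
def dyadicPoints : Set UnitAddCircle := toCircle '' dyadics

theorem toCircle_surjective : Function.Surjective toCircle := QuotientAddGroup.mk_surjective

theorem map_toCircle_nhds (x : ℝ) : map toCircle (𝓝 x) = 𝓝 (toCircle x) :=
  QuotientAddGroup.isOpenQuotientMap_mk.map_nhds_eq x

theorem toCircle_eq (u v : ℝ) (h : toCircle u = toCircle v) :
    ∃ k ∈ dyadics, v = u + k ∧ ∀ t, toCircle (t + k) = toCircle t := by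
  have h1 : ((v - u : ℝ) : UnitAddCircle) = 0 := by
    rw [AddCircle.coe_sub, sub_eq_zero]; exact h.symm
  refine ⟨v - u, ?_, by ring, fun t => ?_⟩
  · obtain ⟨n, hn⟩ := AddCircle.coe_eq_zero_iff (p := (1 : ℝ)) |>.1 h1
    rw [← hn]
    simp [intCast_mem dyadics n]
  · rw [toCircle, AddCircle.coe_add, h1, add_zero]; rfl

theorem toCircle_mem_dyadicPoints {x : ℝ} : toCircle x ∈ dyadicPoints ↔ x ∈ dyadics := by
  constructor
  · rintro ⟨y, hy, hyx⟩
    obtain ⟨k, hk, rfl, -⟩ := toCircle_eq _ _ hyx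
    exact add_mem hy hk
  · exact fun h => ⟨x, h, rfl⟩

theorem sub_mem_dyadicPoints {p r : UnitAddCircle} (hp : p ∈ dyadicPoints)
    (hr : r ∈ dyadicPoints) : 2 • p - r ∈ dyadicPoints := by
  obtain ⟨x, hx, rfl⟩ := hp
  obtain ⟨y, hy, rfl⟩ := hr
  exact ⟨2 • x - y, sub_mem (nsmul_mem hx 2) hy, rfl⟩

/-- Thompson's group `T`: the piecewise-linear homeomorphisms of the circle with dyadic breakpoints
and with linear segments of the form `t ↦ 2 ^ n * t + b`, with `n ∈ ℤ` and `b` dyadic. -/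
def ThompsonT : Subgroup (UnitAddCircle ≃ₜ UnitAddCircle) where
  carrier := {f | IsDyadicPL toCircle f}
  one_mem' := IsDyadicPL.id _
  mul_mem' hf hg := IsDyadicPL.comp hf hg
  inv_mem' {f} hf := IsDyadicPL.inv toCircle_surjective toCircle_eq hf
    f.symm_apply_apply f.apply_symm_apply

/-- `L_{f(p)} ∘ f` agrees with `f ∘ L_p` in a neighbourhood of `p`, where the germ `L_p` at `p` of
the linear map that fixes `p` and has slope `2` is represented by `z ↦ p + 2 (z - p) = 2 z - p`. -/
def CommutesWithDoublingAt (f : UnitAddCircle → UnitAddCircle) (p : UnitAddCircle) : Prop :=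
  ∀ᶠ z in 𝓝 p, 2 • f z - f p = f (2 • z - p)

theorem tendsto_doubling (p : UnitAddCircle) :
    Tendsto (fun z : UnitAddCircle => 2 • z - p) (𝓝 p) (𝓝 p) := by
  have hc : Continuous fun z : UnitAddCircle => 2 • z - p := by fun_prop
  have := hc.tendsto p
  rwa [two_nsmul, add_sub_cancel_right] at this

theorem commutesWithDoublingAt_of_mem {b : UnitAddCircle ≃ₜ UnitAddCircle} (hb : b ∈ ThompsonT)
    (p : UnitAddCircle) : CommutesWithDoublingAt b p := by
  obtain ⟨x, rfl⟩ := toCircle_surjective p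
  obtain ⟨m, n, c, d, -, -, hl, hr, -⟩ := hb x
  rw [CommutesWithDoublingAt, ← map_toCircle_nhds, eventually_map, ← nhdsLE_sup_nhdsGE,
    eventually_sup]
  have key : ∀ (m : ℤ) (c t : ℝ), b (toCircle x) = toCircle (2 ^ m * x + c) →
      b (toCircle t) = toCircle (2 ^ m * t + c) →
      b (toCircle (2 ^ (1 : ℤ) * t + -x)) = toCircle (2 ^ m * (2 ^ (1 : ℤ) * t + -x) + c) →
      2 • b (toCircle t) - b (toCircle x) = b (2 • toCircle t - toCircle x) := by
    intro m c t h1 h2 h3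
    have h4 : 2 • toCircle t - toCircle x = toCircle (2 ^ (1 : ℤ) * t + -x) := by
      have : (2 : ℝ) ^ (1 : ℤ) * t + -x = 2 • t - x := by simp [two_mul, sub_eq_add_neg]
      rw [this]; rfl
    have h5 : 2 ^ m * ((2 : ℝ) ^ (1 : ℤ) * t + -x) + c = 2 • (2 ^ m * t + c) - (2 ^ m * x + c) := by
      simp only [zpow_one, two_nsmul]; ring
    rw [h4, h3, h1, h2, h5]; rfl
  have e : (2 : ℝ) ^ (1 : ℤ) * x + -x = x := by rw [zpow_one]; ring
  have hL := tendsto_affine_le 1 (-x) x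
  have hR := tendsto_affine_ge 1 (-x) x
  rw [e] at hL hR
  constructor
  · filter_upwards [hl, hL.eventually hl] with t h1 h2
    exact key m c t (hl.self_of_nhdsWithin self_mem_Iic) h1 h2
  · filter_upwards [hr, hR.eventually hr] with t h1 h2
    exact key n d t (hr.self_of_nhdsWithin self_mem_Ici) h1 h2

theorem mem_dyadicPoints_iff_of_mem {b : UnitAddCircle ≃ₜ UnitAddCircle} (hb : b ∈ ThompsonT)
    (p : UnitAddCircle) : b p ∈ dyadicPoints ↔ p ∈ dyadicPoints := by
  obtain ⟨x, rfl⟩ := toCircle_surjective p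
  obtain ⟨m, n, c, d, hc, -, hl, -⟩ := hb x
  rw [hl.self_of_nhdsWithin self_mem_Iic, toCircle_mem_dyadicPoints, toCircle_mem_dyadicPoints,
    affine_mem_dyadics_iff hc]

/-- The conditions that define `T𝒜`. -/
def MemTA (f : UnitAddCircle ≃ₜ UnitAddCircle) : Prop :=
  (sing ThompsonT f).Finite ∧ sing ThompsonT f ⊆ dyadicPoints ∧
    ∀ p ∈ sing ThompsonT f, CommutesWithDoublingAt f p

theorem MemTA.commutes {f : UnitAddCircle ≃ₜ UnitAddCircle} (hf : MemTA f) (p : UnitAddCircle) :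
    CommutesWithDoublingAt f p := by
  by_cases hp : p ∈ sing ThompsonT f
  · exact hf.2.2 p hp
  · simp only [sing, mem_ofPred_eq, not_not] at hp
    obtain ⟨b, hb, hfb⟩ := hp
    unfold CommutesWithDoublingAt
    filter_upwards [hfb, (tendsto_doubling p).eventually hfb, commutesWithDoublingAt_of_mem hb p]
      with z h1 h2 h3
    rw [h1, h2, hfb.self_of_nhds, h3]

theorem mem_dyadicPoints_iff_of_not_sing {f : UnitAddCircle ≃ₜ UnitAddCircle} {p : UnitAddCircle}
    (hp : p ∉ sing ThompsonT f) : f p ∈ dyadicPoints ↔ p ∈ dyadicPoints := by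
  simp only [sing, mem_ofPred_eq, not_not] at hp
  obtain ⟨b, hb, hfb⟩ := hp
  rw [hfb.self_of_nhds, mem_dyadicPoints_iff_of_mem hb]

theorem MemTA.mem_dyadicPoints_iff {f : UnitAddCircle ≃ₜ UnitAddCircle} (hf : MemTA f)
    (p : UnitAddCircle) : f p ∈ dyadicPoints ↔ p ∈ dyadicPoints := by
  by_cases hp : p ∉ sing ThompsonT f
  · exact mem_dyadicPoints_iff_of_not_sing hp
  rw [not_not] at hp
  have hpd := hf.2.1 hp
  refine ⟨fun _ => hpd, fun _ => ?_⟩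
  have hns : ∀ᶠ z in 𝓝 p, z ∉ sing ThompsonT f \ {p} :=
    (hf.1.subset sdiff_subset).isClosed.isOpen_compl.mem_nhds (by simp)
  have hall := (hns.and ((tendsto_doubling p).eventually hns)).and (hf.commutes p)
  obtain ⟨x, rfl⟩ := toCircle_surjective p
  have hx : x ∈ dyadics := toCircle_mem_dyadicPoints.1 hpd
  have hseq : Tendsto (fun n : ℕ => toCircle (x + (1 / 2) ^ (n + 2))) atTop (𝓝 (toCircle x)) := by
    have h1 : Tendsto (fun n : ℕ => x + (1 / 2 : ℝ) ^ (n + 2)) atTop (𝓝 (x + 0)) :=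
      tendsto_const_nhds.add ((tendsto_add_atTop_iff_nat 2).2
        (tendsto_pow_atTop_nhds_zero_of_lt_one (by norm_num) (by norm_num)))
    rw [add_zero] at h1
    rw [← map_toCircle_nhds]
    exact tendsto_map.comp h1
  obtain ⟨n, ⟨h1, h2⟩, h3⟩ := (hseq.eventually hall).exists
  have hne : ∀ s : ℝ, 0 < s → s < 1 → toCircle (x + s) ≠ toCircle x := by
    intro s hs0 hs1 h
    have h4 : ((s : ℝ) : UnitAddCircle) = 0 := by
      have : ((x : ℝ) : UnitAddCircle) + (s : UnitAddCircle) = (x : UnitAddCircle) := h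
      simpa using this
    obtain ⟨k, hk⟩ := AddCircle.coe_eq_zero_iff (p := (1 : ℝ)) |>.1 h4
    have hk' : (k : ℝ) = s := by simpa using hk
    rw [← hk'] at hs0 hs1
    have h5 : 0 < k := by exact_mod_cast hs0
    have h6 : k < 1 := by exact_mod_cast hs1
    omega
  have hpow : ∀ j : ℕ, 0 < (1 / 2 : ℝ) ^ (j + 1) ∧ (1 / 2 : ℝ) ^ (j + 1) < 1 := fun j =>
    ⟨by positivity, pow_lt_one₀ (by norm_num) (by norm_num) (by omega)⟩
  have hmem : ∀ j : ℕ, toCircle (x + (1 / 2) ^ j) ∈ dyadicPoints := fun j =>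
    toCircle_mem_dyadicPoints.2 (add_mem hx (pow_mem half_mem_dyadics j))
  have e : 2 • toCircle (x + (1 / 2) ^ (n + 2)) - toCircle x = toCircle (x + (1 / 2) ^ (n + 1)) := by
    have : x + (1 / 2) ^ (n + 1) = 2 • (x + (1 / 2) ^ (n + 2)) - x := by
      rw [two_nsmul]; ring
    rw [this]; rfl
  rw [e] at h2 h3
  have h1' : toCircle (x + (1 / 2) ^ (n + 2)) ∉ sing ThompsonT f := fun h =>
    h1 ⟨h, hne _ (hpow (n + 1)).1 (hpow (n + 1)).2⟩
  have h2' : toCircle (x + (1 / 2) ^ (n + 1)) ∉ sing ThompsonT f := fun h =>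
    h2 ⟨h, hne _ (hpow n).1 (hpow n).2⟩
  have h5 : f (toCircle x) = 2 • f (toCircle (x + (1 / 2) ^ (n + 2))) -
      f (toCircle (x + (1 / 2) ^ (n + 1))) := by
    rw [← h3]; abel
  rw [h5]
  exact sub_mem_dyadicPoints ((mem_dyadicPoints_iff_of_not_sing h1').2 (hmem _))
    ((mem_dyadicPoints_iff_of_not_sing h2').2 (hmem _))

/-- The group `T𝒜`: the homeomorphisms `f` of the circle whose set of singular points relative to
`T` is a finite set of dyadic points, and such that `L_{f(p)} ∘ f` agrees with `f ∘ L_p` near each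
singular point `p`. -/
def GroupTA : Subgroup (UnitAddCircle ≃ₜ UnitAddCircle) where
  carrier := {f | MemTA f}
  one_mem' := by simp [MemTA, sing_of_mem (one_mem ThompsonT)]
  mul_mem' := by
    intro f g hf hg
    refine ⟨(hg.1.union (hf.1.image _)).subset (sing_mul_subset _ f g),
      (sing_mul_subset _ f g).trans (union_subset hg.2.1 ?_), fun p _ => ?_⟩
    · rintro _ ⟨p, hp, rfl⟩
      rw [← hg.mem_dyadicPoints_iff, Homeomorph.apply_symm_apply]
      exact hf.2.1 hp
    · unfold CommutesWithDoublingAt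
      filter_upwards [hg.commutes p, (g.continuous.tendsto p).eventually (hf.commutes (g p))]
        with z h1 h2
      simp only [Homeomorph.mul_apply]
      rw [h2, h1]
  inv_mem' := by
    intro f hf
    refine ⟨(hf.1.image _).subset (sing_inv_subset _ f), (sing_inv_subset _ f).trans ?_,
      fun p _ => ?_⟩
    · rintro _ ⟨p, hp, rfl⟩
      exact (hf.mem_dyadicPoints_iff p).2 (hf.2.1 hp)
    · unfold CommutesWithDoublingAt
      filter_upwards [(f.symm.continuous.tendsto p).eventually (hf.commutes (f.symm p))] with z h
      simp only [Homeomorph.inv_apply]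
      rw [Homeomorph.eq_symm_apply, ← h, Homeomorph.apply_symm_apply, Homeomorph.apply_symm_apply]

/-! ### Thompson's group `V` and the group `V𝒜` on the Cantor set `{0, 1} ^ ω` -/

/-- The Cantor set of infinite binary sequences, with the product topology. -/
abbrev Cantor : Type := ℕ → Bool

/-- The concatenation `α ψ` of a finite word `α` and an infinite sequence `ψ`. -/
def prepend (α : List Bool) (ψ : Cantor) : Cantor := fun k =>
  if h : k < α.length then α[k] else ψ (k - α.length)

theorem prepend_append (α β : List Bool) (ψ : Cantor) :
    prepend (α ++ β) ψ = prepend α (prepend β ψ) := by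
  funext k
  simp only [prepend, List.length_append, List.getElem_append]
  split_ifs <;> first | rfl | omega | (congr 1; omega)

theorem prepend_injective (α : List Bool) : Function.Injective (prepend α) := by
  intro ψ φ h
  funext k
  have := congrFun h (k + α.length)
  simpa [prepend] using this

/-- The homeomorphism (or map) `f` agrees with a prefix replacement `α ψ ↦ β ψ` near `p`
(so `α` and `β` are prefixes of `p` and of `f p`). -/
def IsPrefixReplacementAt (f : Cantor → Cantor) (p : Cantor) : Prop :=
  ∃ α β : List Bool, ∀ᶠ x in 𝓝 p, ∃ ψ, x = prepend α ψ ∧ f x = prepend β ψ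

theorem prepend_comparable {β γ : List Bool} {ψ φ : Cantor} (h : prepend β ψ = prepend γ φ) :
    (∃ τ, γ = β ++ τ) ∨ ∃ τ, β = γ ++ τ := by
  have key : ∀ {β γ : List Bool} {ψ φ : Cantor}, prepend β ψ = prepend γ φ →
      β.length ≤ γ.length → β <+: γ := by
    intro β γ ψ φ h hl
    rw [List.prefix_iff_eq_take]
    refine List.ext_getElem (by simp [hl]) fun i h1 h2 => ?_
    have := congrFun h i
    have h3 : i < γ.length := lt_of_lt_of_le h1 hl
    simpa [prepend, h1, h3] using this
  rcases le_total β.length γ.length with hl | hl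
  · obtain ⟨τ, hτ⟩ := key h hl
    exact Or.inl ⟨τ, hτ.symm⟩
  · obtain ⟨τ, hτ⟩ := key h.symm hl
    exact Or.inr ⟨τ, hτ.symm⟩

/-- Thompson's group `V`: the homeomorphisms of the Cantor set that agree with a prefix replacement
near every point. -/
def ThompsonV : Subgroup (Cantor ≃ₜ Cantor) where
  carrier := {f | ∀ p, IsPrefixReplacementAt f p}
  one_mem' p := ⟨[], [], Eventually.of_forall fun x => ⟨x, rfl, rfl⟩⟩
  mul_mem' := by
    intro f g hf hg p
    obtain ⟨α, β, h1⟩ := hg p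
    obtain ⟨γ, δ, h2⟩ := hf (g p)
    have h3 := (g.continuous.tendsto p).eventually h2
    obtain ⟨ψ₀, -, hψ₀⟩ := h1.self_of_nhds
    obtain ⟨φ₀, hφ₀, -⟩ := h3.self_of_nhds
    rcases prepend_comparable (hψ₀.symm.trans hφ₀) with ⟨τ, rfl⟩ | ⟨τ, rfl⟩
    · refine ⟨α ++ τ, δ, ?_⟩
      filter_upwards [h1, h3]
      rintro x ⟨ψ, hx, hgx⟩ ⟨φ, hgx', hfx⟩
      refine ⟨φ, ?_, hfx⟩
      rw [hgx', prepend_append] at hgx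
      rw [hx, prepend_append, prepend_injective β hgx]
    · refine ⟨α, δ ++ τ, ?_⟩
      filter_upwards [h1, h3]
      rintro x ⟨ψ, hx, hgx⟩ ⟨φ, hgx', hfx⟩
      refine ⟨ψ, hx, ?_⟩
      rw [hgx', prepend_append] at hgx
      rw [Homeomorph.mul_apply, hfx, prepend_append, prepend_injective γ hgx]
  inv_mem' := by
    intro f hf p
    obtain ⟨α, β, h⟩ := hf (f.symm p)
    refine ⟨β, α, ?_⟩
    filter_upwards [(f.symm.continuous.tendsto p).eventually h]
    rintro x ⟨ψ, h1, h2⟩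
    exact ⟨ψ, by rw [← h2, Homeomorph.apply_symm_apply], h1⟩

/-- The point `α a a a ⋯`. -/
def eventuallyConst (α : List Bool) (a : Bool) : Cantor := prepend α fun _ => a

/-- The points that end in `000⋯` or in `111⋯`. -/
def endPoints : Set Cantor := {p | ∃ (α : List Bool) (a : Bool), p = eventuallyConst α a}

/-- The graph of the partial map `L_p`, for a point `p = α a a a ⋯`: it is the prefix replacement
`α a ψ ↦ α ψ`.  (The maps for different ways of writing `p` as `α a a a ⋯` agree where they are both
defined.) -/
def IsL (p x y : Cantor) : Prop :=
  ∃ (α : List Bool) (a : Bool) (ψ : Cantor),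
    p = eventuallyConst α a ∧ x = prepend (α ++ [a]) ψ ∧ y = prepend α ψ

/-- `L_{f(p)} ∘ f` agrees with `f ∘ L_p` in a neighbourhood of `p` (in particular `p` and `f p` end
in `000⋯` or `111⋯`, so that `L_p` and `L_{f(p)}` make sense). -/
def CommutesWithShiftAt (f : Cantor → Cantor) (p : Cantor) : Prop :=
  ∀ᶠ x in 𝓝 p, ∃ y, IsL p x y ∧ IsL (f p) (f x) (f y)

/-- `f` preserves the lexicographic order in a neighbourhood of `p`. -/
def OrderPreservingAt (f : Cantor → Cantor) (p : Cantor) : Prop :=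
  ∃ U ∈ 𝓝 p, ∀ x ∈ U, ∀ y ∈ U, toLex x < toLex y → toLex (f x) < toLex (f y)

theorem IsL.coords {p x y : Cantor} (h : IsL p x y) : ∃ (n : ℕ) (a : Bool), (∀ k, n ≤ k → p k = a) ∧
    (∀ k, k < n → x k = p k) ∧ x n = a ∧ (∀ k, k < n → y k = p k) ∧ ∀ k, n ≤ k → y k = x (k + 1) := by
  obtain ⟨α, a, ψ, rfl, rfl, rfl⟩ := h
  refine ⟨α.length, a, fun k hk => ?_, fun k hk => ?_, ?_, fun k hk => ?_, fun k hk => ?_⟩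
  · simp [eventuallyConst, prepend, not_lt.2 hk]
  · simp [eventuallyConst, prepend, hk, Nat.lt_succ_of_lt hk]
  · simp [prepend]
  · simp [eventuallyConst, prepend, hk]
  · simp [prepend, not_lt.2 hk]

/-- `L_p` is a well-defined partial map. -/
theorem IsL.unique {p x y z : Cantor} (hy : IsL p x y) (hz : IsL p x z) : y = z := by
  obtain ⟨n, a, h1, h2, h3, h4, h5⟩ := hy.coords
  obtain ⟨m, b, g1, g2, g3, g4, g5⟩ := hz.coords
  have key : ∀ (n m : ℕ) (a b : Bool) (y z : Cantor), n ≤ m → (∀ k, n ≤ k → p k = a) →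
      (∀ k, k < n → y k = p k) → (∀ k, n ≤ k → y k = x (k + 1)) →
      (∀ k, m ≤ k → p k = b) → (∀ k, k < m → x k = p k) → x m = b →
      (∀ k, k < m → z k = p k) → (∀ k, m ≤ k → z k = x (k + 1)) → y = z := by
    intro n m a b y z hnm h1 h4 h5 g1 g2 g3 g4 g5
    have hab : a = b := (h1 m hnm).symm.trans (g1 m le_rfl)
    funext k
    rcases lt_or_ge k n with hk | hk
    · rw [h4 k hk, g4 k (by omega)]
    · rcases lt_or_ge k m with hk' | hk'
      · rw [h5 k hk, g4 k hk', h1 k hk]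
        rcases Nat.lt_or_ge (k + 1) m with h | h
        · rw [g2 _ h, h1 _ (by omega)]
        · rw [show k + 1 = m by omega, g3, hab]
      · rw [h5 k hk, g5 k hk']
  rcases le_total n m with h | h
  · exact key n m a b y z h h1 h4 h5 g1 g2 g3 g4 g5
  · exact (key m n b a z y h g1 g4 g5 h1 h2 h3 h4 h5).symm

theorem CommutesWithShiftAt.mem {f : Cantor → Cantor} {p : Cantor} (h : CommutesWithShiftAt f p) :
    p ∈ endPoints ∧ f p ∈ endPoints := by
  obtain ⟨y, ⟨α, a, -, h1, -⟩, ⟨β, b, -, h2, -⟩⟩ := h.self_of_nhds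
  exact ⟨⟨α, a, h1⟩, ⟨β, b, h2⟩⟩

theorem prepend_mem_endPoints {α : List Bool} {ψ : Cantor} :
    prepend α ψ ∈ endPoints ↔ ψ ∈ endPoints := by
  have key : ∀ x : Cantor, x ∈ endPoints ↔ ∃ (n : ℕ) (a : Bool), ∀ k, n ≤ k → x k = a := by
    intro x
    constructor
    · rintro ⟨α, a, rfl⟩
      exact ⟨α.length, a, fun k hk => by simp [eventuallyConst, prepend, not_lt.2 hk]⟩
    · rintro ⟨n, a, h⟩
      refine ⟨List.ofFn fun i : Fin n => x i, a, ?_⟩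
      funext k
      by_cases hk : k < n
      · simp [eventuallyConst, prepend, hk]
      · simp [eventuallyConst, prepend, hk, h k (not_lt.1 hk)]
  rw [key, key]
  constructor
  · rintro ⟨n, a, h⟩
    refine ⟨n, a, fun k hk => ?_⟩
    have := h (k + α.length) (by omega)
    simpa [prepend] using this
  · rintro ⟨n, a, h⟩
    refine ⟨n + α.length, a, fun k hk => ?_⟩
    have h1 : ¬ k < α.length := by omega
    simpa [prepend, h1] using h _ (by omega)

theorem prepend_lt_prepend {α : List Bool} {ψ φ : Cantor} :
    toLex (prepend α ψ) < toLex (prepend α φ) ↔ toLex ψ < toLex φ := by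
  have key : ∀ ψ φ : Cantor, toLex ψ < toLex φ → toLex (prepend α ψ) < toLex (prepend α φ) := by
    rintro ψ φ ⟨i, h1, h2⟩
    refine ⟨i + α.length, fun j hj => ?_, ?_⟩
    · change prepend α ψ j = prepend α φ j
      by_cases hjα : j < α.length
      · simp [prepend, hjα]
      · simpa [prepend, hjα] using h1 (j - α.length) (by omega)
    · change prepend α ψ _ < prepend α φ _
      simpa [prepend] using h2
  refine ⟨fun h => ?_, key ψ φ⟩
  rcases lt_trichotomy (toLex ψ) (toLex φ) with h1 | h1 | h1
  · exact h1
  · rw [show ψ = φ from h1] at h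
    exact absurd h (lt_irrefl _)
  · exact absurd h (key φ ψ h1).asymm

theorem continuous_prepend (α : List Bool) : Continuous (prepend α) := by
  refine continuous_pi fun k => ?_
  by_cases h : k < α.length
  · simp only [prepend, h, dif_pos]; exact continuous_const
  · simp only [prepend, h, dif_neg, not_false_eq_true]; exact continuous_apply _

theorem IsPrefixReplacementAt.mem_endPoints_iff {f : Cantor → Cantor} {p : Cantor}
    (h : IsPrefixReplacementAt f p) : f p ∈ endPoints ↔ p ∈ endPoints := by
  obtain ⟨α, β, h⟩ := h
  obtain ⟨ψ, h1, h2⟩ := h.self_of_nhds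
  rw [h2, h1, prepend_mem_endPoints, prepend_mem_endPoints]

theorem IsPrefixReplacementAt.orderPreservingAt {f : Cantor → Cantor} {p : Cantor}
    (h : IsPrefixReplacementAt f p) : OrderPreservingAt f p := by
  obtain ⟨α, β, h⟩ := h
  refine ⟨_, h, ?_⟩
  rintro x ⟨ψ, rfl, h1⟩ y ⟨φ, rfl, h2⟩ hxy
  rw [h1, h2]
  exact prepend_lt_prepend.2 (prepend_lt_prepend.1 hxy)

theorem IsPrefixReplacementAt.commutesWithShiftAt {f : Cantor → Cantor} {p : Cantor}
    (h : IsPrefixReplacementAt f p) (hp : p ∈ endPoints) : CommutesWithShiftAt f p := by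
  obtain ⟨α, β, h⟩ := h
  obtain ⟨ψ₀, rfl, h2⟩ := h.self_of_nhds
  obtain ⟨γ, a, hγ⟩ := prepend_mem_endPoints.1 hp
  subst hγ
  rw [eventuallyConst, ← prepend_append] at h
  have hopen : ∀ᶠ x in 𝓝 (prepend (α ++ γ) fun _ => a),
      ∃ φ, x = prepend (α ++ γ ++ [a]) φ := by
    have h1 : ∀ᶠ x : Cantor in 𝓝 (prepend (α ++ γ) fun _ => a), ∀ k ∈ Finset.range
        (α ++ γ ++ [a]).length, x k = prepend (α ++ γ) (fun _ => a) k := by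
      rw [Filter.eventually_all_finset]
      intro k _
      exact (continuous_apply k).tendsto _ |>.eventually
        ((isOpen_discrete {prepend (α ++ γ) (fun _ => a) k}).mem_nhds rfl)
    filter_upwards [h1] with x hx
    refine ⟨fun k => x (k + (α ++ γ ++ [a]).length), ?_⟩
    have e : (prepend (α ++ γ) fun _ => a) = prepend (α ++ γ ++ [a]) fun _ => a := by
      rw [prepend_append (α ++ γ) [a]]
      congr 1
      funext k
      by_cases hk : k < [a].length
      · have : k = 0 := by simpa using hk
        subst this; simp [prepend]
      · simp [prepend]
    funext k
    by_cases hk : k < (α ++ γ ++ [a]).length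
    · rw [hx k (Finset.mem_range.2 hk), e]
      simp only [prepend, hk, dif_pos]
    · simp only [prepend, hk, dif_neg, not_false_eq_true]
      congr 1; omega
  have hlift : Tendsto (fun φ : Cantor => prepend (α ++ γ) φ) (𝓝 fun _ => a)
      (𝓝 (prepend (α ++ γ) fun _ => a)) := (continuous_prepend _).tendsto _
  rw [CommutesWithShiftAt, eventuallyConst, ← prepend_append]
  have hfp : f (prepend (α ++ γ) fun _ => a) = eventuallyConst (β ++ γ) a := by
    rw [prepend_append, eventuallyConst, prepend_append β]; exact h2
  -- the values of `f` on the whole cone near `p` are needed at `x` and at `L_p x`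
  have htail : ∀ᶠ x : Cantor in 𝓝 (prepend (α ++ γ) fun _ => a),
      ∀ φ, x = prepend (α ++ γ ++ [a]) φ →
        ∃ ψ, prepend (α ++ γ) φ = prepend α ψ ∧ f (prepend (α ++ γ) φ) = prepend β ψ := by
    have hdel : Continuous fun x : Cantor =>
        prepend (α ++ γ) fun k => x (k + (α ++ γ ++ [a]).length) :=
      (continuous_prepend _).comp (continuous_pi fun k => continuous_apply _)
    have ht := hdel.tendsto (prepend (α ++ γ) fun _ => a)
    have e : (fun k => prepend (α ++ γ) (fun _ => a) (k + (α ++ γ ++ [a]).length))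
        = fun _ => a := by
      funext k
      have : ¬ k + (α ++ γ ++ [a]).length < (α ++ γ).length := by simp; omega
      simp only [prepend, this, dif_neg, not_false_eq_true]
    rw [e] at ht
    filter_upwards [ht.eventually h] with x hx φ hφ
    have e2 : (fun k => x (k + (α ++ γ ++ [a]).length)) = φ := by
      funext k
      rw [hφ]
      simp only [prepend]
      rw [dif_neg (by omega)]
      congr 1; omega
    rwa [e2] at hx
  filter_upwards [h, hopen, htail]
  rintro x ⟨ψ, hx1, hx2⟩ ⟨φ, hφ⟩ ht
  obtain ⟨ψ', hy1, hy2⟩ := ht φ hφ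
  refine ⟨prepend (α ++ γ) φ, ⟨α ++ γ, a, φ, rfl, hφ, rfl⟩, β ++ γ, a, φ, hfp, ?_, ?_⟩
  · rw [hx2]
    rw [hφ, List.append_assoc, prepend_append] at hx1
    rw [List.append_assoc, prepend_append, prepend_injective α hx1]
  · rw [prepend_append] at hy1
    rw [hy2, prepend_append, prepend_injective α hy1]

/-- The conditions that define `V𝒜`. -/
def MemVA (f : Cantor ≃ₜ Cantor) : Prop :=
  (sing ThompsonV f).Finite ∧ sing ThompsonV f ⊆ endPoints ∧
    ∀ p ∈ sing ThompsonV f, OrderPreservingAt f p ∧ CommutesWithShiftAt f p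

theorem isPrefixReplacementAt_of_not_sing {f : Cantor ≃ₜ Cantor} {p : Cantor}
    (hp : p ∉ sing ThompsonV f) : IsPrefixReplacementAt f p := by
  simp only [sing, mem_ofPred_eq, not_not] at hp
  obtain ⟨b, hb, hfb⟩ := hp
  obtain ⟨α, β, h⟩ := hb p
  refine ⟨α, β, ?_⟩
  filter_upwards [hfb, h] with x h1 h2
  rwa [h1]

theorem MemVA.mem_endPoints_iff {f : Cantor ≃ₜ Cantor} (hf : MemVA f) (p : Cantor) :
    f p ∈ endPoints ↔ p ∈ endPoints := by
  by_cases hp : p ∈ sing ThompsonV f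
  · exact iff_of_true (hf.2.2 p hp).2.mem.2 (hf.2.1 hp)
  · exact (isPrefixReplacementAt_of_not_sing hp).mem_endPoints_iff

theorem MemVA.orderPreservingAt {f : Cantor ≃ₜ Cantor} (hf : MemVA f) (p : Cantor) :
    OrderPreservingAt f p := by
  by_cases hp : p ∈ sing ThompsonV f
  · exact (hf.2.2 p hp).1
  · exact (isPrefixReplacementAt_of_not_sing hp).orderPreservingAt

theorem MemVA.commutesWithShiftAt {f : Cantor ≃ₜ Cantor} (hf : MemVA f) {p : Cantor}
    (hpe : p ∈ endPoints) : CommutesWithShiftAt f p := by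
  by_cases hp : p ∈ sing ThompsonV f
  · exact (hf.2.2 p hp).2
  · exact (isPrefixReplacementAt_of_not_sing hp).commutesWithShiftAt hpe

/-- The group `V𝒜`: the homeomorphisms `f` of the Cantor set with finitely many singular points
relative to `V`, each of which ends in `000⋯` or `111⋯`, such that near each singular point `p` the
map `f` preserves the lexicographic order and `L_{f(p)} ∘ f` agrees with `f ∘ L_p`. -/
def GroupVA : Subgroup (Cantor ≃ₜ Cantor) where
  carrier := {f | MemVA f}
  one_mem' := by simp [MemVA, sing_of_mem (one_mem ThompsonV)]
  mul_mem' := by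
    intro f g hf hg
    have hsub : sing ThompsonV (f * g) ⊆ endPoints := by
      refine (sing_mul_subset _ f g).trans (union_subset hg.2.1 ?_)
      rintro _ ⟨p, hp, rfl⟩
      rw [← hg.mem_endPoints_iff, Homeomorph.apply_symm_apply]
      exact hf.2.1 hp
    refine ⟨(hg.1.union (hf.1.image _)).subset (sing_mul_subset _ f g), hsub, fun p hp => ⟨?_, ?_⟩⟩
    · obtain ⟨U, hU, h1⟩ := hg.orderPreservingAt p
      obtain ⟨W, hW, h2⟩ := hf.orderPreservingAt (g p)
      refine ⟨U ∩ g ⁻¹' W, inter_mem hU (g.continuous.tendsto p hW), ?_⟩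
      rintro x ⟨hxU, hxW⟩ y ⟨hyU, hyW⟩ hxy
      exact h2 _ hxW _ hyW (h1 x hxU y hyU hxy)
    · have hpe := hsub hp
      have h1 := hf.commutesWithShiftAt ((hg.mem_endPoints_iff p).2 hpe)
      unfold CommutesWithShiftAt
      filter_upwards [hg.commutesWithShiftAt hpe, (g.continuous.tendsto p).eventually h1]
      rintro x ⟨y, hy, hgy⟩ ⟨z, hz, hfz⟩
      obtain rfl := hgy.unique hz
      exact ⟨y, hy, hfz⟩
  inv_mem' := by
    intro f hf
    have hsub : sing ThompsonV f⁻¹ ⊆ endPoints := by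
      refine (sing_inv_subset _ f).trans ?_
      rintro _ ⟨p, hp, rfl⟩
      exact (hf.mem_endPoints_iff p).2 (hf.2.1 hp)
    refine ⟨(hf.1.image _).subset (sing_inv_subset _ f), hsub, fun p hp => ⟨?_, ?_⟩⟩
    · obtain ⟨U, hU, h1⟩ := hf.orderPreservingAt (f.symm p)
      refine ⟨f.symm ⁻¹' U, f.symm.continuous.tendsto p hU, fun x hx y hy hxy => ?_⟩
      simp only [Homeomorph.inv_apply]
      rcases lt_trichotomy (toLex (f.symm x)) (toLex (f.symm y)) with h | h | h
      · exact h
      · have : x = y := f.symm.injective h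
        subst this
        exact absurd hxy (lt_irrefl _)
      · have := h1 _ hy _ hx h
        rw [Homeomorph.apply_symm_apply, Homeomorph.apply_symm_apply] at this
        exact absurd hxy this.asymm
    · have hpe : f.symm p ∈ endPoints := by
        rw [← hf.mem_endPoints_iff, Homeomorph.apply_symm_apply]; exact hsub hp
      have h1 := hf.commutesWithShiftAt hpe
      unfold CommutesWithShiftAt
      filter_upwards [(f.symm.continuous.tendsto p).eventually h1]
      rintro x ⟨y, hy, hfy⟩
      rw [Homeomorph.apply_symm_apply, Homeomorph.apply_symm_apply] at hfy
      refine ⟨f y, hfy, ?_⟩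
      simpa using hy

/-- The points moved by a homeomorphism, closed up: its support. -/
def homeoSupport {X : Type} [TopologicalSpace X] (f : X ≃ₜ X) : Set X := closure {x | f x ≠ x}

/-! Three constructions are combined: compatible roots of the unit translation, copies of the line
inside small intervals, and divisibility of `ℚ` and `ℚ / ℤ`.

Roots. For every `m > 0` some dyadic piecewise-linear `P` satisfies `P (t + 1) = P t + m`, because
any two intervals with dyadic endpoints are related by a dyadic piecewise-linear map. Composing
inverses of such maps gives conjugates `g n` of the unit translation with `g (n + 1) ^ (n + 1) = g
n`, hence an action of `ℚ` on the line in which `1` is the unit translation (`exists_rat_action`).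
Its elements commute with that translation, so they lie in `𝒜`. They are lifts of elements of `T`;
read on binary expansions they lie in `V`, and the integers are exactly what becomes trivial there,
which gives `ℚ / ℤ` in `V`.

Copies of `𝒜`. The map `theta` identifies the line with `(0, 1)` so that the unit translation
becomes, near the two ends, multiplication by `2` or by `1 / 2` about the endpoint. Commuting with
the translation near infinity therefore turns into commuting with doubling at the endpoints
(`insertHom_doubling_left`, `insertHom_doubling_right`). An element of `𝒜` inserted into a dyadic
interval of the circle can be singular only at the two endpoints, and satisfies the condition of
`T𝒜` there.

Passage to the Cantor set. A point of the Cantor set is a real number modulo `1` together with a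
side, which matters only at dyadic numbers. Increasing lifts that preserve the dyadic numbers act on
such pairs (`cantorHom`). Affine germs become prefix replacements, and doubling about a dyadic point
becomes the map `L_p`, so the same inserted maps lie in `V𝒜`. Copies of `V` are placed directly in
cones.

Direct sums. Maps with disjoint supports commute, and a product of them is determined by its
restrictions, so the copies assemble into a direct sum (`exists_directSum_hom`). For the abelian
groups, a torsion-free group sits in its divisible hull, a rational vector space. A general
countable group is exhausted by adding one generator at a time, and each new cyclic quotient is
detected by a homomorphism to `ℚ ⊕ ℚ / ℤ` because that group is divisible. -/

/-! ### Dyadic piecewise-linear maps of the line -/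

/-- `f` is dyadic piecewise-linear at `x`; the pointwise form of `IsDyadicPL` on the line. -/
def DyadicPLAt (f : ℝ → ℝ) (x : ℝ) : Prop :=
  ∃ (m n : ℤ) (b c : ℝ), b ∈ dyadics ∧ c ∈ dyadics ∧
    (∀ᶠ t in 𝓝[≤] x, f t = 2 ^ m * t + b) ∧
    (∀ᶠ t in 𝓝[≥] x, f t = 2 ^ n * t + c) ∧
    (x ∉ dyadics → m = n ∧ b = c)

theorem DyadicPLAt.congr {f g : ℝ → ℝ} {x : ℝ} (hf : DyadicPLAt f x) (h : ∀ᶠ t in 𝓝 x, g t = f t) :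
    DyadicPLAt g x := by
  obtain ⟨m, n, b, c, hb, hc, hl, hr, hx⟩ := hf
  refine ⟨m, n, b, c, hb, hc, ?_, ?_, hx⟩
  · filter_upwards [hl, nhdsWithin_le_nhds h] with t h1 h2
    rw [h2, h1]
  · filter_upwards [hr, nhdsWithin_le_nhds h] with t h1 h2
    rw [h2, h1]

theorem dyadicPLAt_affine (m : ℤ) {b : ℝ} (hb : b ∈ dyadics) (x : ℝ) :
    DyadicPLAt (fun t => 2 ^ m * t + b) x :=
  ⟨m, m, b, b, hb, hb, Eventually.of_forall fun _ => rfl, Eventually.of_forall fun _ => rfl,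
    fun _ => ⟨rfl, rfl⟩⟩

theorem dyadicPLAt_id (x : ℝ) : DyadicPLAt (fun t => t) x :=
  IsDyadicPL.id (fun t : ℝ => t) x

/-- Slopes are positive, so left germs compose with left germs and right germs with right germs.
Away from dyadic points the image is not dyadic either, and both pairs of germs coincide. -/
theorem DyadicPLAt.comp {f g : ℝ → ℝ} {x : ℝ} (hf : DyadicPLAt f (g x)) (hg : DyadicPLAt g x) :
    DyadicPLAt (fun t => f (g t)) x := by
  obtain ⟨m, n, b, c, hb, hc, hl, hr, hx⟩ := hg
  obtain ⟨m₁, n₁, b₁, c₁, hb₁, hc₁, hl₁, hr₁, hx₁⟩ := hf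
  have e1 : g x = 2 ^ m * x + b := hl.self_of_nhdsWithin self_mem_Iic
  have e2 : g x = 2 ^ n * x + c := hr.self_of_nhdsWithin self_mem_Ici
  rw [e1] at hl₁
  rw [e2] at hr₁
  refine ⟨m₁ + m, n₁ + n, 2 ^ m₁ * b + b₁, 2 ^ n₁ * c + c₁,
    add_mem (mul_mem (two_zpow_mem_dyadics _) hb) hb₁,
    add_mem (mul_mem (two_zpow_mem_dyadics _) hc) hc₁, ?_, ?_, fun h => ?_⟩
  · filter_upwards [hl, (tendsto_affine_le m b x).eventually hl₁] with t h1 h2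
    rw [h1, h2, zpow_add₀ two_ne_zero]; ring
  · filter_upwards [hr, (tendsto_affine_ge n c x).eventually hr₁] with t h1 h2
    rw [h1, h2, zpow_add₀ two_ne_zero]; ring
  · obtain ⟨rfl, rfl⟩ := hx h
    obtain ⟨rfl, rfl⟩ := hx₁ (by rwa [e1, affine_mem_dyadics_iff hb])
    exact ⟨rfl, rfl⟩

theorem affine_symm (n : ℤ) (b t : ℝ) :
    2 ^ n * (2 ^ (-n) * t + -(2 ^ (-n) * b)) + b = t := by
  have h0 : (2 : ℝ) ^ n ≠ 0 := by positivity
  rw [zpow_neg]; field_simp; ring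

theorem symm_affine (n : ℤ) (b t : ℝ) :
    2 ^ (-n) * (2 ^ n * t + b) + -(2 ^ (-n) * b) = t := by
  have h0 : (2 : ℝ) ^ n ≠ 0 := by positivity
  rw [zpow_neg]; field_simp; ring

/-- The inverse of each one-sided affine germ of `f` carries a one-sided neighbourhood of `f x` into
one of `x`, and there the left inverse property determines `g`. Surjectivity of `f` plays no role,
which allows `g` to be the inverse of a chart. -/
theorem DyadicPLAt.of_leftInverse {f g : ℝ → ℝ} {x : ℝ} (hf : DyadicPLAt f x)
    (h : ∀ᶠ t in 𝓝 x, g (f t) = t) : DyadicPLAt g (f x) := by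
  obtain ⟨m, n, b, c, hb, hc, hl, hr, hx⟩ := hf
  have e1 : f x = 2 ^ m * x + b := hl.self_of_nhdsWithin self_mem_Iic
  have e2 : f x = 2 ^ n * x + c := hr.self_of_nhdsWithin self_mem_Ici
  refine ⟨-m, -n, -(2 ^ (-m) * b), -(2 ^ (-n) * c),
    neg_mem (mul_mem (two_zpow_mem_dyadics _) hb),
    neg_mem (mul_mem (two_zpow_mem_dyadics _) hc), ?_, ?_, fun hy => ?_⟩
  · have := tendsto_affine_le (-m) (-(2 ^ (-m) * b)) (f x)
    rw [e1, symm_affine] at this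
    rw [e1]
    filter_upwards [this.eventually hl, this.eventually (nhdsWithin_le_nhds h)] with t h1 h2
    rwa [h1, affine_symm] at h2
  · have := tendsto_affine_ge (-n) (-(2 ^ (-n) * c)) (f x)
    rw [e2, symm_affine] at this
    rw [e2]
    filter_upwards [this.eventually hr, this.eventually (nhdsWithin_le_nhds h)] with t h1 h2
    rwa [h1, affine_symm] at h2
  · rw [e1, affine_mem_dyadics_iff hb] at hy
    obtain ⟨rfl, rfl⟩ := hx hy
    exact ⟨rfl, rfl⟩

theorem DyadicPLAt.mem_dyadics_iff {f : ℝ → ℝ} {x : ℝ} (hf : DyadicPLAt f x) :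
    f x ∈ dyadics ↔ x ∈ dyadics := by
  obtain ⟨m, n, b, c, hb, hc, hl, hr, hx⟩ := hf
  rw [show f x = 2 ^ m * x + b from hl.self_of_nhdsWithin self_mem_Iic, affine_mem_dyadics_iff hb]

/-- Dyadic piecewise-linear maps can be glued along intervals with dyadic endpoints. -/
theorem dyadicPLAt_of_eqOn_Icc {f : ℝ → ℝ} {x : ℝ}
    (hl : ∃ u v : ℝ, u < x ∧ x ≤ v ∧ ∃ F, DyadicPLAt F x ∧ EqOn f F (Icc u v))
    (hr : ∃ u v : ℝ, u ∈ dyadics ∧ u ≤ x ∧ x < v ∧ ∃ F, DyadicPLAt F x ∧ EqOn f F (Icc u v)) :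
    DyadicPLAt f x := by
  by_cases hx : x ∈ dyadics
  · obtain ⟨u, v, hux, hxv, F, ⟨m, -, b, -, hb, -, hF, -⟩, hf⟩ := hl
    obtain ⟨u', v', -, hux', hxv', F', ⟨-, n, -, c, -, hc, -, hF', -⟩, hf'⟩ := hr
    refine ⟨m, n, b, c, hb, hc, ?_, ?_, fun h => absurd hx h⟩
    · filter_upwards [hF, self_mem_nhdsWithin, nhdsWithin_le_nhds (lt_mem_nhds hux)]
        with t h1 (h2 : t ≤ x) h3
      rw [hf ⟨h3.le, h2.trans hxv⟩, h1]
    · filter_upwards [hF', self_mem_nhdsWithin, nhdsWithin_le_nhds (gt_mem_nhds hxv')]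
        with t h1 (h2 : x ≤ t) h3
      rw [hf' ⟨hux'.trans h2, h3.le⟩, h1]
  -- A nondyadic `x` cannot equal the dyadic left endpoint `u`, so the interval on the right is
  -- already a full neighbourhood of `x`.
  · obtain ⟨u, v, hu, hux, hxv, F, hF, hf⟩ := hr
    have hux : u < x := lt_of_le_of_ne hux (by rintro rfl; exact hx hu)
    exact hF.congr (by filter_upwards [Icc_mem_nhds hux hxv] with t ht using hf ht)

/-! ### Gluing, interpolation and periodic extension. -/

/-- The order isomorphism of the line that is `F` on the left of `v` and `G` on the right. -/
noncomputable def glueIso (F G : ℝ ≃o ℝ) (v : ℝ) (h : F v = G v) : ℝ ≃o ℝ :=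
  StrictMono.orderIsoOfSurjective (fun t => if t ≤ v then F t else G t)
    (by
      intro s t hst
      dsimp only
      split_ifs with h1 h2 h2
      · exact F.strictMono hst
      · exact ((F.le_iff_le.2 h1).trans h.le).trans_lt (G.strictMono (not_le.1 h2))
      · exact absurd (hst.le.trans h2) h1
      · exact G.strictMono hst)
    (by
      intro y
      by_cases hy : y ≤ F v
      · refine ⟨F.symm y, ?_⟩
        have : F.symm y ≤ v := by rwa [OrderIso.symm_apply_le]
        simp [this]
      · refine ⟨G.symm y, ?_⟩
        have : ¬ G.symm y ≤ v := by rwa [OrderIso.symm_apply_le, ← h]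
        simp [this])

theorem glueIso_apply (F G : ℝ ≃o ℝ) (v : ℝ) (h : F v = G v) (t : ℝ) :
    glueIso F G v h t = if t ≤ v then F t else G t := rfl

theorem glueIso_of_le (F G : ℝ ≃o ℝ) {v : ℝ} (h : F v = G v) {t : ℝ} (ht : t ≤ v) :
    glueIso F G v h t = F t := by simp [glueIso_apply, ht]

theorem glueIso_of_ge (F G : ℝ ≃o ℝ) {v : ℝ} (h : F v = G v) {t : ℝ} (ht : v ≤ t) :
    glueIso F G v h t = G t := by
  rcases ht.eq_or_lt with rfl | ht
  · simp [glueIso_apply, h]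
  · simp [glueIso_apply, not_le.2 ht]

theorem dyadicPLAt_glueIso {F G : ℝ ≃o ℝ} {v : ℝ} (h : F v = G v) (hv : v ∈ dyadics) {x : ℝ}
    (hF : DyadicPLAt F x) (hG : DyadicPLAt G x) : DyadicPLAt (glueIso F G v h) x := by
  rcases lt_trichotomy x v with hx | rfl | hx
  · refine hF.congr ?_
    filter_upwards [gt_mem_nhds hx] with t ht using glueIso_of_le F G h ht.le
  · exact dyadicPLAt_of_eqOn_Icc
      ⟨x - 1, x, by linarith, le_rfl, F, hF, fun t ht => glueIso_of_le F G h ht.2⟩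
      ⟨x, x + 1, hv, le_rfl, by linarith, G, hG, fun t ht => glueIso_of_ge F G h ht.1⟩
  · refine hG.congr ?_
    filter_upwards [lt_mem_nhds hx] with t ht using glueIso_of_ge F G h ht.le

/-- The affine order isomorphism `t ↦ 2 ^ m * t + b`. -/
noncomputable def affineIso (m : ℤ) (b : ℝ) : ℝ ≃o ℝ where
  toFun t := 2 ^ m * t + b
  invFun t := 2 ^ (-m) * t + -(2 ^ (-m) * b)
  left_inv t := symm_affine m b t
  right_inv t := affine_symm m b t
  map_rel_iff' {s t} := by
    have : (0 : ℝ) < 2 ^ m := by positivity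
    simp [this]

theorem affineIso_apply (m : ℤ) (b t : ℝ) : affineIso m b t = 2 ^ m * t + b := rfl

theorem dyadicPLAt_affineIso (m : ℤ) {b : ℝ} (hb : b ∈ dyadics) (x : ℝ) :
    DyadicPLAt (affineIso m b) x := dyadicPLAt_affine m hb x

theorem two_mem_dyadics : (2 : ℝ) ∈ dyadics := by exact_mod_cast natCast_mem dyadics 2

/-- Any two intervals with dyadic endpoints are related by a dyadic piecewise-linear map. -/
theorem exists_dyadicPL_of_endpoints {a b c d : ℝ} (ha : a ∈ dyadics) (hb : b ∈ dyadics)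
    (hc : c ∈ dyadics) (hd : d ∈ dyadics) (hab : a < b) (hcd : c < d) :
    ∃ F : ℝ ≃o ℝ, (∀ x, DyadicPLAt F x) ∧ F a = c ∧ F b = d := by
  have hab' := sub_pos.2 hab
  have hcd' := sub_pos.2 hcd
  -- The average slope `(d - c) / (b - a)` lies between `2 ^ k` and `2 ^ (k + 1)`, so one break
  -- between these two slopes is enough.
  obtain ⟨k, hk1, hk2⟩ := exists_mem_Ico_zpow (div_pos hcd' hab') one_lt_two
  rw [le_div_iff₀ hab'] at hk1
  rw [div_lt_iff₀ hab', zpow_add₀ two_ne_zero, zpow_one] at hk2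
  have h0 : (0 : ℝ) < 2 ^ k := by positivity
  -- The break solves `2 ^ k * (w - a) + 2 ^ (k + 1) * (b - w) = d - c`.
  set w : ℝ := 2 * b - a - 2 ^ (-k) * (d - c) with hw
  have hwd : w ∈ dyadics := sub_mem (sub_mem (mul_mem two_mem_dyadics hb) ha)
    (mul_mem (two_zpow_mem_dyadics _) (sub_mem hd hc))
  have hkw : 2 ^ k * w = 2 ^ k * (2 * b - a) - (d - c) := by
    rw [hw, zpow_neg]; field_simp
  have haw : a ≤ w := by
    have : 2 ^ k * a ≤ 2 ^ k * w := by rw [hkw]; nlinarith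
    exact le_of_mul_le_mul_left this h0
  have hwb : w ≤ b := by
    have : 2 ^ k * w ≤ 2 ^ k * b := by rw [hkw]; nlinarith
    exact le_of_mul_le_mul_left this h0
  have hglue : affineIso k (c - 2 ^ k * a) w = affineIso (k + 1) (d - 2 ^ (k + 1) * b) w := by
    rw [affineIso_apply, affineIso_apply, zpow_add₀ two_ne_zero, zpow_one]
    linear_combination -hkw
  refine ⟨glueIso _ _ w hglue, fun x => dyadicPLAt_glueIso _ hwd
    (dyadicPLAt_affineIso _ (sub_mem hc (mul_mem (two_zpow_mem_dyadics _) ha)) _)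
    (dyadicPLAt_affineIso _ (sub_mem hd (mul_mem (two_zpow_mem_dyadics _) hb)) _), ?_, ?_⟩
  · rw [glueIso_of_le _ _ _ haw, affineIso_apply]; ring
  · rw [glueIso_of_ge _ _ _ hwb, affineIso_apply]; ring

/-- The extension of the restriction of `F` to `[u, u + 1]` that satisfies
`f (t + 1) = f t + m`. -/
noncomputable def periodize (F : ℝ ≃o ℝ) (u m : ℝ) (h : F (u + 1) = F u + m) : ℝ ≃o ℝ :=
  have hm : 0 < m := by
    have := F.strictMono (lt_add_one u)
    linarith
  StrictMono.orderIsoOfSurjective (fun t => ⌊t - u⌋ * m + F (t - ⌊t - u⌋))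
    (by
      intro s t hst
      dsimp only
      have h1 := Int.floor_le (t - u)
      have h2 := Int.lt_floor_add_one (s - u)
      rcases (Int.floor_mono (sub_le_sub_right hst.le u)).eq_or_lt with he | hlt
      · rw [he]
        have := F.strictMono (sub_lt_sub_right hst (⌊t - u⌋ : ℝ))
        linarith
      · have h3 : (⌊s - u⌋ : ℝ) + 1 ≤ ⌊t - u⌋ := by exact_mod_cast hlt
        have h4 : F (s - ⌊s - u⌋) < F u + m := by
          rw [← h]; exact F.strictMono (by linarith)
        have h5 : F u ≤ F (t - ⌊t - u⌋) := F.monotone (by linarith)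
        nlinarith)
    (by
      intro y
      set k := ⌊(y - F u) / m⌋ with hk
      have h1 := Int.floor_le ((y - F u) / m)
      have h2 := Int.lt_floor_add_one ((y - F u) / m)
      rw [← hk, le_div_iff₀ hm] at h1
      rw [← hk, div_lt_iff₀ hm] at h2
      have h3 : u ≤ F.symm (y - k * m) := by rw [OrderIso.le_symm_apply]; linarith
      have h4 : F.symm (y - k * m) < u + 1 := by rw [OrderIso.symm_apply_lt, h]; linarith
      have h5 : ⌊k + F.symm (y - k * m) - u⌋ = k := by
        rw [Int.floor_eq_iff]; constructor <;> linarith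
      refine ⟨k + F.symm (y - k * m), ?_⟩
      simp only [h5]
      rw [add_sub_cancel_left, OrderIso.apply_symm_apply]; ring)

theorem periodize_apply (F : ℝ ≃o ℝ) (u m : ℝ) (h : F (u + 1) = F u + m) (t : ℝ) :
    periodize F u m h t = ⌊t - u⌋ * m + F (t - ⌊t - u⌋) := rfl

theorem periodize_add_one (F : ℝ ≃o ℝ) (u m : ℝ) (h : F (u + 1) = F u + m) (t : ℝ) :
    periodize F u m h (t + 1) = periodize F u m h t + m := by
  have : ⌊t + 1 - u⌋ = ⌊t - u⌋ + 1 := by rw [← Int.floor_add_one]; congr 1; ring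
  rw [periodize_apply, periodize_apply, this]
  push_cast
  rw [show t + 1 - ((⌊t - u⌋ : ℝ) + 1) = t - ⌊t - u⌋ by ring]
  ring

/-- The closed interval matters for gluing: at its right end the floor jumps, and the condition `h`
makes the two formulas agree. -/
theorem periodize_of_mem (F : ℝ ≃o ℝ) (u m : ℝ) (h : F (u + 1) = F u + m) {t : ℝ} {k : ℤ}
    (ht : t ∈ Icc (u + k) (u + k + 1)) : periodize F u m h t = k * m + F (t - k) := by
  rcases ht.2.eq_or_lt with rfl | h2
  · have : ⌊u + k + 1 - u⌋ = k + 1 := by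
      rw [Int.floor_eq_iff]; push_cast; constructor <;> linarith
    rw [periodize_apply, this]
    push_cast
    rw [show u + k + 1 - ((k : ℝ) + 1) = u by ring, show u + k + 1 - (k : ℝ) = u + 1 by ring, h]
    ring
  · have : ⌊t - u⌋ = k := by
      rw [Int.floor_eq_iff]; constructor <;> linarith [ht.1]
    rw [periodize_apply, this]

theorem dyadicPLAt_periodize {F : ℝ ≃o ℝ} {u m : ℝ} (h : F (u + 1) = F u + m)
    (hF : ∀ x, DyadicPLAt F x) (hu : u ∈ dyadics) (hm : m ∈ dyadics) (x : ℝ) :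
    DyadicPLAt (periodize F u m h) x := by
  have key : ∀ k : ℤ, DyadicPLAt (fun t => k * m + F (t - k)) x := by
    intro k
    have h1 := dyadicPLAt_affine 0 (neg_mem (intCast_mem dyadics k)) x
    have h2 := dyadicPLAt_affine 0 (mul_mem (intCast_mem dyadics k) hm)
    refine ((h2 _).comp ((hF _).comp h1)).congr (Eventually.of_forall fun t => ?_)
    simp only [zpow_zero, one_mul, ← sub_eq_add_neg]
    ring
  refine dyadicPLAt_of_eqOn_Icc ?_ ?_
  -- The ceiling gives a period interval that is open at its left end and contains `x`; the floor,
  -- below, gives one that contains points to the right of `x` and starts at a dyadic number.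
  · have h1 := Int.ceil_lt_add_one (x - u)
    have h2 := Int.le_ceil (x - u)
    refine ⟨u + (⌈x - u⌉ - 1 : ℤ), u + (⌈x - u⌉ - 1 : ℤ) + 1, ?_, ?_, _, key _,
      fun t ht => periodize_of_mem F u m h ht⟩ <;> push_cast <;> linarith
  · have h1 := Int.floor_le (x - u)
    have h2 := Int.lt_floor_add_one (x - u)
    exact ⟨u + ⌊x - u⌋, u + ⌊x - u⌋ + 1, add_mem hu (intCast_mem _ _), by linarith, by linarith, _,
      key _, fun t ht => periodize_of_mem F u m h ht⟩

theorem exists_dyadic_btwn {x y : ℝ} (h : x < y) : ∃ d ∈ dyadics, x < d ∧ d < y := by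
  obtain ⟨n, hn⟩ := exists_pow_lt_of_lt_one (sub_pos.2 h) (by norm_num : (1 / 2 : ℝ) < 1)
  have hp : (0 : ℝ) < (1 / 2) ^ n := by positivity
  refine ⟨(⌊x / (1 / 2) ^ n⌋ + 1) * (1 / 2) ^ n,
    mul_mem (add_mem (intCast_mem _ _) (one_mem _)) (pow_mem half_mem_dyadics n), ?_, ?_⟩
  · rw [← div_lt_iff₀ hp]; exact Int.lt_floor_add_one _
  · have := Int.floor_le (x / (1 / 2) ^ n)
    rw [le_div_iff₀ hp] at this
    linarith

/-- A dyadic piecewise-linear germ extends to a dyadic piecewise-linear order isomorphism. -/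
theorem DyadicPLAt.exists_orderIso {f : ℝ → ℝ} {x : ℝ} (hf : DyadicPLAt f x) :
    ∃ F : ℝ ≃o ℝ, (∀ y, DyadicPLAt F y) ∧ ∀ᶠ t in 𝓝 x, F t = f t := by
  obtain ⟨m, n, b, c, hb, hc, hl, hr, hx⟩ := hf
  have e1 : f x = 2 ^ m * x + b := hl.self_of_nhdsWithin self_mem_Iic
  have e2 : f x = 2 ^ n * x + c := hr.self_of_nhdsWithin self_mem_Ici
  have h : affineIso m b x = affineIso n c x := e1.symm.trans e2
  refine ⟨glueIso _ _ x h, fun y => ?_, ?_⟩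
  -- The gluing point is allowed to be nondyadic only because the two affine pieces are then the
  -- same.
  · by_cases hxd : x ∈ dyadics
    · exact dyadicPLAt_glueIso h hxd (dyadicPLAt_affineIso m hb y) (dyadicPLAt_affineIso n hc y)
    · obtain ⟨rfl, rfl⟩ := hx hxd
      refine (dyadicPLAt_affineIso m hb y).congr (Eventually.of_forall fun t => ?_)
      simp [glueIso_apply]
  · rw [← nhdsLE_sup_nhdsGE, eventually_sup]
    constructor
    · filter_upwards [hl, self_mem_nhdsWithin] with t h1 h2
      rw [glueIso_of_le _ _ h h2, h1, affineIso_apply]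
    · filter_upwards [hr, self_mem_nhdsWithin] with t h1 h2
      rw [glueIso_of_ge _ _ h h2, h1, affineIso_apply]

/-- A dyadic piecewise-linear germ extends to a lift of an element of Thompson's group `T`. -/
theorem DyadicPLAt.exists_periodic {f : ℝ → ℝ} {x : ℝ} (hf : DyadicPLAt f x) :
    ∃ F : ℝ ≃o ℝ, (∀ y, DyadicPLAt F y) ∧ (∀ t, F (t + 1) = F t + 1) ∧ ∀ᶠ t in 𝓝 x, F t = f t := by
  obtain ⟨F, hF, hFf⟩ := hf.exists_orderIso
  -- The margins of `1 / 2` ensure `v < u + 1` and `F v < F u + 1`. This leaves room for a map `G`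
  -- from `[v, u + 1]` onto `[F v, F u + 1]` that closes `F` on `[u, v]` up to one period.
  have hlt : ∀ᶠ y in 𝓝 x, x - 1 / 2 < y ∧ y < x + 1 / 2 ∧ F x - 1 / 2 < F y ∧ F y < F x + 1 / 2 :=
    (lt_mem_nhds (by linarith)).and ((gt_mem_nhds (by linarith)).and
      (((F.continuous.tendsto x).eventually (lt_mem_nhds (by linarith))).and
        ((F.continuous.tendsto x).eventually (gt_mem_nhds (by linarith)))))
  obtain ⟨δ, hδ, hball⟩ := Metric.eventually_nhds_iff.1 hlt
  obtain ⟨u, hu, hu1, hu2⟩ := exists_dyadic_btwn (show x - δ < x by linarith)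
  obtain ⟨v, hv, hv1, hv2⟩ := exists_dyadic_btwn (show x < x + δ by linarith)
  obtain ⟨a1, a2, a3, a4⟩ := hball (y := u) (by rw [Real.dist_eq, abs_lt]; constructor <;> linarith)
  obtain ⟨b1, b2, b3, b4⟩ := hball (y := v) (by rw [Real.dist_eq, abs_lt]; constructor <;> linarith)
  obtain ⟨G, hG, hG1, hG2⟩ := exists_dyadicPL_of_endpoints hv (add_mem hu (one_mem _))
    ((hF v).mem_dyadics_iff.2 hv) (add_mem ((hF u).mem_dyadics_iff.2 hu) (one_mem _))
    (by linarith : v < u + 1) (by linarith : F v < F u + 1)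
  have huv : u < v := by linarith
  have hper : glueIso F G v hG1.symm (u + 1) = glueIso F G v hG1.symm u + 1 := by
    rw [glueIso_of_ge F G hG1.symm (by linarith : v ≤ u + 1), glueIso_of_le F G hG1.symm huv.le, hG2]
  refine ⟨periodize _ u 1 hper, dyadicPLAt_periodize hper
    (fun y => dyadicPLAt_glueIso hG1.symm hv (hF y) (hG y)) hu (one_mem _),
    periodize_add_one _ u 1 hper, ?_⟩
  filter_upwards [hFf, Ioo_mem_nhds hu2 hv1] with t h1 h2
  rw [periodize_of_mem _ u 1 hper (k := 0) ⟨by simpa using h2.1.le, by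
    simp only [Int.cast_zero, add_zero]; linarith [h2.2]⟩]
  simp only [Int.cast_zero, zero_mul, zero_add, sub_zero]
  rw [glueIso_of_le F G hG1.symm h2.2.le, h1]

/-! ### Rational powers of the unit translation -/

/-- The dyadic piecewise-linear order isomorphisms of the line. -/
def DyadicIso : Subgroup (ℝ ≃o ℝ) where
  carrier := {f | ∀ x, DyadicPLAt f x}
  one_mem' x := dyadicPLAt_id x
  mul_mem' hf hg x := (hf _).comp (hg x)
  inv_mem' {f} hf x := by
    have := (hf (f.symm x)).of_leftInverse (g := f.symm)
      (Eventually.of_forall fun t => f.symm_apply_apply t)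
    rwa [f.apply_symm_apply] at this

/-- A sequence `g` with `g (n + 1) ^ (n + 1) = g n` in a group defines a homomorphism on `ℚ`, with
`p / n ! ↦ g n ^ p`. -/
theorem exists_rat_hom {K : Type*} [Group K] (g : ℕ → K) (hg : ∀ n, g (n + 1) ^ (n + 1) = g n) :
    ∃ i : Multiplicative ℚ →* K, ∀ (q : ℚ) (n : ℕ) (p : ℤ), q * (n.factorial : ℚ) = p →
      i (Multiplicative.ofAdd q) = g n ^ p := by
  have hstep : ∀ (n : ℕ) (p : ℤ), g (n + 1) ^ ((n + 1 : ℕ) * p) = g n ^ p := by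
    intro n p
    rw [zpow_mul, zpow_natCast, hg]
  have hpow : ∀ (n k : ℕ) (q : ℚ) (p r : ℤ), q * (n.factorial : ℚ) = p →
      q * ((n + k).factorial : ℚ) = r → g (n + k) ^ r = g n ^ p := by
    intro n k q p
    induction k with
    | zero =>
      intro r hp hr
      have : (p : ℚ) = r := by rw [← hp, ← hr, add_zero]
      rw [add_zero, Int.cast_injective this]
    | succ k ih =>
      intro r hp hr
      obtain ⟨d, hd⟩ := Nat.factorial_dvd_factorial (Nat.le_add_right n k)
      have hs : q * ((n + k).factorial : ℚ) = (p * d : ℤ) := by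
        rw [hd]; push_cast; rw [← hp]; ring
      have hr' : r = ((n + k + 1 : ℕ) : ℤ) * (p * d) := by
        have : (r : ℚ) = ((((n + k + 1 : ℕ) : ℤ) * (p * d) : ℤ) : ℚ) := by
          rw [Int.cast_mul, ← hs, ← hr, ← add_assoc, Nat.factorial_succ]; push_cast; ring
        exact_mod_cast this
      rw [← ih _ hp hs, ← add_assoc, hr', hstep]
  have hwell : ∀ (q : ℚ) (n m : ℕ) (p r : ℤ), q * (n.factorial : ℚ) = p →
      q * (m.factorial : ℚ) = r → g n ^ p = g m ^ r := by
    intro q n m p r hp hr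
    rcases le_total n m with h | h
    · obtain ⟨k, rfl⟩ := Nat.exists_eq_add_of_le h
      exact (hpow n k q p r hp hr).symm
    · obtain ⟨k, rfl⟩ := Nat.exists_eq_add_of_le h
      exact hpow m k q r p hr hp
  -- Every rational number, and every pair of them, becomes integral at a common factorial level, so
  -- the homomorphism property reduces to addition of exponents.
  have hint : ∀ (q : ℚ) (n : ℕ), q.den ≤ n → ∃ p : ℤ, q * (n.factorial : ℚ) = p := by
    intro q n hn
    obtain ⟨d, hd⟩ := Nat.dvd_factorial q.den_pos hn
    refine ⟨q.num * d, ?_⟩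
    rw [hd]; push_cast; rw [← mul_assoc, Rat.mul_den_eq_num]
  choose p hp using fun q : ℚ => hint q q.den le_rfl
  refine ⟨MonoidHom.mk' (fun q => g q.toAdd.den ^ p q.toAdd) fun q r => ?_,
    fun q n s hs => hwell q _ _ _ _ (hp q) hs⟩
  obtain ⟨a, ha⟩ := hint q.toAdd (q.toAdd.den + r.toAdd.den) (by omega)
  obtain ⟨b, hb⟩ := hint r.toAdd (q.toAdd.den + r.toAdd.den) (by omega)
  rw [hwell _ _ _ _ _ (hp q.toAdd) ha, hwell _ _ _ _ _ (hp r.toAdd) hb, ← zpow_add]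
  refine hwell _ _ _ _ _ (hp _) ?_
  rw [toAdd_mul, add_mul, ha, hb, Int.cast_add]

/-- A dyadic piecewise-linear map that conjugates the unit translation to the translation
by `m`. -/
theorem exists_conj_translation (m : ℕ) (hm : 0 < m) :
    ∃ P : ℝ ≃o ℝ, P ∈ DyadicIso ∧ P 0 = 0 ∧ ∀ t, P (t + 1) = P t + m := by
  obtain ⟨F, hF, h0, h1⟩ := exists_dyadicPL_of_endpoints (zero_mem dyadics) (one_mem dyadics)
    (zero_mem dyadics) (natCast_mem dyadics m) one_pos (by exact_mod_cast hm)
  have h : F (0 + 1) = F 0 + m := by rw [zero_add, h1, h0, zero_add]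
  refine ⟨periodize F 0 m h, dyadicPLAt_periodize h hF (zero_mem _) (natCast_mem dyadics m), ?_,
    periodize_add_one F 0 m h⟩
  rw [periodize_of_mem F 0 m h (k := 0) (by simp)]
  simp [h0]

/-- With `g n` the conjugate of the unit translation by `D n`, the last equation says `g (n + 1) ^
(n + 1) = g n`. It holds because `D (n + 1) = D n * (P n)⁻¹`, where `P n` conjugates the unit
translation to its `(n + 1)`-st power. Fixing `0` is what later yields injectivity. -/
theorem exists_conj_sequence : ∃ D : ℕ → (ℝ ≃o ℝ), (∀ n, D n ∈ DyadicIso) ∧ (∀ n, D n 0 = 0) ∧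
    D 0 = 1 ∧ ∀ n t, D (n + 1) (t + (n + 1 : ℕ)) = D n ((D n).symm (D (n + 1) t) + 1) := by
  choose P hP hP0 hP1 using fun n : ℕ => exists_conj_translation (n + 1) n.succ_pos
  refine ⟨fun n => Nat.rec 1 (fun n D => D * (P n)⁻¹) n, fun n => ?_, fun n => ?_, rfl,
    fun n t => ?_⟩
  · induction n with
    | zero => exact one_mem _
    | succ n ih => exact mul_mem ih (inv_mem (hP n))
  · induction n with
    | zero => rfl
    | succ n ih =>
      have : (P n).symm 0 = 0 := by rw [OrderIso.symm_apply_eq, hP0]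
      exact (congrArg _ this).trans ih
  · dsimp only
    set D : ℝ ≃o ℝ := Nat.rec 1 (fun n D => D * (P n)⁻¹) n
    change D ((P n).symm (t + (n + 1 : ℕ))) = D (D.symm (D ((P n).symm t)) + 1)
    rw [OrderIso.symm_apply_apply]
    congr 1
    rw [OrderIso.symm_apply_eq, hP1, OrderIso.apply_symm_apply]

/-- The translation by `1`. -/
noncomputable def unitTranslation : ℝ ≃o ℝ := OrderIso.addRight (1 : ℝ)

theorem unitTranslation_zpow_apply (k : ℤ) (t : ℝ) : (unitTranslation ^ k) t = t + k := by
  have hnat : ∀ (n : ℕ) (t : ℝ), (unitTranslation ^ n) t = t + n := by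
    intro n
    induction n with
    | zero => simp
    | succ n ih =>
      intro t
      rw [pow_succ, RelIso.mul_apply, ih]
      change t + 1 + n = _
      push_cast; ring
  rcases k with n | n
  · simpa using hnat n t
  · rw [zpow_negSucc]
    apply (unitTranslation ^ (n + 1)).injective
    rw [RelIso.apply_inv_self, hnat]
    push_cast; ring

theorem unitTranslation_mem : unitTranslation ∈ DyadicIso := fun x =>
  (dyadicPLAt_affine 0 (one_mem _) x).congr (Eventually.of_forall fun t => by
    change t + 1 = _; simp)

/-- `ℚ` acts on the line by dyadic piecewise-linear maps, with `1` acting as a translation. -/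
theorem exists_rat_action : ∃ i : Multiplicative ℚ →* DyadicIso,
    (∀ (k : ℤ) (t : ℝ), (i (Multiplicative.ofAdd (k : ℚ))).1 t = t + k) ∧
    ∀ q : ℚ, (i (Multiplicative.ofAdd q)).1 0 = 0 → q = 0 := by
  obtain ⟨D, hD, hD0, hD1, hDs⟩ := exists_conj_sequence
  have hmem : ∀ n, D n * unitTranslation * (D n)⁻¹ ∈ DyadicIso := fun n =>
    mul_mem (mul_mem (hD n) unitTranslation_mem) (inv_mem (hD n))
  obtain ⟨i, hi⟩ := exists_rat_hom (fun n => (⟨_, hmem n⟩ : DyadicIso)) (by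
    intro n
    ext t
    rw [Subgroup.coe_pow]
    dsimp only
    rw [conj_pow]
    have := unitTranslation_zpow_apply (n + 1 : ℕ) ((D (n + 1)).symm t)
    rw [zpow_natCast] at this
    change D (n + 1) ((unitTranslation ^ (n + 1)) ((D (n + 1)).symm t)) = D n ((D n).symm t + 1)
    rw [this, Int.cast_natCast, hDs, OrderIso.apply_symm_apply])
  have hval : ∀ (n : ℕ) (p : ℤ) (t : ℝ), ((⟨_, hmem n⟩ : DyadicIso) ^ p).1 t =
      D n ((D n).symm t + p) := by
    intro n p t
    rw [Subgroup.coe_zpow]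
    dsimp only
    rw [conj_zpow]
    change D n ((unitTranslation ^ p) ((D n).symm t)) = _
    rw [unitTranslation_zpow_apply]
  refine ⟨i, fun k t => ?_, fun q hq => ?_⟩
  · rw [hi k 0 k (by simp), hval, hD1]
    rfl
  -- At the level `n = q.den` the number `q` acts as a power `g n ^ p`. Since `D n` fixes `0`, this
  -- sends `0` to `D n p`, which is `0` only for `p = 0`.
  · obtain ⟨d, hd⟩ := Nat.dvd_factorial q.den_pos le_rfl
    have hqd : q * (q.den.factorial : ℚ) = (q.num * d : ℤ) := by
      rw [hd]; push_cast; rw [← mul_assoc, Rat.mul_den_eq_num]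
    rw [hi q q.den _ hqd, hval] at hq
    have h0 : (D q.den).symm 0 = 0 := by rw [OrderIso.symm_apply_eq, hD0]
    rw [h0, zero_add] at hq
    have h1 := (D q.den).injective (hq.trans (hD0 q.den).symm)
    rw [Int.cast_eq_zero] at h1
    rw [h1, Int.cast_zero] at hqd
    have : (q.den.factorial : ℚ) ≠ 0 := by exact_mod_cast Nat.factorial_ne_zero _
    exact (mul_eq_zero.1 hqd).resolve_right this

/-! ### The line as an open interval -/

/-- The piecewise-linear map that agrees with `t ↦ 2 ^ t` at the integers. -/
noncomputable def pwExp (t : ℝ) : ℝ := 2 ^ ⌊t⌋ * (1 + Int.fract t)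

theorem pwExp_pos (t : ℝ) : 0 < pwExp t := by
  have := Int.fract_nonneg t
  unfold pwExp; positivity

theorem pwExp_zero : pwExp 0 = 1 := by simp [pwExp]

theorem pwExp_add_one (t : ℝ) : pwExp (t + 1) = 2 * pwExp t := by
  rw [pwExp, pwExp, Int.floor_add_one, Int.fract_add_one, zpow_add₀ two_ne_zero, zpow_one]; ring

theorem pwExp_strictMono : StrictMono pwExp := by
  intro s t hst
  unfold pwExp
  rcases (Int.floor_mono hst.le).eq_or_lt with h | h
  · rw [← h]
    have : Int.fract s < Int.fract t := by
      rw [Int.fract, Int.fract, h]; linarith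
    have : (0 : ℝ) < 2 ^ ⌊s⌋ := by positivity
    nlinarith
  · have h1 : (2 : ℝ) ^ (⌊s⌋ + 1) ≤ 2 ^ ⌊t⌋ := zpow_le_zpow_right₀ one_le_two h
    rw [zpow_add₀ two_ne_zero, zpow_one] at h1
    have h2 : (0 : ℝ) < 2 ^ ⌊s⌋ := by positivity
    have h3 := Int.fract_lt_one s
    have h4 := Int.fract_nonneg t
    have h5 : (0 : ℝ) < 2 ^ ⌊t⌋ := by positivity
    nlinarith

theorem exists_pwExp_eq {y : ℝ} (hy : 0 < y) : ∃ t, pwExp t = y := by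
  obtain ⟨k, hk1, hk2⟩ := exists_mem_Ico_zpow hy one_lt_two
  have h2 : (0 : ℝ) < 2 ^ k := by positivity
  rw [zpow_add₀ two_ne_zero, zpow_one] at hk2
  have h3 : 1 ≤ y / 2 ^ k := by rwa [le_div_iff₀ h2, one_mul]
  have h4 : y / 2 ^ k < 2 := by rw [div_lt_iff₀ h2]; linarith
  have h5 : ⌊(k : ℝ) + (y / 2 ^ k - 1)⌋ = k := by
    rw [Int.floor_eq_iff]; constructor <;> linarith
  refine ⟨k + (y / 2 ^ k - 1), ?_⟩
  rw [pwExp, Int.fract, h5]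
  field_simp
  ring

theorem pwExp_of_mem {n : ℤ} {t : ℝ} (ht : t ∈ Icc (n : ℝ) (n + 1)) :
    pwExp t = 2 ^ n * (1 + (t - n)) := by
  rcases ht.2.eq_or_lt with rfl | h
  · rw [pwExp_add_one]
    simp [pwExp]; ring
  · have : ⌊t⌋ = n := Int.floor_eq_iff.2 ⟨ht.1, h⟩
    rw [pwExp, Int.fract, this]

/-- A dyadic piecewise-linear map from the line onto the interval `(0, 1)`, which near `-∞` and near
`∞` conjugates the unit translation to the homotheties with ratios `2` and `1 / 2` at the
endpoints. -/
noncomputable def theta (t : ℝ) : ℝ := if t ≤ 0 then pwExp t / 2 else 1 - pwExp (-t) / 2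

theorem theta_of_nonpos {t : ℝ} (ht : t ≤ 0) : theta t = pwExp t / 2 := if_pos ht

theorem theta_of_nonneg {t : ℝ} (ht : 0 ≤ t) : theta t = 1 - pwExp (-t) / 2 := by
  rcases ht.eq_or_lt with rfl | h
  · rw [theta_of_nonpos le_rfl, neg_zero, pwExp_zero]; norm_num
  · exact if_neg (not_le.2 h)

theorem theta_strictMono : StrictMono theta := by
  have key : ∀ t, t ≤ 0 → pwExp t ≤ 1 := fun t ht => by
    rw [← pwExp_zero]; exact pwExp_strictMono.monotone ht
  intro s t hst
  rcases le_or_gt t 0 with ht | ht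
  · rw [theta_of_nonpos ht, theta_of_nonpos (hst.le.trans ht)]
    linarith [pwExp_strictMono hst]
  · rcases le_or_gt s 0 with hs | hs
    · rw [theta_of_nonpos hs, theta_of_nonneg ht.le]
      have := pwExp_strictMono (neg_lt_zero.2 ht)
      rw [pwExp_zero] at this
      linarith [key s hs]
    · rw [theta_of_nonneg hs.le, theta_of_nonneg ht.le]
      linarith [pwExp_strictMono (neg_lt_neg hst)]

theorem theta_pos (t : ℝ) : 0 < theta t := by
  rcases le_total t 0 with ht | ht
  · rw [theta_of_nonpos ht]
    linarith [pwExp_pos t]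
  · rw [theta_of_nonneg ht]
    have := pwExp_strictMono.monotone (neg_nonpos.2 ht)
    rw [pwExp_zero] at this
    linarith

theorem theta_lt_one (t : ℝ) : theta t < 1 := by
  rcases le_total t 0 with ht | ht
  · rw [theta_of_nonpos ht]
    have := pwExp_strictMono.monotone ht
    rw [pwExp_zero] at this
    linarith
  · rw [theta_of_nonneg ht]
    linarith [pwExp_pos (-t)]

theorem exists_theta_eq {y : ℝ} (h0 : 0 < y) (h1 : y < 1) : ∃ t, theta t = y := by
  rcases le_total y (1 / 2) with h | h
  · obtain ⟨t, ht⟩ := exists_pwExp_eq (y := 2 * y) (by linarith)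
    have : t ≤ 0 := by rw [← pwExp_strictMono.le_iff_le, ht, pwExp_zero]; linarith
    exact ⟨t, by rw [theta_of_nonpos this, ht]; ring⟩
  · obtain ⟨t, ht⟩ := exists_pwExp_eq (y := 2 * (1 - y)) (by linarith)
    have : t ≤ 0 := by rw [← pwExp_strictMono.le_iff_le, ht, pwExp_zero]; linarith
    exact ⟨-t, by rw [theta_of_nonneg (neg_nonneg.2 this), neg_neg, ht]; ring⟩

/-- This formula and the next one turn translation near `-∞` and `∞` into the doubling germ at `0`
and the inverse of the doubling germ at `1`. -/
theorem theta_add_one_of_nonpos {t : ℝ} (ht : t + 1 ≤ 0) : theta (t + 1) = 2 * theta t := by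
  rw [theta_of_nonpos ht, theta_of_nonpos (by linarith), pwExp_add_one]; ring

theorem theta_add_one_of_nonneg {t : ℝ} (ht : 0 ≤ t) : theta (t + 1) = (1 + theta t) / 2 := by
  have := pwExp_add_one (-(t + 1))
  rw [show -(t + 1) + 1 = -t by ring] at this
  rw [theta_of_nonneg (by linarith), theta_of_nonneg ht, this]; ring

theorem dyadicPLAt_theta (x : ℝ) : DyadicPLAt theta x := by
  have key : ∀ n : ℤ, ∃ F, DyadicPLAt F x ∧ EqOn theta F (Icc (n : ℝ) (n + 1)) := by
    intro n
    have hmem : ∀ k : ℤ, (2 : ℝ) ^ k ∈ dyadics := two_zpow_mem_dyadics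
    have hn : (n : ℝ) ∈ dyadics := intCast_mem _ _
    rcases lt_or_ge n 0 with h | h
    · refine ⟨_, dyadicPLAt_affine (n - 1)
        (mul_mem (hmem (n - 1)) (sub_mem (one_mem _) hn)) x, fun t ht => ?_⟩
      have h1 : (n : ℝ) + 1 ≤ 0 := by exact_mod_cast h
      rw [theta_of_nonpos (ht.2.trans h1), pwExp_of_mem ht, zpow_sub₀ two_ne_zero, zpow_one]
      ring
    · refine ⟨_, dyadicPLAt_affine (-n - 2)
        (sub_mem (one_mem _) (mul_mem (hmem (-n - 2)) (add_mem two_mem_dyadics hn))) x,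
        fun t ht => ?_⟩
      have h1 : (0 : ℝ) ≤ n := by exact_mod_cast h
      -- Reflection takes `[n, n + 1]` to `[-n - 1, -n]`, where `pwExp` has slope `2 ^ (-n - 1)`;
      -- the factor `1 / 2` in `theta` lowers the exponent to `-n - 2`.
      rw [theta_of_nonneg (h1.trans ht.1), pwExp_of_mem (n := -n - 1)
        (by push_cast; constructor <;> linarith [ht.1, ht.2]), zpow_sub₀ two_ne_zero,
        zpow_sub₀ two_ne_zero, zpow_one]
      push_cast
      norm_num
      ring
  refine dyadicPLAt_of_eqOn_Icc ?_ ?_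
  · have h1 := Int.ceil_lt_add_one x
    have h2 := Int.le_ceil x
    obtain ⟨F, hF, hF'⟩ := key (⌈x⌉ - 1)
    refine ⟨(⌈x⌉ - 1 : ℤ), (⌈x⌉ - 1 : ℤ) + 1, ?_, ?_, F, hF, hF'⟩ <;> push_cast <;> linarith
  · obtain ⟨F, hF, hF'⟩ := key ⌊x⌋
    exact ⟨⌊x⌋, ⌊x⌋ + 1, intCast_mem _ _, Int.floor_le x, Int.lt_floor_add_one x, F, hF, hF'⟩

/-! ### Inserting homeomorphisms of the line into intervals -/

/-- The number `2 ^ (-(k + 1))`. -/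
noncomputable def width (k : ℕ) : ℝ := (1 / 2) ^ (k + 1)

theorem width_pos (k : ℕ) : 0 < width k := by unfold width; positivity

theorem width_le (k : ℕ) : width k ≤ 1 / 2 := by
  rw [width, pow_succ]
  have : (1 / 2 : ℝ) ^ k ≤ 1 := pow_le_one₀ (by norm_num) (by norm_num)
  linarith

theorem width_mem_dyadics (k : ℕ) : width k ∈ dyadics := pow_mem half_mem_dyadics _

theorem width_eq_zpow (k : ℕ) : width k = 2 ^ (-(k + 1 : ℕ) : ℤ) := by
  rw [width, zpow_neg, zpow_natCast, one_div, inv_pow]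

theorem two_mul_width_le {k l : ℕ} (h : k < l) : 2 * width l ≤ width k := by
  rw [width, width, pow_succ (1 / 2 : ℝ) l]
  have : (1 / 2 : ℝ) ^ l ≤ (1 / 2) ^ (k + 1) :=
    pow_le_pow_of_le_one (by norm_num) (by norm_num) h
  linarith

/-- The identification of the line with the interval between `j + width k` and
`j + 2 * width k`. -/
noncomputable def chart (k : ℕ) (j : ℤ) (r : ℝ) : ℝ := j + width k * (1 + theta r)

theorem chart_strictMono (k : ℕ) (j : ℤ) : StrictMono (chart k j) := fun s t h => by
  have := mul_lt_mul_of_pos_left (theta_strictMono h) (width_pos k)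
  unfold chart
  linarith

theorem lt_chart (k : ℕ) (j : ℤ) (r : ℝ) : j + width k < chart k j r := by
  have := mul_pos (width_pos k) (theta_pos r)
  unfold chart
  linarith

theorem chart_lt (k : ℕ) (j : ℤ) (r : ℝ) : chart k j r < j + 2 * width k := by
  have := mul_lt_mul_of_pos_left (theta_lt_one r) (width_pos k)
  unfold chart
  linarith

theorem exists_chart_eq {k : ℕ} {j : ℤ} {t : ℝ} (h1 : j + width k < t)
    (h2 : t < j + 2 * width k) : ∃ r, chart k j r = t := by
  have hw := width_pos k
  obtain ⟨r, hr⟩ := exists_theta_eq (y := (t - j - width k) / width k)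
    (div_pos (by linarith) hw) (by rw [div_lt_one hw]; linarith)
  refine ⟨r, ?_⟩
  rw [chart, hr]
  field_simp
  ring

theorem chart_add_one (k : ℕ) (j : ℤ) (r : ℝ) : chart k (j + 1) r = chart k j r + 1 := by
  unfold chart; push_cast; ring

/-- Since `2 * width k ≤ 1`, the interval with index `j` stays between `j` and `j + 1`, so different
indices give disjoint intervals. -/
theorem chart_injective {k : ℕ} {i j : ℤ} {r s : ℝ} (h : chart k i r = chart k j s) :
    i = j ∧ r = s := by
  have h1 := lt_chart k i r
  have h2 := lt_chart k j s
  have h3 := chart_lt k i r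
  have h4 := chart_lt k j s
  have h5 := width_le k
  have hij : i = j := by
    have h6 : (i : ℝ) < j + 1 := by linarith [width_pos k]
    have h7 : (j : ℝ) < i + 1 := by linarith [width_pos k]
    have h6 : i < j + 1 := by exact_mod_cast h6
    have h7 : j < i + 1 := by exact_mod_cast h7
    omega
  subst hij
  exact ⟨rfl, (chart_strictMono k i).injective h⟩

theorem dyadicPLAt_chart (k : ℕ) (j : ℤ) (r : ℝ) : DyadicPLAt (chart k j) r := by
  refine ((dyadicPLAt_affine (-(k + 1 : ℕ)) (add_mem (intCast_mem _ j) (width_mem_dyadics k)) _).comp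
    (dyadicPLAt_theta r)).congr (Eventually.of_forall fun t => ?_)
  rw [chart, ← width_eq_zpow]; ring

open Classical in
/-- The map that acts as `f` on each of the intervals that `chart k` identifies with the line, and is
the identity elsewhere. -/
noncomputable def insertFun (k : ℕ) (f : ℝ → ℝ) (t : ℝ) : ℝ :=
  if h : ∃ p : ℤ × ℝ, chart k p.1 p.2 = t then chart k h.choose.1 (f h.choose.2) else t

theorem insertFun_chart (k : ℕ) (f : ℝ → ℝ) (j : ℤ) (r : ℝ) :
    insertFun k f (chart k j r) = chart k j (f r) := by
  have h : ∃ p : ℤ × ℝ, chart k p.1 p.2 = chart k j r := ⟨(j, r), rfl⟩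
  obtain ⟨h1, h2⟩ := chart_injective h.choose_spec
  rw [insertFun, dif_pos h, h1, h2]

theorem insertFun_of_forall_ne {k : ℕ} (f : ℝ → ℝ) {t : ℝ} (h : ∀ j r, chart k j r ≠ t) :
    insertFun k f t = t := by
  rw [insertFun, dif_neg]
  rintro ⟨p, hp⟩
  exact h _ _ hp

theorem chart_cases (k : ℕ) (t : ℝ) : (∃ j r, t = chart k j r) ∨ ∀ j r, chart k j r ≠ t := by
  by_cases h : ∃ j r, t = chart k j r
  · exact Or.inl h
  · exact Or.inr fun j r hjr => h ⟨j, r, hjr.symm⟩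

theorem insertFun_comp (k : ℕ) (f g : ℝ → ℝ) (t : ℝ) :
    insertFun k f (insertFun k g t) = insertFun k (fun r => f (g r)) t := by
  rcases chart_cases k t with ⟨j, r, rfl⟩ | h
  · simp only [insertFun_chart]
  · simp only [insertFun_of_forall_ne _ h]

theorem insertFun_id (k : ℕ) (t : ℝ) : insertFun k (fun r => r) t = t := by
  rcases chart_cases k t with ⟨j, r, rfl⟩ | h
  · simp only [insertFun_chart]
  · simp only [insertFun_of_forall_ne _ h]

theorem insertFun_strictMono (k : ℕ) {f : ℝ → ℝ} (hf : StrictMono f) :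
    StrictMono (insertFun k f) := by
  -- A chart fills an open interval, so a point outside the charts lies beyond the whole interval.
  -- Comparing it with a chart point is then unaffected by moving the latter within its interval.
  have key1 : ∀ j r t, (∀ j r, chart k j r ≠ t) → chart k j r < t → j + 2 * width k ≤ t := by
    intro j r t h hlt
    by_contra hcon
    obtain ⟨r', hr'⟩ := exists_chart_eq ((lt_chart k j r).trans hlt) (not_le.1 hcon)
    exact h _ _ hr'
  have key2 : ∀ j r t, (∀ j r, chart k j r ≠ t) → t < chart k j r → t ≤ j + width k := by
    intro j r t h hlt
    by_contra hcon
    obtain ⟨r', hr'⟩ := exists_chart_eq (not_le.1 hcon) (hlt.trans (chart_lt k j r))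
    exact h _ _ hr'
  intro s t hst
  rcases chart_cases k s with ⟨i, q, rfl⟩ | hs <;> rcases chart_cases k t with ⟨j, r, rfl⟩ | ht
  · rw [insertFun_chart, insertFun_chart]
    have h1 := lt_chart k i q
    have h2 := chart_lt k j r
    have h3 := chart_lt k i (f q)
    have h4 := lt_chart k j (f r)
    have h5 := width_le k
    have h6 := width_pos k
    have hij : i ≤ j := by
      have : (i : ℝ) < j + 1 := by linarith
      have : i < j + 1 := by exact_mod_cast this
      omega
    rcases hij.eq_or_lt with rfl | hij
    · exact chart_strictMono k i (hf ((chart_strictMono k i).lt_iff_lt.1 hst))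
    · have : (i : ℝ) + 1 ≤ j := by exact_mod_cast hij
      linarith
  · rw [insertFun_chart, insertFun_of_forall_ne _ ht]
    exact (chart_lt k i _).trans_le (key1 i q t ht hst)
  · rw [insertFun_chart, insertFun_of_forall_ne _ hs]
    exact (key2 j r s hs hst).trans_lt (lt_chart k j _)
  · rwa [insertFun_of_forall_ne _ hs, insertFun_of_forall_ne _ ht]

/-- The homomorphism that inserts copies of an order isomorphism of the line into the intervals
described by `chart k`. -/
noncomputable def insertHom (k : ℕ) : (ℝ ≃o ℝ) →* (ℝ ≃o ℝ) :=
  MonoidHom.mk' (fun f =>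
    { toFun := insertFun k f
      invFun := insertFun k f.symm
      left_inv := fun t => by simp [insertFun_comp, insertFun_id]
      right_inv := fun t => by simp [insertFun_comp, insertFun_id]
      map_rel_iff' := (insertFun_strictMono k f.strictMono).le_iff_le })
    (fun f g => by ext t; exact (insertFun_comp k f g t).symm)

theorem insertHom_chart (k : ℕ) (f : ℝ ≃o ℝ) (j : ℤ) (r : ℝ) :
    insertHom k f (chart k j r) = chart k j (f r) := insertFun_chart k f j r

theorem insertHom_of_forall_ne {k : ℕ} (f : ℝ ≃o ℝ) {t : ℝ} (h : ∀ j r, chart k j r ≠ t) :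
    insertHom k f t = t := insertFun_of_forall_ne f h

/-! ### Lifts of circle maps and regularity of inserted maps. -/

/-- The order isomorphisms of the line that commute with the unit translation and preserve the set
of dyadic numbers. -/
def CircleLift : Subgroup (ℝ ≃o ℝ) where
  carrier := {f | (∀ t, f (t + 1) = f t + 1) ∧ ∀ t, f t ∈ dyadics ↔ t ∈ dyadics}
  one_mem' := ⟨fun _ => rfl, fun _ => Iff.rfl⟩
  mul_mem' {f g} hf hg := ⟨fun t => by simp only [RelIso.mul_apply, hg.1, hf.1],
    fun t => by simp only [RelIso.mul_apply, hf.2, hg.2]⟩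
  inv_mem' {f} hf := by
    refine ⟨fun t => ?_, fun t => ?_⟩
    · apply f.injective
      rw [hf.1, RelIso.apply_inv_self, RelIso.apply_inv_self]
    · rw [← hf.2, RelIso.apply_inv_self]

theorem CircleLift.map_add_int {f : ℝ ≃o ℝ} (hf : f ∈ CircleLift) (t : ℝ) (k : ℤ) :
    f (t + k) = f t + k := by
  induction k using Int.induction_on with
  | zero => simp
  | succ n ih =>
    have := hf.1 (t + (n : ℤ))
    push_cast at this ih ⊢
    rw [← add_assoc, this, ih, add_assoc]
  | pred n ih =>
    have := hf.1 (t + ((-n - 1 : ℤ) : ℝ))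
    push_cast at this ih ⊢
    rw [show t + (-(n : ℝ) - 1) + 1 = t + -n by ring, ih] at this
    linarith

theorem insertHom_add_one (k : ℕ) (f : ℝ ≃o ℝ) (t : ℝ) :
    insertHom k f (t + 1) = insertHom k f t + 1 := by
  rcases chart_cases k t with ⟨j, r, rfl⟩ | h
  · rw [← chart_add_one, insertHom_chart, insertHom_chart, chart_add_one]
  · rw [insertHom_of_forall_ne f h, insertHom_of_forall_ne]
    intro j r hjr
    refine h (j - 1) r ?_
    have := chart_add_one k (j - 1) r
    rw [sub_add_cancel, hjr] at this
    linarith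

theorem insertHom_mem_circleLift (k : ℕ) {f : ℝ ≃o ℝ} (hf : f ∈ DyadicIso) :
    insertHom k f ∈ CircleLift := by
  refine ⟨insertHom_add_one k f, fun t => ?_⟩
  rcases chart_cases k t with ⟨j, r, rfl⟩ | h
  · rw [insertHom_chart, (dyadicPLAt_chart k j _).mem_dyadics_iff,
      (dyadicPLAt_chart k j _).mem_dyadics_iff, (hf r).mem_dyadics_iff]
  · rw [insertHom_of_forall_ne f h]

/-- Inside a chart the inserted map is a conjugate of `f` by a dyadic piecewise-linear map, whose
inverse is again of this kind. -/
theorem dyadicPLAt_insertHom_chart (k : ℕ) {f : ℝ ≃o ℝ} (hf : f ∈ DyadicIso) (j : ℤ) (r : ℝ) :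
    DyadicPLAt (insertHom k f) (chart k j r) := by
  have hinv : ∀ s, Function.invFun (chart k j) (chart k j s) = s :=
    Function.leftInverse_invFun (chart_strictMono k j).injective
  have h1 := (dyadicPLAt_chart k j r).of_leftInverse (Eventually.of_forall hinv)
  have h2 : DyadicPLAt (fun t => chart k j (f t)) (Function.invFun (chart k j) (chart k j r)) :=
    (dyadicPLAt_chart k j _).comp (hf _)
  refine (h2.comp h1).congr ?_
  filter_upwards [Ioo_mem_nhds (lt_chart k j r) (chart_lt k j r)] with t ht
  obtain ⟨s, rfl⟩ := exists_chart_eq ht.1 ht.2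
  rw [insertHom_chart, hinv]

theorem exists_int_mem_Ico (t : ℝ) : ∃ j : ℤ, (j : ℝ) ≤ t ∧ t < j + 1 :=
  ⟨⌊t⌋, Int.floor_le t, Int.lt_floor_add_one t⟩

/-- The points `t` outside of the charts, other than their endpoints, have neighbourhoods that are
disjoint from the charts. -/
theorem eventually_chart_ne {k : ℕ} {t : ℝ} (h : ∀ j r, chart k j r ≠ t)
    (h1 : ∀ j : ℤ, t ≠ j + width k) (h2 : ∀ j : ℤ, t ≠ j + 2 * width k) :
    ∀ᶠ s in 𝓝 t, ∀ j r, chart k j r ≠ s := by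
  obtain ⟨i, hi1, hi2⟩ := exists_int_mem_Ico t
  have hw := width_pos k
  have hw' := width_le k
  -- Either `t` lies between the charts `i - 1` and `i`, or it lies between the charts `i` and `i +
  -- 1`; both gaps are open around `t` because endpoints are excluded.
  rcases lt_trichotomy t (i + width k) with h3 | h3 | h3
  · have h2' : (i : ℝ) - 1 + 2 * width k < t := by
      have := h2 (i - 1)
      push_cast at this
      exact lt_of_le_of_ne (by linarith) this.symm
    filter_upwards [Ioo_mem_nhds h2' h3] with s hs j r hjr
    have a1 := lt_chart k j r
    have a2 := chart_lt k j r
    have a3 : (j : ℝ) < i := by linarith [hs.2]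
    have a4 : (i : ℝ) < j + 1 := by linarith [hs.1]
    have a3 : j < i := by exact_mod_cast a3
    have a4 : i < j + 1 := by exact_mod_cast a4
    omega
  · exact absurd h3 (h1 i)
  · have h4 : (i : ℝ) + 2 * width k < t := by
      refine lt_of_le_of_ne ?_ (h2 i).symm
      by_contra hcon
      obtain ⟨r, hr⟩ := exists_chart_eq h3 (not_le.1 hcon)
      exact h _ _ hr
    filter_upwards [Ioo_mem_nhds h4 (show t < i + 1 + width k by linarith)] with s hs j r hjr
    have a1 := lt_chart k j r
    have a2 := chart_lt k j r
    have a3 : (j : ℝ) < i + 1 := by linarith [hs.2]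
    have a4 : (i : ℝ) < j := by linarith [hs.1]
    have a3 : j < i + 1 := by exact_mod_cast a3
    have a4 : i < j := by exact_mod_cast a4
    omega

theorem dyadicPLAt_insertHom (k : ℕ) {f : ℝ ≃o ℝ} (hf : f ∈ DyadicIso) {t : ℝ}
    (h1 : ∀ j : ℤ, t ≠ j + width k) (h2 : ∀ j : ℤ, t ≠ j + 2 * width k) :
    DyadicPLAt (insertHom k f) t := by
  rcases chart_cases k t with ⟨j, r, rfl⟩ | h
  · exact dyadicPLAt_insertHom_chart k hf j r
  · refine (dyadicPLAt_id t).congr ?_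
    filter_upwards [eventually_chart_ne h h1 h2] with s hs
    exact insertHom_of_forall_ne f hs

theorem chart_ne_of_mem_left {k : ℕ} {i : ℤ} {t : ℝ} (h1 : (i : ℝ) ≤ t) (h2 : t ≤ i + width k)
    (j : ℤ) (r : ℝ) : chart k j r ≠ t := by
  rintro rfl
  have a1 := lt_chart k j r
  have a2 := chart_lt k j r
  have a3 := width_le k
  have a4 : (j : ℝ) < i := by linarith
  have a5 : (i : ℝ) < j + 1 := by linarith
  have a4 : j < i := by exact_mod_cast a4
  have a5 : i < j + 1 := by exact_mod_cast a5
  omega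

theorem chart_ne_of_mem_right {k : ℕ} {i : ℤ} {t : ℝ} (h1 : i + 2 * width k ≤ t) (h2 : t ≤ i + 1)
    (j : ℤ) (r : ℝ) : chart k j r ≠ t := by
  rintro rfl
  have a1 := lt_chart k j r
  have a2 := chart_lt k j r
  have a3 := width_le k
  have a6 := width_pos k
  have a4 : (j : ℝ) < i + 1 := by linarith
  have a5 : (i : ℝ) < j := by linarith
  have a4 : j < i + 1 := by exact_mod_cast a4
  have a5 : i < j := by exact_mod_cast a5
  omega

theorem eventually_insertHom_left (k : ℕ) (f : ℝ ≃o ℝ) (i : ℤ) :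
    ∀ᶠ t in 𝓝[≤] (i + width k), insertHom k f t = t := by
  have := width_pos k
  filter_upwards [self_mem_nhdsWithin,
    nhdsWithin_le_nhds (lt_mem_nhds (show (i : ℝ) < i + width k by linarith))] with t h1 h2
  exact insertHom_of_forall_ne f (chart_ne_of_mem_left h2.le h1)

theorem eventually_insertHom_right (k : ℕ) (f : ℝ ≃o ℝ) (i : ℤ) :
    ∀ᶠ t in 𝓝[≥] (i + 2 * width k), insertHom k f t = t := by
  have := width_le k
  have := width_pos k
  have hlt : (i : ℝ) + 2 * width k < i + 1 + width k := by linarith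
  filter_upwards [self_mem_nhdsWithin, nhdsWithin_le_nhds (gt_mem_nhds hlt)] with t h1 h2
  refine insertHom_of_forall_ne f ?_
  -- For `k = 0` the right endpoint is the integer `i + 1` itself, so the neighbourhood reaches into
  -- the next unit interval.
  rcases le_total t (i + 1) with h | h
  · exact chart_ne_of_mem_right h1 h
  · exact chart_ne_of_mem_left (i := i + 1) (by push_cast; exact h) (by push_cast; exact h2.le)

theorem insertHom_left_endpoint (k : ℕ) (f : ℝ ≃o ℝ) (i : ℤ) :
    insertHom k f (i + width k) = i + width k :=
  (eventually_insertHom_left k f i).self_of_nhdsWithin self_mem_Iic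

theorem insertHom_right_endpoint (k : ℕ) (f : ℝ ≃o ℝ) (i : ℤ) :
    insertHom k f (i + 2 * width k) = i + 2 * width k :=
  (eventually_insertHom_right k f i).self_of_nhdsWithin self_mem_Ici

/-! ### Commutation with doubling at the endpoints. -/

theorem tendsto_two_mul_sub (p : ℝ) : Tendsto (fun t : ℝ => 2 * t - p) (𝓝 p) (𝓝 p) := by
  have hc : Continuous fun t : ℝ => 2 * t - p := by fun_prop
  have := hc.tendsto p
  rwa [two_mul, add_sub_cancel_right] at this

/-- To the left of the endpoint the map is the identity. To the right, doubling about the endpoint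
is `chart k i s ↦ chart k i (s + 1)` for very negative `s`, and `f` commutes with this shift there.
-/
theorem insertHom_doubling_left (k : ℕ) {f : ℝ ≃o ℝ} {N : ℝ}
    (hf : ∀ t : ℝ, N ≤ |t| → f (t + 1) = f t + 1) (i : ℤ) :
    ∀ᶠ t in 𝓝 (i + width k), insertHom k f (2 * t - (i + width k)) =
      2 * insertHom k f t - (i + width k) := by
  have hw := width_pos k
  rw [← nhdsLE_sup_nhdsGE, eventually_sup]
  constructor
  · have ht : Tendsto (fun t : ℝ => 2 * t - (i + width k)) (𝓝[≤] (i + width k))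
        (𝓝[≤] (i + width k)) := by
      refine tendsto_nhdsWithin_iff.2
        ⟨(tendsto_two_mul_sub _).mono_left nhdsWithin_le_nhds, ?_⟩
      filter_upwards [self_mem_nhdsWithin] with t (ht : t ≤ _)
      simp only [mem_Iic]
      linarith
    filter_upwards [eventually_insertHom_left k f i, ht.eventually (eventually_insertHom_left k f i)]
      with t h1 h2
    rw [h1, h2]
  -- Below `R` both `r` and `f r` are less than `-1`, where doubling is the shift, and `|r|` is at
  -- least `N`.
  · set R := min (min (-1) (-N)) (f.symm (-1)) with hR
    filter_upwards [self_mem_nhdsWithin, nhdsWithin_le_nhds (gt_mem_nhds (lt_chart k i R))]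
      with t h1 h2
    rcases (show i + width k ≤ t from h1).eq_or_lt with rfl | h1
    · rw [insertHom_left_endpoint, two_mul, add_sub_cancel_right, insertHom_left_endpoint]
    · obtain ⟨r, rfl⟩ := exists_chart_eq h1 (h2.trans (chart_lt k i R))
      have hr : r < R := (chart_strictMono k i).lt_iff_lt.1 h2
      obtain ⟨⟨hr1, hr2⟩, hr3⟩ : (r < -1 ∧ r < -N) ∧ r < f.symm (-1) := by
        simpa [hR, lt_min_iff] using hr
      have hfr : f r < -1 := by rwa [← OrderIso.lt_symm_apply]
      have e : ∀ s, s < -1 → 2 * chart k i s - (i + width k) = chart k i (s + 1) := by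
        intro s hs
        rw [chart, chart, theta_add_one_of_nonpos (by linarith)]; ring
      have hN : N ≤ |r| := by
        rw [abs_of_neg (by linarith)]
        linarith
      rw [e r hr1, insertHom_chart, insertHom_chart, hf r hN,
        e _ hfr]

theorem insertHom_doubling_right (k : ℕ) {f : ℝ ≃o ℝ} {N : ℝ}
    (hf : ∀ t : ℝ, N ≤ |t| → f (t + 1) = f t + 1) (i : ℤ) :
    ∀ᶠ t in 𝓝 (i + 2 * width k), insertHom k f (2 * t - (i + 2 * width k)) =
      2 * insertHom k f t - (i + 2 * width k) := by
  have hw := width_pos k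
  rw [← nhdsLE_sup_nhdsGE, eventually_sup, and_comm]
  constructor
  · have ht : Tendsto (fun t : ℝ => 2 * t - (i + 2 * width k)) (𝓝[≥] (i + 2 * width k))
        (𝓝[≥] (i + 2 * width k)) := by
      refine tendsto_nhdsWithin_iff.2
        ⟨(tendsto_two_mul_sub _).mono_left nhdsWithin_le_nhds, ?_⟩
      filter_upwards [self_mem_nhdsWithin] with t (ht : _ ≤ t)
      simp only [mem_Ici]
      linarith
    filter_upwards [eventually_insertHom_right k f i,
      ht.eventually (eventually_insertHom_right k f i)] with t h1 h2
    rw [h1, h2]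
  -- At the right endpoint doubling is the shift by `-1`, so the hypothesis on `f` is applied at `r
  -- - 1`; this accounts for `N + 1`.
  · set R := max (max 1 (N + 1)) (f.symm 1) with hR
    filter_upwards [self_mem_nhdsWithin, nhdsWithin_le_nhds (lt_mem_nhds (chart_lt k i R))]
      with t h1 h2
    rcases (show t ≤ i + 2 * width k from h1).eq_or_lt with rfl | h1
    · rw [insertHom_right_endpoint, two_mul (i + 2 * width k), add_sub_cancel_right,
        insertHom_right_endpoint]
    · obtain ⟨r, rfl⟩ := exists_chart_eq ((lt_chart k i R).trans h2) h1
      have hr : R < r := (chart_strictMono k i).lt_iff_lt.1 h2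
      obtain ⟨⟨hr1, hr2⟩, hr3⟩ : (1 < r ∧ N + 1 < r) ∧ f.symm 1 < r := by
        simpa [hR, max_lt_iff] using hr
      have hfr : 1 < f r := by rwa [← OrderIso.symm_apply_lt]
      have e : ∀ s, 1 < s → 2 * chart k i s - (i + 2 * width k) = chart k i (s - 1) := by
        intro s hs
        have := theta_add_one_of_nonneg (t := s - 1) (by linarith)
        rw [sub_add_cancel] at this
        rw [chart, chart, this]; ring
      have hN : N ≤ |r - 1| := by
        rw [abs_of_nonneg (by linarith)]
        linarith
      have h3 := hf (r - 1) hN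
      rw [sub_add_cancel] at h3
      rw [e r hr1, insertHom_chart, insertHom_chart, e _ hfr, h3, add_sub_cancel_right]

/-- A point and its image lie in the same interval of length less than `1`, so an integer
displacement is zero. This is the injectivity argument for both the circle and the Cantor set, where
only displacements modulo integers are visible. -/
theorem insertHom_eq_one_of_int {k : ℕ} {f : ℝ ≃o ℝ}
    (h : ∀ t, ∃ j : ℤ, insertHom k f t = t + j) : f = 1 := by
  ext r
  obtain ⟨j, hj⟩ := h (chart k 0 r)
  have a1 := lt_chart k 0 (f r)
  have a2 := chart_lt k 0 (f r)
  have a3 := lt_chart k 0 r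
  have a4 := chart_lt k 0 r
  have a5 := width_le k
  rw [insertHom_chart] at hj
  have h1 : (j : ℝ) < 1 := by linarith [width_pos k]
  have h2 : (-1 : ℝ) < j := by linarith [width_pos k]
  have h1 : j < 1 := by exact_mod_cast h1
  have h2 : -1 < j := by exact_mod_cast h2
  obtain rfl : j = 0 := by omega
  rw [Int.cast_zero, add_zero] at hj
  exact (chart_strictMono k 0).injective hj

/-! ### Brin's group acting through lifts. -/

/-- The elements of Brin's group are increasing. -/
theorem BrinA.strictMono (f : BrinA) : StrictMono f.1 := by
  -- A homeomorphism of the line is monotone, and a positive slope to the right of `0` rules out a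
  -- decreasing one.
  refine (f.1.continuous.strictMono_of_inj f.1.injective).resolve_right fun h => ?_
  obtain ⟨-, n, -, c, -, -, -, hr, -⟩ := f.2.1 0
  have hev : ∀ᶠ t : ℝ in 𝓝[>] 0, f.1 t = 2 ^ n * t + c := nhdsWithin_mono _ Ioi_subset_Ici_self hr
  have h0 : f.1 0 = 2 ^ n * 0 + c := hr.self_of_nhdsWithin self_mem_Ici
  obtain ⟨t, h1, h2⟩ := (hev.and self_mem_nhdsWithin).exists
  have h3 := h (show (0 : ℝ) < t from h2)
  have h4 : (0 : ℝ) < 2 ^ n * t := mul_pos (by positivity) h2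
  rw [h1, h0] at h3
  linarith

/-- Brin's group as a group of order isomorphisms of the line. -/
def brinIso : BrinA →* (ℝ ≃o ℝ) :=
  MonoidHom.mk' (fun f => { f.1.toEquiv with map_rel_iff' := (BrinA.strictMono f).le_iff_le })
    fun _ _ => rfl

theorem brinIso_injective : Function.Injective brinIso := fun f g h => by
  ext t
  exact congrArg (fun F : ℝ ≃o ℝ => F t) h

theorem brinIso_mem (f : BrinA) : brinIso f ∈ DyadicIso := f.2.1

/-- The homomorphism that inserts elements of Brin's group into intervals of the circle, in terms of
lifts to the line. -/
noncomputable def brinLift (k : ℕ) : BrinA →* CircleLift :=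
  ((insertHom k).comp brinIso).codRestrict CircleLift
    fun f => insertHom_mem_circleLift k (brinIso_mem f)

theorem brinLift_coe (k : ℕ) (f : BrinA) : (brinLift k f).1 = insertHom k (brinIso f) := rfl

theorem brinLift_eq_one_of_int {k : ℕ} {f : BrinA}
    (h : ∀ t, ∃ j : ℤ, (brinLift k f).1 t = t + j) : f = 1 :=
  brinIso_injective ((insertHom_eq_one_of_int h).trans (map_one _).symm)

theorem isDyadic_circleLift {f : ℝ ≃o ℝ} (hf : f ∈ DyadicIso) (h : ∀ t, f (t + 1) = f t + 1) :
    f ∈ CircleLift := ⟨h, fun t => (hf t).mem_dyadics_iff⟩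

/-! ### The action on the circle -/

theorem toCircle_add_int (t : ℝ) (k : ℤ) : toCircle (t + k) = toCircle t := by
  have : ((k : ℝ) : UnitAddCircle) = 0 := by
    rw [AddCircle.coe_eq_zero_iff]
    exact ⟨k, by simp⟩
  rw [toCircle, AddCircle.coe_add, this, add_zero]; rfl

theorem exists_int_of_toCircle_eq {s t : ℝ} (h : toCircle s = toCircle t) :
    ∃ k : ℤ, t = s + k := by
  have h1 : ((t - s : ℝ) : UnitAddCircle) = 0 := by
    rw [AddCircle.coe_sub, sub_eq_zero]; exact h.symm
  obtain ⟨n, hn⟩ := AddCircle.coe_eq_zero_iff (p := (1 : ℝ)) |>.1 h1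
  refine ⟨n, ?_⟩
  rw [zsmul_eq_mul, mul_one] at hn
  linarith

theorem continuous_toCircle : Continuous toCircle :=
  QuotientAddGroup.isOpenQuotientMap_mk.continuous

/-- The map of the circle with a given lift. -/
def circleFun (f : CircleLift) : UnitAddCircle → UnitAddCircle :=
  Function.Periodic.lift (f := fun t => toCircle (f.1 t)) (c := 1) fun t => by
    dsimp only
    rw [f.2.1]
    simpa using toCircle_add_int (f.1 t) 1

theorem circleFun_toCircle (f : CircleLift) (t : ℝ) :
    circleFun f (toCircle t) = toCircle (f.1 t) := rfl

theorem continuous_circleFun (f : CircleLift) : Continuous (circleFun f) := by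
  rw [QuotientAddGroup.isOpenQuotientMap_mk.isQuotientMap.continuous_iff]
  exact continuous_toCircle.comp f.1.continuous

/-- The homomorphism from lifts to homeomorphisms of the circle. -/
def circleHom : CircleLift →* (UnitAddCircle ≃ₜ UnitAddCircle) :=
  MonoidHom.mk' (fun f =>
    { toFun := circleFun f
      invFun := circleFun f⁻¹
      left_inv := fun p => by
        obtain ⟨t, rfl⟩ := toCircle_surjective p
        rw [circleFun_toCircle, circleFun_toCircle]
        exact congrArg toCircle (RelIso.inv_apply_self f.1 t)
      right_inv := fun p => by
        obtain ⟨t, rfl⟩ := toCircle_surjective p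
        rw [circleFun_toCircle, circleFun_toCircle]
        exact congrArg toCircle (RelIso.apply_inv_self f.1 t)
      continuous_toFun := continuous_circleFun f
      continuous_invFun := continuous_circleFun f⁻¹ })
    (fun f g => by
      ext p
      obtain ⟨t, rfl⟩ := toCircle_surjective p
      rfl)

theorem circleHom_toCircle (f : CircleLift) (t : ℝ) :
    circleHom f (toCircle t) = toCircle (f.1 t) := rfl

theorem exists_int_of_circleHom_eq_one {f : CircleLift} (h : circleHom f = 1) (t : ℝ) :
    ∃ k : ℤ, f.1 t = t + k := by
  have := congrArg (fun F : UnitAddCircle ≃ₜ UnitAddCircle => F (toCircle t)) h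
  exact exists_int_of_toCircle_eq (s := t) this.symm

theorem circleHom_mem_thompsonT {f : CircleLift} (hf : f.1 ∈ DyadicIso) :
    circleHom f ∈ ThompsonT := by
  intro x
  obtain ⟨m, n, b, c, hb, hc, hl, hr, hx⟩ := hf x
  exact ⟨m, n, b, c, hb, hc, hl.mono fun t ht => congrArg toCircle ht,
    hr.mono fun t ht => congrArg toCircle ht, hx⟩

theorem exists_dyadicIso_circleLift {f : ℝ → ℝ} {t : ℝ} (ht : DyadicPLAt f t) :
    ∃ F : CircleLift, F.1 ∈ DyadicIso ∧ ∀ᶠ s in 𝓝 t, F.1 s = f s := by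
  obtain ⟨F, hF, hF1, hFf⟩ := ht.exists_periodic
  exact ⟨⟨F, isDyadic_circleLift hF hF1⟩, hF, hFf⟩

/-- Being nonsingular means agreeing nearby with an element of `T` defined on the whole circle, so
the germ has to be extended periodically. -/
theorem toCircle_notMem_sing {f : CircleLift} {t : ℝ} (ht : DyadicPLAt f.1 t) :
    toCircle t ∉ sing ThompsonT (circleHom f) := by
  obtain ⟨F, hF, hFf⟩ := exists_dyadicIso_circleLift ht
  refine fun hs => hs ⟨circleHom F, circleHom_mem_thompsonT hF, ?_⟩
  rw [← map_toCircle_nhds, eventually_map]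
  filter_upwards [hFf] with s hs
  rw [circleHom_toCircle, circleHom_toCircle, hs]

theorem commutesWithDoublingAt_circleHom {f : CircleLift} {p : ℝ}
    (h : ∀ᶠ t in 𝓝 p, f.1 (2 * t - p) = 2 * f.1 t - f.1 p) :
    CommutesWithDoublingAt (circleHom f) (toCircle p) := by
  rw [CommutesWithDoublingAt, ← map_toCircle_nhds, eventually_map]
  filter_upwards [h] with t ht
  have e : ∀ s r : ℝ, 2 • toCircle s - toCircle r = toCircle (2 * s - r) := by
    intro s r
    rw [two_mul, two_nsmul]; rfl
  rw [e, circleHom_toCircle, circleHom_toCircle, circleHom_toCircle, e, ht]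

theorem sing_circleHom_brinLift_subset (k : ℕ) (f : BrinA) :
    sing ThompsonT (circleHom (brinLift k f)) ⊆ {toCircle (width k), toCircle (2 * width k)} := by
  intro p hp
  obtain ⟨t, rfl⟩ := toCircle_surjective p
  by_contra h
  simp only [mem_insert_iff, mem_singleton_iff, not_or] at h
  refine toCircle_notMem_sing (dyadicPLAt_insertHom k (brinIso_mem f) (fun j hj => h.1 ?_)
    fun j hj => h.2 ?_) hp
  · rw [hj, add_comm, toCircle_add_int]
  · rw [hj, add_comm, toCircle_add_int]

theorem circleHom_brinLift_mem (k : ℕ) (f : BrinA) : circleHom (brinLift k f) ∈ GroupTA := by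
  have hsub := sing_circleHom_brinLift_subset k f
  have hw := width_mem_dyadics k
  obtain ⟨N, -, hN⟩ := f.2.2
  refine ⟨(toFinite _).subset hsub, hsub.trans ?_, fun p hp => ?_⟩
  · rintro p (rfl | rfl)
    · exact toCircle_mem_dyadicPoints.2 hw
    · exact toCircle_mem_dyadicPoints.2 (mul_mem two_mem_dyadics hw)
  · rcases hsub hp with rfl | rfl
    · refine commutesWithDoublingAt_circleHom ?_
      have h1 := insertHom_doubling_left k (f := brinIso f) hN 0
      have h2 := insertHom_left_endpoint k (brinIso f) 0
      rw [Int.cast_zero, zero_add] at h1 h2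
      rw [brinLift_coe, h2]
      exact h1
    · refine commutesWithDoublingAt_circleHom ?_
      have h1 := insertHom_doubling_right k (f := brinIso f) hN 0
      have h2 := insertHom_right_endpoint k (brinIso f) 0
      rw [Int.cast_zero, zero_add] at h1 h2
      rw [brinLift_coe, h2]
      exact h1

/-- The `k`-th copy of Brin's group in `T𝒜`. -/
noncomputable def brinToTA (k : ℕ) : BrinA →* GroupTA :=
  (circleHom.comp (brinLift k)).codRestrict GroupTA (circleHom_brinLift_mem k)

theorem brinToTA_injective (k : ℕ) : Function.Injective (brinToTA k) := by
  rw [injective_iff_map_eq_one]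
  intro f hf
  exact brinLift_eq_one_of_int (exists_int_of_circleHom_eq_one (congrArg Subtype.val hf))

theorem homeoSupport_brinToTA_subset (k : ℕ) (f : BrinA) :
    homeoSupport (brinToTA k f).1 ⊆ toCircle '' Icc (width k) (2 * width k) := by
  refine closure_minimal ?_ (isCompact_Icc.image continuous_toCircle).isClosed
  intro p hp
  obtain ⟨t, rfl⟩ := toCircle_surjective p
  rcases chart_cases k t with ⟨j, r, rfl⟩ | h
  · refine ⟨chart k 0 r, ⟨?_, ?_⟩, ?_⟩
    · simpa using (lt_chart k 0 r).le
    · simpa using (chart_lt k 0 r).le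
    · rw [← toCircle_add_int _ j]
      congr 1
      simp only [chart, Int.cast_zero]; ring
  · exact absurd (congrArg toCircle (insertHom_of_forall_ne (brinIso f) h)) hp

/-- Consecutive closed intervals share an endpoint, since `2 * width (k + 1) = width k`, so a gap in
the indices is required. Positive indices keep the intervals inside `(0, 1 / 2]`, away from their
integer translates. Odd indices meet both conditions. -/
theorem disjoint_toCircle_image {k l : ℕ} (hk : 0 < k) (hkl : k + 1 < l) :
    Disjoint (toCircle '' Icc (width k) (2 * width k)) (toCircle '' Icc (width l) (2 * width l)) := by
  rw [Set.disjoint_left]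
  rintro _ ⟨s, hs, rfl⟩ ⟨t, ht, hst⟩
  obtain ⟨j, rfl⟩ := exists_int_of_toCircle_eq hst
  have h1 := two_mul_width_le hkl
  have h2 := two_mul_width_le (Nat.lt_succ_self k)
  have h3 := two_mul_width_le hk
  have h4 := width_le 0
  have h5 := width_pos l
  have h6 := width_pos k
  have h7 := width_pos (k + 1)
  have hj1 : (j : ℝ) < 1 := by linarith [hs.2, ht.1]
  have hj2 : (0 : ℝ) < j := by
    have : 2 * width (k + 1) ≤ width k := h2
    linarith [hs.1, ht.2]
  have hj1 : j < 1 := by exact_mod_cast hj1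
  have hj2 : 0 < j := by exact_mod_cast hj2
  omega

theorem disjoint_toCircle_image_of_ne {m n : ℕ} (h : m ≠ n) :
    Disjoint (toCircle '' Icc (width (2 * m + 1)) (2 * width (2 * m + 1)))
      (toCircle '' Icc (width (2 * n + 1)) (2 * width (2 * n + 1))) := by
  rcases lt_or_gt_of_ne h with h | h
  · exact disjoint_toCircle_image (by omega) (by omega)
  · exact (disjoint_toCircle_image (by omega) (by omega)).symm

theorem disjoint_homeoSupport_brinToTA {m n : ℕ} (h : m ≠ n) (f g : BrinA) :
    Disjoint (homeoSupport (brinToTA (2 * m + 1) f).1)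
      (homeoSupport (brinToTA (2 * n + 1) g).1) :=
  (disjoint_toCircle_image_of_ne h).mono (homeoSupport_brinToTA_subset _ f)
    (homeoSupport_brinToTA_subset _ g)

/-! ### Binary expansions -/

/-- The value of a binary digit. -/
def bit (b : Bool) : ℝ := if b then 1 else 0

@[simp] theorem bit_true : bit true = 1 := rfl

@[simp] theorem bit_false : bit false = 0 := rfl

/-- The integer part of `y` if `y` is approached from the right (`a = false`) or from the left
(`a = true`). -/
noncomputable def sideFloor (a : Bool) (y : ℝ) : ℤ := if a then ⌈y⌉ - 1 else ⌊y⌋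

theorem sideFloor_int_add (a : Bool) (z : ℤ) (y : ℝ) :
    sideFloor a (z + y) = z + sideFloor a y := by
  cases a
  · simp [sideFloor]
  · simp only [sideFloor, if_true, Int.ceil_intCast_add]; ring

/-- The binary expansion of `t` modulo `1`; if `t` is dyadic, then it is the one that ends in
`000⋯` for `a = false` and the one that ends in `111⋯` for `a = true`. -/
noncomputable def expand (t : ℝ) (a : Bool) : Cantor := fun k =>
  decide (Odd (sideFloor a (2 ^ (k + 1) * t)))

theorem odd_two_pow_mul_add (k : ℕ) (z w : ℤ) : Odd (2 ^ (k + 1) * z + w) ↔ Odd w := by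
  have : Even ((2 : ℤ) ^ (k + 1) * z) := by
    rw [pow_succ, mul_assoc, mul_left_comm]; exact even_two_mul _
  exact ⟨fun h => by have := h.sub_even this; rwa [add_sub_cancel_left] at this, this.add_odd⟩

theorem expand_add_int (t : ℝ) (j : ℤ) (a : Bool) : expand (t + j) a = expand t a := by
  funext k
  unfold expand
  rw [show (2 : ℝ) ^ (k + 1) * (t + j) = ((2 ^ (k + 1) * j : ℤ) : ℝ) + 2 ^ (k + 1) * t by
    push_cast; ring, sideFloor_int_add]
  simp only [odd_two_pow_mul_add]

theorem expand_int_add (t : ℝ) (j : ℤ) (a : Bool) : expand (j + t) a = expand t a := by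
  rw [add_comm, expand_add_int]

/-- For nondyadic `t` no number `2 ^ (k + 1) * t` is an integer, so `⌈y⌉ - 1 = ⌊y⌋` at each of them.
-/
theorem expand_eq_of_notMem {t : ℝ} (ht : t ∉ dyadics) (a b : Bool) : expand t a = expand t b := by
  have key : ∀ a, expand t a = expand t false := by
    intro a
    cases a
    · rfl
    funext k
    have h1 : ⌈(2 : ℝ) ^ (k + 1) * t⌉ = ⌊(2 : ℝ) ^ (k + 1) * t⌋ + 1 := by
      have h2 := Int.floor_le ((2 : ℝ) ^ (k + 1) * t)
      have h3 := Int.lt_floor_add_one ((2 : ℝ) ^ (k + 1) * t)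
      rw [Int.ceil_eq_iff]
      push_cast
      refine ⟨?_, h3.le⟩
      rw [add_sub_cancel_right]
      refine lt_of_le_of_ne h2 fun h4 => ht ?_
      have h5 := affine_mem_dyadics_iff (n := (k + 1 : ℕ)) (x := t) (zero_mem dyadics)
      rw [add_zero, zpow_natCast] at h5
      rw [← h5, ← h4]
      exact intCast_mem _ _
    simp [expand, sideFloor, h1]
  rw [key a, key b]

/-- The points of `[0, 1]`, with the side `a` from which they are approached. -/
def InUnit (s : ℝ) (a : Bool) : Prop := 0 ≤ s ∧ s ≤ 1 ∧ s ≠ bit !a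

/-- `InUnit` describes `[0, 1)` for `a = false` and `(0, 1]` for `a = true`; the omitted endpoint is
the one at which the one-sided floor is not `0`. -/
theorem InUnit.sideFloor_eq {s : ℝ} {a : Bool} (h : InUnit s a) : sideFloor a s = 0 := by
  obtain ⟨h0, h1, h2⟩ := h
  cases a
  · simp only [sideFloor, Bool.false_eq_true, if_false]
    rw [Int.floor_eq_iff]
    refine ⟨by simpa using h0, ?_⟩
    simpa using lt_of_le_of_ne h1 h2
  · simp only [sideFloor, if_true]
    have : ⌈s⌉ = 1 := by
      rw [Int.ceil_eq_iff]
      refine ⟨?_, by simpa using h1⟩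
      simpa using lt_of_le_of_ne h0 (Ne.symm h2)
    omega

/-- The affine map from the unit interval to the interval of the numbers whose binary expansions
begin with `α`. -/
noncomputable def cellMap : List Bool → ℝ → ℝ
  | [], s => s
  | b :: α, s => (bit b + cellMap α s) / 2

theorem cellMap_append (α β : List Bool) (s : ℝ) :
    cellMap (α ++ β) s = cellMap α (cellMap β s) := by
  induction α with
  | nil => rfl
  | cons b α ih => simp only [List.cons_append, cellMap, ih]

theorem cellMap_eq (α : List Bool) (s : ℝ) : cellMap α s = cellMap α 0 + s / 2 ^ α.length := by
  induction α with
  | nil => simp [cellMap]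
  | cons b α ih =>
    simp only [cellMap, List.length_cons, pow_succ]
    rw [ih]; field_simp; ring

theorem cellMap_strictMono (α : List Bool) : StrictMono (cellMap α) := by
  intro s t h
  rw [cellMap_eq α s, cellMap_eq α t]
  have : s / 2 ^ α.length < t / 2 ^ α.length := div_lt_div_of_pos_right h (by positivity)
  linarith

theorem cellMap_sub (α : List Bool) (s t : ℝ) :
    cellMap α s - cellMap α t = (s - t) / 2 ^ α.length := by
  rw [cellMap_eq α s, cellMap_eq α t]; ring

/-- The lower end of a cell of depth `n` is an integer multiple of `2 ^ (-n)`. -/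
theorem exists_int_two_pow_mul_cellMap (α : List Bool) (s : ℝ) :
    ∃ z : ℤ, 2 ^ α.length * cellMap α s = z + s := by
  induction α with
  | nil => exact ⟨0, by simp [cellMap]⟩
  | cons b α ih =>
    obtain ⟨z, hz⟩ := ih
    refine ⟨(if b then 2 ^ α.length else 0) + z, ?_⟩
    simp only [cellMap, List.length_cons, pow_succ]
    rw [show (2 : ℝ) ^ α.length * 2 * ((bit b + cellMap α s) / 2) =
      2 ^ α.length * bit b + 2 ^ α.length * cellMap α s by ring, hz]
    cases b <;> simp
    ring

theorem bit_mem_dyadics (b : Bool) : bit b ∈ dyadics := by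
  cases b
  · exact zero_mem _
  · exact one_mem _

theorem cellMap_mem_dyadics (α : List Bool) {s : ℝ} (hs : s ∈ dyadics) :
    cellMap α s ∈ dyadics := by
  induction α with
  | nil => exact hs
  | cons b α ih =>
    have := mul_mem half_mem_dyadics (add_mem (bit_mem_dyadics b) ih)
    rwa [one_div, inv_mul_eq_div] at this

theorem cellMap_mem_Icc (α : List Bool) {s : ℝ} (hs : s ∈ Icc (0 : ℝ) 1) :
    cellMap α s ∈ Icc (0 : ℝ) 1 := by
  induction α with
  | nil => exact hs
  | cons b α ih =>
    obtain ⟨h1, h2⟩ := ih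
    cases b <;> simp only [cellMap, bit_true, bit_false] <;> constructor <;> linarith

theorem InUnit.mem_Icc {s : ℝ} {a : Bool} (h : InUnit s a) : s ∈ Icc (0 : ℝ) 1 := ⟨h.1, h.2.1⟩

theorem InUnit.map {s : ℝ} {a : Bool} (h : InUnit s a) (α : List Bool) :
    InUnit (cellMap α s) a := by
  have h0 := cellMap_mem_Icc α h.mem_Icc
  refine ⟨h0.1, h0.2, ?_⟩
  obtain ⟨h1, h2, h3⟩ := h
  cases a
  · refine ne_of_lt ?_
    exact (cellMap_strictMono α (lt_of_le_of_ne h2 h3)).trans_le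
      (cellMap_mem_Icc α (by simp)).2
  · refine ne_of_gt ?_
    exact lt_of_le_of_lt (cellMap_mem_Icc α (s := 0) (by simp)).1
      (cellMap_strictMono α (lt_of_le_of_ne h1 h3.symm))

theorem prepend_cons (b : Bool) (α : List Bool) (ψ : Cantor) :
    prepend (b :: α) ψ = prepend [b] (prepend α ψ) := prepend_append [b] α ψ

theorem prepend_singleton_zero (b : Bool) (ψ : Cantor) : prepend [b] ψ 0 = b := by simp [prepend]

theorem prepend_singleton_succ (b : Bool) (ψ : Cantor) (k : ℕ) : prepend [b] ψ (k + 1) = ψ k := by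
  simp [prepend]

theorem expand_half {s : ℝ} {a : Bool} (h : InUnit s a) (b : Bool) :
    expand ((bit b + s) / 2) a = prepend [b] (expand s a) := by
  have hb : bit b = ((if b then 1 else 0 : ℤ) : ℝ) := by cases b <;> simp
  funext k
  rcases k with _ | k
  · rw [prepend_singleton_zero]
    unfold expand
    rw [show (2 : ℝ) ^ (0 + 1) * ((bit b + s) / 2) = bit b + s by ring, hb, sideFloor_int_add,
      h.sideFloor_eq]
    cases b <;> simp
  · rw [prepend_singleton_succ]
    unfold expand
    rw [show (2 : ℝ) ^ (k + 1 + 1) * ((bit b + s) / 2) =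
      ((2 ^ (k + 1) * (if b then 1 else 0 : ℤ) : ℤ) : ℝ) + 2 ^ (k + 1) * s by
        rw [hb]; push_cast; ring, sideFloor_int_add]
    simp only [odd_two_pow_mul_add]

/-- This is the dictionary between cells of the line and cones of the Cantor set: all statements
about germs are transferred through it. -/
theorem expand_cellMap {s : ℝ} {a : Bool} (h : InUnit s a) (α : List Bool) :
    expand (cellMap α s) a = prepend α (expand s a) := by
  induction α with
  | nil => funext k; simp [cellMap, prepend]
  | cons b α ih => rw [cellMap, expand_half (h.map α), ih, prepend_cons b α]

theorem exists_cellMap_eq {t : ℝ} {a : Bool} (h : InUnit t a) (n : ℕ) :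
    ∃ α s, α.length = n ∧ InUnit s a ∧ t = cellMap α s := by
  induction n generalizing t with
  | zero => exact ⟨[], t, rfl, h, rfl⟩
  | succ n ih =>
    have : ∃ b s, InUnit s a ∧ t = (bit b + s) / 2 := by
      obtain ⟨h1, h2, h3⟩ := h
      -- At the midpoint the side decides the digit: approached from the left, `1 / 2` is the upper
      -- end of the lower half.
      by_cases hb : 2 * t < 1 ∨ (2 * t = 1 ∧ a = true)
      · refine ⟨false, 2 * t, ⟨by linarith, by rcases hb with hb | hb <;> linarith, ?_⟩, by simp⟩
        cases a
        · simp only [Bool.not_false, bit_true]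
          rcases hb with hb | hb
          · exact hb.ne
          · simp at hb
        · simpa using h3
      · rw [not_or, not_lt, not_and] at hb
        refine ⟨true, 2 * t - 1, ⟨by linarith, by linarith, ?_⟩, by simp⟩
        cases a
        · intro h4
          simp only [Bool.not_false, bit_true] at h3 h4
          exact h3 (by linarith)
        · intro h4
          simp only [Bool.not_true, bit_false] at h4
          exact hb.2 (by linarith) rfl
    obtain ⟨b, s, hs, rfl⟩ := this
    obtain ⟨α, s', hα, hs', rfl⟩ := ih hs
    exact ⟨b :: α, s', by simp [hα], hs', rfl⟩

theorem exists_int_inUnit (t : ℝ) (a : Bool) : ∃ k : ℤ, InUnit (t - k) a := by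
  cases a
  · refine ⟨⌊t⌋, sub_nonneg.2 (Int.floor_le t), ?_, ?_⟩
    · linarith [Int.lt_floor_add_one t]
    · simp only [Bool.not_false, bit_true]
      linarith [Int.lt_floor_add_one t]
  · refine ⟨⌈t⌉ - 1, ?_, ?_, ?_⟩
    · push_cast; linarith [Int.ceil_lt_add_one t]
    · push_cast; linarith [Int.le_ceil t]
    · simp only [Bool.not_true, bit_false]
      push_cast; linarith [Int.ceil_lt_add_one t]

theorem exists_two_pow_mul_eq_int {t : ℝ} (ht : t ∈ dyadics) :
    ∃ n : ℕ, ∃ z : ℤ, 2 ^ n * t = z := by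
  induction ht using Subring.closure_induction with
  | mem x hx => exact ⟨1, 1, by rw [mem_singleton_iff.1 hx]; norm_num⟩
  | zero => exact ⟨0, 0, by simp⟩
  | one => exact ⟨0, 1, by simp⟩
  | add x y _ _ hx hy =>
    obtain ⟨n, z, hz⟩ := hx
    obtain ⟨m, w, hw⟩ := hy
    refine ⟨n + m, 2 ^ m * z + 2 ^ n * w, ?_⟩
    push_cast
    rw [← hz, ← hw, pow_add]; ring
  | neg x _ hx =>
    obtain ⟨n, z, hz⟩ := hx
    exact ⟨n, -z, by push_cast; rw [← hz]; ring⟩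
  | mul x y _ _ hx hy =>
    obtain ⟨n, z, hz⟩ := hx
    obtain ⟨m, w, hw⟩ := hy
    refine ⟨n + m, z * w, ?_⟩
    push_cast
    rw [← hz, ← hw, pow_add]; ring

theorem exists_forall_two_pow_mul_eq_int {t : ℝ} (ht : t ∈ dyadics) :
    ∃ n₀ : ℕ, ∀ n, n₀ ≤ n → ∃ z : ℤ, 2 ^ n * t = z := by
  obtain ⟨n₀, z, hz⟩ := exists_two_pow_mul_eq_int ht
  refine ⟨n₀, fun n hn => ?_⟩
  obtain ⟨k, rfl⟩ := Nat.exists_eq_add_of_le hn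
  exact ⟨2 ^ k * z, by push_cast; rw [← hz, pow_add]; ring⟩

theorem InUnit.eq_bit {s : ℝ} {a : Bool} (h : InUnit s a) {z : ℤ} (hz : s = z) : s = bit a := by
  obtain ⟨h1, h2, h3⟩ := h
  rw [hz] at h1 h2
  have h1 : 0 ≤ z := by exact_mod_cast h1
  have h2 : z ≤ 1 := by exact_mod_cast h2
  obtain rfl | rfl : z = 0 ∨ z = 1 := by omega
  · cases a
    · simpa using hz
    · simp [hz] at h3
  · cases a
    · simp [hz] at h3
    · simpa using hz

theorem InUnit.eq_bit_of_int {α : List Bool} {s : ℝ} {a : Bool} (h : InUnit s a) {z : ℤ}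
    (hz : 2 ^ α.length * cellMap α s = z) : s = bit a := by
  obtain ⟨w, hw⟩ := exists_int_two_pow_mul_cellMap α s
  refine h.eq_bit (z := z - w) ?_
  push_cast
  linarith

/-- Once `2 ^ n * t` is an integer, `t` is an end of every cell of depth `n` that contains it, and
the side `a` selects the end. From there on all digits are `a`. -/
theorem exists_forall_eq_bit {t : ℝ} (ht : t ∈ dyadics) : ∃ n₀ : ℕ, ∀ (α : List Bool) (s : ℝ)
    (a : Bool) (k : ℤ), n₀ ≤ α.length → InUnit s a → t = k + cellMap α s → s = bit a := by
  obtain ⟨n₀, h⟩ := exists_forall_two_pow_mul_eq_int ht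
  refine ⟨n₀, fun α s a k hα hs hts => ?_⟩
  obtain ⟨z, hz⟩ := h _ hα
  refine hs.eq_bit_of_int (α := α) (z := z - 2 ^ α.length * k) ?_
  push_cast
  rw [← hz, hts]; ring

theorem eq_of_prepend_eq {α β : List Bool} {ψ φ : Cantor} (hl : α.length = β.length)
    (h : prepend α ψ = prepend β φ) : α = β := by
  rcases prepend_comparable h with ⟨τ, rfl⟩ | ⟨τ, rfl⟩
  · simpa using hl
  · simpa using hl

/-- Equal expansions place both numbers, up to integers, in the same cells of every depth, so they
agree modulo `1`. A dyadic number is the end `bit a` of a deep cell, and this recovers the side.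
Hence the expansion loses only the integer part and the side of a nondyadic number. -/
theorem eq_of_expand_eq {t t' : ℝ} {a a' : Bool} (h : expand t a = expand t' a') :
    ∃ k : ℤ, t' = t + k ∧ (t ∈ dyadics → a = a') := by
  obtain ⟨k, hk⟩ := exists_int_inUnit t a
  obtain ⟨k', hk'⟩ := exists_int_inUnit t' a'
  have hcell : ∀ n : ℕ, ∃ α s s', α.length = n ∧ InUnit s a ∧ InUnit s' a' ∧
      t - k = cellMap α s ∧ t' - k' = cellMap α s' := by
    intro n
    obtain ⟨α, s, hα, hs, hts⟩ := exists_cellMap_eq hk n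
    obtain ⟨α', s', hα', hs', hts'⟩ := exists_cellMap_eq hk' n
    have h1 := expand_cellMap hs α
    have h2 := expand_cellMap hs' α'
    rw [← hts, ← expand_add_int _ k, sub_add_cancel, h] at h1
    rw [← hts', ← expand_add_int _ k', sub_add_cancel] at h2
    obtain rfl := eq_of_prepend_eq (hα.trans hα'.symm) (h1.symm.trans h2)
    exact ⟨α, s, s', hα, hs, hs', hts, hts'⟩
  have heq : t - k = t' - k' := by
    by_contra hne
    obtain ⟨n, hn⟩ := exists_pow_lt_of_lt_one (abs_pos.2 (sub_ne_zero.2 hne))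
      (by norm_num : (1 / 2 : ℝ) < 1)
    obtain ⟨α, s, s', hα, hs, hs', h1, h2⟩ := hcell n
    rw [h1, h2, cellMap_sub, hα, abs_div, abs_of_pos (by positivity : (0 : ℝ) < 2 ^ n),
      lt_div_iff₀ (by positivity), one_div, inv_pow, inv_mul_cancel₀ (by positivity)] at hn
    have : |s - s'| ≤ 1 := by
      rw [abs_le]
      constructor <;> linarith [hs.1, hs.2.1, hs'.1, hs'.2.1]
    linarith
  refine ⟨k' - k, by push_cast; linarith, fun ht => ?_⟩
  obtain ⟨n₀, hn₀⟩ := exists_forall_eq_bit ht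
  obtain ⟨α, s, s', hα, hs, hs', h1, h2⟩ := hcell n₀
  have h3 := hn₀ α s a k hα.ge hs (by linarith)
  have h4 := hn₀ α s' a' k hα.ge hs' (by linarith)
  have h5 : s = s' := (cellMap_strictMono α).injective (by rw [← h1, ← h2, heq])
  rw [h3, h4] at h5
  cases a <;> cases a' <;> simp_all

/-- The first `n` digits of `x`. -/
def digits (n : ℕ) (x : Cantor) : List Bool := List.ofFn fun i : Fin n => x i

theorem prepend_digits_apply {n k : ℕ} (hk : k < n) (x ψ : Cantor) :
    prepend (digits n x) ψ k = x k := by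
  simp [digits, prepend, hk]

theorem digits_add (m n : ℕ) (x : Cantor) :
    digits (m + n) x = digits m x ++ digits n fun i => x (m + i) := by
  unfold digits
  rw [List.ofFn_add]
  rfl

theorem exists_expand_eq (x : Cantor) : ∃ t a, InUnit t a ∧ expand t a = x := by
  have hmono : Monotone fun n => cellMap (digits n x) 0 := by
    refine monotone_nat_of_le_succ fun n => ?_
    rw [digits_add, cellMap_append]
    exact (cellMap_strictMono _).monotone (cellMap_mem_Icc _ (by simp)).1
  have hanti : Antitone fun n => cellMap (digits n x) 1 := by
    refine antitone_nat_of_succ_le fun n => ?_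
    rw [digits_add, cellMap_append]
    exact (cellMap_strictMono _).monotone (cellMap_mem_Icc _ (by simp)).2
  have hmem := hmono.ciSup_mem_iInter_Icc_of_antitone hanti
    fun n => (cellMap_strictMono _).monotone zero_le_one
  set t := ⨆ n, cellMap (digits n x) 0
  have hs : ∀ n, ∃ s ∈ Icc (0 : ℝ) 1, t = cellMap (digits n x) s := by
    intro n
    obtain ⟨h1, h2⟩ := mem_iInter.1 hmem n
    have hp : (0 : ℝ) < 2 ^ (digits n x).length := by positivity
    refine ⟨(t - cellMap (digits n x) 0) * 2 ^ (digits n x).length, ⟨?_, ?_⟩, ?_⟩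
    · exact mul_nonneg (sub_nonneg.2 h1) hp.le
    · rw [cellMap_eq] at h2
      rw [← le_div_iff₀ hp]; linarith
    · rw [cellMap_eq]; field_simp; ring
  -- `s n` is the relative position in `[0, 1]` of the limit point `t` within the `n`-th nested
  -- cell.
  choose s hs01 hts using hs
  have hsub : ∀ n k, ∃ τ, s n = cellMap τ (s (n + k)) := by
    intro n k
    refine ⟨digits k fun i => x (n + i), (cellMap_strictMono (digits n x)).injective ?_⟩
    rw [← hts, ← cellMap_append, ← digits_add, ← hts]
  have hfin : ∀ a, (∀ n, s n ≠ bit !a) → ∃ t a, InUnit t a ∧ expand t a = x := by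
    intro a ha
    have hin : ∀ n, InUnit (s n) a := fun n => ⟨(hs01 n).1, (hs01 n).2, ha n⟩
    refine ⟨t, a, ?_, ?_⟩
    · rw [hts 0]; exact (hin 0).map _
    · funext k
      rw [hts (k + 1), expand_cellMap (hin _), prepend_digits_apply (Nat.lt_succ_self k)]
  -- If `t` is never the upper end of its cell, the side `false` works. Otherwise `true` works:
  -- being at an end persists in all deeper cells, so `s n = 1` and `s m = 0` would contradict each
  -- other at depth `n + m`.
  by_cases h1 : ∀ n, s n ≠ 1
  · exact hfin false h1
  refine hfin true fun m hm => h1 fun n hn => ?_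
  simp only [Bool.not_true, bit_false] at hm
  obtain ⟨τ, hτ⟩ := hsub n m
  obtain ⟨σ, hσ⟩ := hsub m n
  rw [add_comm] at hσ
  have h2 : s (n + m) = 1 := by
    refine le_antisymm (hs01 _).2 (not_lt.1 fun hlt => ?_)
    have := cellMap_strictMono τ hlt
    rw [← hτ, hn] at this
    exact absurd (cellMap_mem_Icc τ (s := 1) (by simp)).2 (not_le.2 this)
  have h3 : s (n + m) = 0 := by
    refine le_antisymm (not_lt.1 fun hlt => ?_) (hs01 _).1
    have := cellMap_strictMono σ hlt
    rw [← hσ, hm] at this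
    exact absurd (cellMap_mem_Icc σ (s := 0) (by simp)).1 (not_le.2 this)
  linarith

/-! ### Neighbourhoods in the Cantor set -/

/-- The point `(t', c)` is within distance `δ` of `t` and, if `t` is dyadic, on the side of `t` that
is given by `a`. -/
def Near (δ t : ℝ) (a : Bool) (t' : ℝ) (c : Bool) : Prop :=
  |t' - t| < δ ∧ (t ∈ dyadics → (a = false → t ≤ t') ∧ (a = true → t' ≤ t) ∧ (t' = t → c = a))

theorem Near.mono {δ δ' t t' : ℝ} {a c : Bool} (h : Near δ t a t' c) (hδ : δ ≤ δ') :
    Near δ' t a t' c := ⟨h.1.trans_le hδ, h.2⟩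

/-- Deep cells are short, and a dyadic `t` sits at their end on the side prescribed by `a`. Together
with `exists_delta_of_cell` this shows that the conditions `Near δ t a` describe a neighbourhood
basis of the point `expand t a`. -/
theorem exists_near_cell (t : ℝ) (a : Bool) {δ : ℝ} (hδ : 0 < δ) : ∃ n₀ : ℕ, ∀ n, n₀ ≤ n →
    ∃ (k : ℤ) (α : List Bool) (s : ℝ), α.length = n ∧ InUnit s a ∧ t = k + cellMap α s ∧
      ∀ w c, InUnit w c → Near δ t a (k + cellMap α w) c := by
  obtain ⟨n₁, hn₁⟩ := exists_pow_lt_of_lt_one hδ (by norm_num : (1 / 2 : ℝ) < 1)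
  obtain ⟨n₂, hn₂⟩ : ∃ n₂ : ℕ, t ∈ dyadics → ∀ (α : List Bool) (s : ℝ)
      (a : Bool) (k : ℤ), n₂ ≤ α.length → InUnit s a → t = k + cellMap α s → s = bit a := by
    by_cases ht : t ∈ dyadics
    · obtain ⟨n₂, h⟩ := exists_forall_eq_bit ht
      exact ⟨n₂, fun _ => h⟩
    · exact ⟨0, fun h => absurd h ht⟩
  refine ⟨max n₁ n₂, fun n hn => ?_⟩
  obtain ⟨k, hk⟩ := exists_int_inUnit t a
  obtain ⟨α, s, hα, hs, hts⟩ := exists_cellMap_eq hk n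
  have hts : t = k + cellMap α s := by linarith
  refine ⟨k, α, s, hα, hs, hts, fun w c hw => ⟨?_, fun ht => ?_⟩⟩
  · have hp : (0 : ℝ) < 2 ^ n := by positivity
    rw [hts, add_sub_add_left_eq_sub, cellMap_sub, hα, abs_div, abs_of_pos hp, div_lt_iff₀ hp]
    have h1 : |w - s| ≤ 1 := by
      rw [abs_le]
      constructor <;> linarith [hs.1, hs.2.1, hw.1, hw.2.1]
    have h2 : (1 / 2 : ℝ) ^ n < δ :=
      (pow_le_pow_of_le_one (by norm_num) (by norm_num) ((le_max_left _ _).trans hn)).trans_lt hn₁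
    rw [one_div, inv_pow, inv_lt_iff_one_lt_mul₀ hp] at h2
    linarith
  · have hsa := hn₂ ht α s a k (by rw [hα]; exact (le_max_right _ _).trans hn) hs hts
    subst hsa
    have hm := (cellMap_strictMono α).monotone
    rw [hts]
    refine ⟨?_, ?_, fun h => ?_⟩
    · rintro rfl
      simpa using hm hw.1
    · rintro rfl
      simpa using hm hw.2.1
    · have hwa : w = bit a := (cellMap_strictMono α).injective (by linarith)
      have := hw.2.2
      rw [hwa] at this
      cases a <;> cases c <;> simp_all

/-- Here `δ` is the distance from `t` to the end of the cell towards which `t'` may move. A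
nondyadic `t` is interior, since the ends of cells are dyadic, and the nearer end is taken. -/
theorem exists_delta_of_cell {t s : ℝ} {a : Bool} {k : ℤ} {α : List Bool}
    (ht : t = k + cellMap α s) (hs : InUnit s a) : ∃ δ > 0, ∀ t' c, Near δ t a t' c →
      ∃ w, InUnit w c ∧ t' = k + cellMap α w := by
  have hp : (0 : ℝ) < 2 ^ α.length := by positivity
  have hcell : ∀ t', t' = k + cellMap α (s + (t' - t) * 2 ^ α.length) := by
    intro t'
    have := cellMap_sub α (s + (t' - t) * 2 ^ α.length) s
    rw [add_sub_cancel_left, mul_div_cancel_right₀ _ hp.ne'] at this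
    linarith
  have hlt : ∀ {r t'}, |t' - t| < r / 2 ^ α.length →
      -r < (t' - t) * 2 ^ α.length ∧ (t' - t) * 2 ^ α.length < r := by
    intro r t' h
    rw [abs_lt, ← neg_div, div_lt_iff₀ hp, lt_div_iff₀ hp] at h
    exact h
  obtain ⟨h0, h1, h2⟩ := hs
  by_cases hd : t ∈ dyadics
  · cases a
    · have h1 : s < 1 := lt_of_le_of_ne h1 h2
      refine ⟨(1 - s) / 2 ^ α.length, div_pos (sub_pos.2 h1) hp, fun t' c h =>
        ⟨_, ⟨?_, ?_, ?_⟩, hcell t'⟩⟩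
      · have := mul_nonneg (sub_nonneg.2 ((h.2 hd).1 rfl)) hp.le
        linarith
      · linarith [(hlt h.1).2]
      · have h3 := mul_nonneg (sub_nonneg.2 ((h.2 hd).1 rfl)) hp.le
        cases c
        · simp only [Bool.not_false, bit_true]
          linarith [(hlt h.1).2]
        · simp only [Bool.not_true, bit_false]
          intro h4
          -- The forbidden endpoint can be reached only by `t' = t`, where `Near` forces the side
          -- `c` to be `a`.
          have h5 : (t' - t) * 2 ^ α.length = 0 := by linarith
          have h6 := (mul_eq_zero.1 h5).resolve_right hp.ne'
          have := (h.2 hd).2.2 (by linarith)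
          simp at this
    · have h0 : 0 < s := lt_of_le_of_ne h0 h2.symm
      refine ⟨s / 2 ^ α.length, div_pos h0 hp, fun t' c h => ⟨_, ⟨?_, ?_, ?_⟩, hcell t'⟩⟩
      · linarith [(hlt h.1).1]
      · have := mul_nonneg (sub_nonneg.2 ((h.2 hd).2.1 rfl)) hp.le
        linarith
      · have h3 := mul_nonneg (sub_nonneg.2 ((h.2 hd).2.1 rfl)) hp.le
        cases c
        · simp only [Bool.not_false, bit_true]
          intro h4
          have h5 : (t - t') * 2 ^ α.length = 0 := by linarith
          have h6 := (mul_eq_zero.1 h5).resolve_right hp.ne'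
          have := (h.2 hd).2.2 (by linarith)
          simp at this
        · simp only [Bool.not_true, bit_false]
          linarith [(hlt h.1).1]
  · have hs0 : s ≠ 0 := by
      rintro rfl
      exact hd (ht ▸ add_mem (intCast_mem _ _) (cellMap_mem_dyadics α (zero_mem _)))
    have hs1 : s ≠ 1 := by
      rintro rfl
      exact hd (ht ▸ add_mem (intCast_mem _ _) (cellMap_mem_dyadics α (one_mem _)))
    have h0 : 0 < s := lt_of_le_of_ne h0 hs0.symm
    have h1 : s < 1 := lt_of_le_of_ne h1 hs1
    refine ⟨min s (1 - s) / 2 ^ α.length, div_pos (lt_min h0 (sub_pos.2 h1)) hp, fun t' c h =>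
      ⟨_, ⟨?_, ?_, ?_⟩, hcell t'⟩⟩
    · linarith [(hlt h.1).1, min_le_left s (1 - s)]
    · linarith [(hlt h.1).2, min_le_right s (1 - s)]
    · cases c
      · simp only [Bool.not_false, bit_true]
        linarith [(hlt h.1).2, min_le_right s (1 - s)]
      · simp only [Bool.not_true, bit_false]
        linarith [(hlt h.1).1, min_le_left s (1 - s)]

theorem isOpen_cone (α : List Bool) : IsOpen (range (prepend α)) := by
  have : range (prepend α) = ⋂ k ∈ Finset.range α.length,
      {x : Cantor | x k = prepend α (fun _ => false) k} := by
    ext x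
    simp only [mem_range, mem_iInter, Finset.mem_range]
    constructor
    · rintro ⟨ψ, rfl⟩ k hk
      simp [prepend, hk]
    · intro h
      refine ⟨fun k => x (k + α.length), ?_⟩
      funext k
      by_cases hk : k < α.length
      · have : x k = prepend α (fun _ => false) k := h k hk
        simp [this, prepend, hk]
      · simp [prepend, hk, Nat.sub_add_cancel (not_lt.1 hk)]
  rw [this]
  exact isOpen_biInter_finset fun k _ => (isOpen_discrete {_}).preimage (continuous_apply k)

theorem eventually_of_cell {α : List Bool} {ψ : Cantor} {Q : Cantor → Prop}
    (h : ∀ w c, InUnit w c → Q (expand (cellMap α w) c)) : ∀ᶠ y in 𝓝 (prepend α ψ), Q y := by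
  filter_upwards [(isOpen_cone α).mem_nhds ⟨ψ, rfl⟩]
  rintro _ ⟨φ, rfl⟩
  obtain ⟨w, c, hw, rfl⟩ := exists_expand_eq φ
  rw [← expand_cellMap hw]
  exact h w c hw

theorem eventually_of_near {t : ℝ} {a : Bool} {δ : ℝ} (hδ : 0 < δ) {Q : Cantor → Prop}
    (h : ∀ t' c, Near δ t a t' c → Q (expand t' c)) : ∀ᶠ y in 𝓝 (expand t a), Q y := by
  obtain ⟨n₀, hn₀⟩ := exists_near_cell t a hδ
  obtain ⟨k, α, s, -, hs, rfl, hnear⟩ := hn₀ n₀ le_rfl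
  rw [expand_int_add, expand_cellMap hs]
  refine eventually_of_cell fun w c hw => ?_
  rw [← expand_int_add _ k]
  exact h _ _ (hnear w c hw)

/-! ### The action on the Cantor set -/

/-- The map of the Cantor set induced by a lift of a map of the circle. -/
noncomputable def cantorFun (f : CircleLift) (x : Cantor) : Cantor :=
  expand (f.1 (exists_expand_eq x).choose) (exists_expand_eq x).choose_spec.choose

/-- Well-definedness of the action. A dyadic number determines its side; a nondyadic number has a
nondyadic image, where the side is irrelevant. This uses that lifts preserve dyadicity in both
directions. -/
theorem expand_map_eq (f : CircleLift) {t t' : ℝ} {a a' : Bool}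
    (h : expand t' a' = expand t a) : expand (f.1 t') a' = expand (f.1 t) a := by
  obtain ⟨k, rfl, ha⟩ := eq_of_expand_eq h
  rw [CircleLift.map_add_int f.2, expand_add_int]
  by_cases ht : t' ∈ dyadics
  · rw [ha ht]
  · exact expand_eq_of_notMem (by rwa [f.2.2]) _ _

theorem cantorFun_expand (f : CircleLift) (t : ℝ) (a : Bool) :
    cantorFun f (expand t a) = expand (f.1 t) a :=
  expand_map_eq f (exists_expand_eq (expand t a)).choose_spec.choose_spec.2

theorem Near.map {f : CircleLift} {δ δ' t t' : ℝ} {a c : Bool}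
    (hf : ∀ s, |s - t| < δ' → |f.1 s - f.1 t| < δ) (h : Near δ' t a t' c) :
    Near δ (f.1 t) a (f.1 t') c := by
  refine ⟨hf _ h.1, fun ht => ?_⟩
  obtain ⟨h1, h2, h3⟩ := h.2 ((f.2.2 t).1 ht)
  exact ⟨fun ha => f.1.monotone (h1 ha), fun ha => f.1.monotone (h2 ha),
    fun h => h3 (f.1.injective h)⟩

theorem exists_near_map (f : CircleLift) (t : ℝ) (a : Bool) {δ : ℝ} (hδ : 0 < δ) :
    ∃ δ' > 0, ∀ t' c, Near δ' t a t' c → Near δ (f.1 t) a (f.1 t') c := by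
  obtain ⟨δ', hδ', h⟩ := Metric.continuousAt_iff.1 (f.1.continuous.continuousAt (x := t)) δ hδ
  exact ⟨δ', hδ', fun t' c hn => hn.map fun s hs => h hs⟩

theorem continuous_cantorFun (f : CircleLift) : Continuous (cantorFun f) := by
  refine continuous_pi fun n => continuous_iff_continuousAt.2 fun x => ?_
  obtain ⟨t, a, -, rfl⟩ := exists_expand_eq x
  obtain ⟨k, hk⟩ := exists_int_inUnit (f.1 t) a
  obtain ⟨α, s, hα, hs, hts⟩ := exists_cellMap_eq hk (n + 1)
  obtain ⟨δ, hδ, hcell⟩ := exists_delta_of_cell (show f.1 t = k + cellMap α s by linarith) hs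
  obtain ⟨δ', hδ', hnear⟩ := exists_near_map f t a hδ
  have hval : ∀ t' c, Near δ (f.1 t) a (f.1 t') c →
      cantorFun f (expand t' c) n = prepend α (fun _ => false) n := by
    intro t' c h
    obtain ⟨w, hw, hw'⟩ := hcell _ _ h
    rw [cantorFun_expand, hw', expand_int_add, expand_cellMap hw]
    simp [prepend, hα]
  have h1 : ∀ᶠ y in 𝓝 (expand t a), cantorFun f y n = prepend α (fun _ => false) n :=
    eventually_of_near hδ' fun t' c h => hval t' c (hnear t' c h)
  exact continuousAt_const.congr (h1.mono fun y hy => hy.symm)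

/-- The homomorphism from lifts of homeomorphisms of the circle to homeomorphisms of the Cantor
set. -/
noncomputable def cantorHom : CircleLift →* (Cantor ≃ₜ Cantor) :=
  MonoidHom.mk' (fun f =>
    { toFun := cantorFun f
      invFun := cantorFun f⁻¹
      left_inv := fun x => by
        obtain ⟨t, a, -, rfl⟩ := exists_expand_eq x
        rw [cantorFun_expand, cantorFun_expand]
        exact congrArg (expand · a) (RelIso.inv_apply_self f.1 t)
      right_inv := fun x => by
        obtain ⟨t, a, -, rfl⟩ := exists_expand_eq x
        rw [cantorFun_expand, cantorFun_expand]
        exact congrArg (expand · a) (RelIso.apply_inv_self f.1 t)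
      continuous_toFun := continuous_cantorFun f
      continuous_invFun := continuous_cantorFun f⁻¹ })
    (fun f g => by
      ext x : 1
      obtain ⟨t, a, -, rfl⟩ := exists_expand_eq x
      change cantorFun (f * g) _ = cantorFun f (cantorFun g _)
      rw [cantorFun_expand, cantorFun_expand, cantorFun_expand]; rfl)

theorem cantorHom_expand (f : CircleLift) (t : ℝ) (a : Bool) :
    cantorHom f (expand t a) = expand (f.1 t) a := cantorFun_expand f t a

theorem exists_int_of_cantorHom_eq_one {f : CircleLift} (h : cantorHom f = 1) (t : ℝ) :
    ∃ k : ℤ, f.1 t = t + k := by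
  have := congrArg (fun F : Cantor ≃ₜ Cantor => F (expand t false)) h
  obtain ⟨k, hk, -⟩ := eq_of_expand_eq ((this.symm.trans (cantorHom_expand f t false) :
    expand t false = expand (f.1 t) false))
  exact ⟨k, hk⟩

theorem cantorHom_eq_one_of_int {f : CircleLift} (k : ℤ) (h : ∀ t, f.1 t = t + k) :
    cantorHom f = 1 := by
  ext x : 1
  obtain ⟨t, a, -, rfl⟩ := exists_expand_eq x
  rw [cantorHom_expand, h, expand_add_int]; rfl

/-- An affine map with slope a power of `2` and dyadic translation part maps the sufficiently small
cells affinely to cells. -/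
theorem exists_affine_cell (m : ℤ) {b : ℝ} (hb : b ∈ dyadics) : ∃ n₀ : ℕ, ∀ (k : ℤ)
    (α : List Bool), n₀ ≤ α.length → ∃ (l : ℤ) (β : List Bool),
      ∀ w, 2 ^ m * (k + cellMap α w) + b = l + cellMap β w := by
  obtain ⟨n₁, hn₁⟩ := exists_forall_two_pow_mul_eq_int hb
  -- The image of a cell of depth `α.length` has length `2 ^ (-n)` with `n = α.length - m`. The
  -- bound makes `n` a natural number at least `n₁`, so that `2 ^ n * b` is an integer and the image
  -- starts on the grid of depth `n`.
  refine ⟨n₁ + 2 * m.natAbs, fun k α hα => ?_⟩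
  obtain ⟨n, hn⟩ : ∃ n : ℕ, (n : ℤ) = α.length - m := ⟨(α.length - m).toNat, by omega⟩
  have hnn : n₁ ≤ n := by omega
  obtain ⟨zb, hzb⟩ := hn₁ n hnn
  obtain ⟨zα, hzα⟩ := exists_int_two_pow_mul_cellMap α 0
  have hpow : (2 : ℝ) ^ n * 2 ^ m = 2 ^ α.length := by
    rw [← zpow_natCast, ← zpow_add₀ two_ne_zero, ← zpow_natCast]; congr 1; omega
  set d : ℝ := 2 ^ m * (k + cellMap α 0) + b with hd
  have hz : 2 ^ n * d = ((2 ^ α.length * k + zα + zb : ℤ) : ℝ) := by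
    push_cast
    rw [hd, mul_add, ← mul_assoc, hpow, hzb, mul_add, hzα]; ring
  obtain ⟨l, hl⟩ := exists_int_inUnit d false
  obtain ⟨β, s, hβ, hs, hds⟩ := exists_cellMap_eq hl n
  have hs0 : s = bit false := by
    refine hs.eq_bit_of_int (α := β) (z := 2 ^ α.length * k + zα + zb - 2 ^ n * l) ?_
    rw [← hds, hβ, mul_sub, hz]
    push_cast; ring
  rw [hs0, bit_false] at hds
  refine ⟨l, β, fun w => ?_⟩
  have hwm : 2 ^ m * (w / 2 ^ α.length) = w / 2 ^ n := by
    rw [← hpow]; field_simp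
  rw [cellMap_eq α w, cellMap_eq β w, ← hds, hβ, ← hwm, hd]
  ring

/-- A breakpoint is dyadic and hence splits into two points of the Cantor set, each of which sees a
single affine germ. -/
theorem exists_near_affine {f : ℝ → ℝ} {t : ℝ} (h : DyadicPLAt f t) (a : Bool) :
    ∃ (m : ℤ) (b : ℝ), b ∈ dyadics ∧ ∃ δ > 0, ∀ t' c, Near δ t a t' c → f t' = 2 ^ m * t' + b := by
  obtain ⟨m, n, b, c, hb, hc, hl, hr, hx⟩ := h
  by_cases hd : t ∈ dyadics
  · cases a
    · obtain ⟨δ, hδ, h⟩ := Metric.mem_nhdsWithin_iff.1 hr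
      exact ⟨n, c, hc, δ, hδ, fun t' _ h' => h ⟨h'.1, (h'.2 hd).1 rfl⟩⟩
    · obtain ⟨δ, hδ, h⟩ := Metric.mem_nhdsWithin_iff.1 hl
      exact ⟨m, b, hb, δ, hδ, fun t' _ h' => h ⟨h'.1, (h'.2 hd).2.1 rfl⟩⟩
  · obtain ⟨rfl, rfl⟩ := hx hd
    have h : ∀ᶠ s in 𝓝 t, f s = 2 ^ m * s + b := by
      rw [← nhdsLE_sup_nhdsGE, eventually_sup]
      exact ⟨hl, hr⟩
    obtain ⟨δ, hδ, h⟩ := Metric.eventually_nhds_iff.1 h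
    exact ⟨m, b, hb, δ, hδ, fun t' _ h' => h h'.1⟩

/-- On a sufficiently deep cell the lift is affine and its image is again a cell, up to an integer;
the relative position is kept, so the digits after the prefix are unchanged. -/
theorem isPrefixReplacementAt_cantorHom {f : CircleLift} {t : ℝ} (h : DyadicPLAt f.1 t) (a : Bool) :
    IsPrefixReplacementAt (cantorHom f) (expand t a) := by
  obtain ⟨m, b, hb, δ, hδ, haff⟩ := exists_near_affine h a
  obtain ⟨n₀, hn₀⟩ := exists_affine_cell m hb
  obtain ⟨n₁, hn₁⟩ := exists_near_cell t a hδ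
  obtain ⟨k, α, s, hα, hs, rfl, hnear⟩ := hn₁ (max n₀ n₁) (le_max_right _ _)
  obtain ⟨l, β, hβ⟩ := hn₀ k α (by rw [hα]; exact le_max_left _ _)
  refine ⟨α, β, ?_⟩
  rw [expand_int_add, expand_cellMap hs]
  refine eventually_of_cell fun w c hw => ⟨expand w c, expand_cellMap hw α, ?_⟩
  rw [← expand_int_add _ k, cantorHom_expand, haff _ _ (hnear w c hw), hβ, expand_int_add,
    expand_cellMap hw]

theorem cantorHom_mem_thompsonV {f : CircleLift} (hf : f.1 ∈ DyadicIso) :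
    cantorHom f ∈ ThompsonV := by
  intro x
  obtain ⟨t, a, -, rfl⟩ := exists_expand_eq x
  exact isPrefixReplacementAt_cantorHom (hf t) a

theorem expand_notMem_sing {f : CircleLift} {t : ℝ} {a : Bool} {δ : ℝ} (hδ : 0 < δ)
    {g : CircleLift} (hg : g.1 ∈ DyadicIso) (h : ∀ t' c, Near δ t a t' c → f.1 t' = g.1 t') :
    expand t a ∉ sing ThompsonV (cantorHom f) := by
  refine fun hs => hs ⟨cantorHom g, cantorHom_mem_thompsonV hg, eventually_of_near hδ ?_⟩
  intro t' c hn
  rw [cantorHom_expand, cantorHom_expand, h t' c hn]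

theorem expand_notMem_sing_of_dyadicPLAt {f : CircleLift} {t : ℝ} (h : DyadicPLAt f.1 t)
    (a : Bool) : expand t a ∉ sing ThompsonV (cantorHom f) := by
  obtain ⟨F, hF, hFf⟩ := exists_dyadicIso_circleLift h
  obtain ⟨δ, hδ, hball⟩ := Metric.eventually_nhds_iff.1 hFf
  exact expand_notMem_sing hδ hF fun t' c hn => (hball hn.1).symm

theorem inUnit_bit (a : Bool) : InUnit (bit a) a := by
  cases a <;> simp [InUnit]

theorem expand_bit (a : Bool) : expand (bit a) a = fun _ => a := by
  funext k
  cases a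
  · simp [expand, sideFloor]
  · have : ⌈(2 : ℝ) ^ (k + 1)⌉ = 2 ^ (k + 1) := by exact_mod_cast Int.ceil_intCast (2 ^ (k + 1))
    have h2 : Even ((2 : ℤ) ^ (k + 1)) := by rw [pow_succ]; exact even_two.mul_left _
    simp [expand, sideFloor, this, h2.sub_odd odd_one]

theorem exists_cellMap_bit {t : ℝ} (ht : t ∈ dyadics) (a : Bool) :
    ∃ (k : ℤ) (α : List Bool), t = k + cellMap α (bit a) := by
  obtain ⟨n₀, hn₀⟩ := exists_forall_eq_bit ht
  obtain ⟨k, hk⟩ := exists_int_inUnit t a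
  obtain ⟨α, s, hα, hs, hts⟩ := exists_cellMap_eq hk n₀
  have hts : t = k + cellMap α s := by linarith
  rw [hn₀ α s a k hα.ge hs hts] at hts
  exact ⟨k, α, hts⟩

theorem expand_cellMap_bit (k : ℤ) (α : List Bool) (a : Bool) :
    expand (k + cellMap α (bit a)) a = eventuallyConst α a := by
  rw [expand_int_add, expand_cellMap (inUnit_bit a), expand_bit]; rfl

theorem expand_mem_endPoints {t : ℝ} (ht : t ∈ dyadics) (a : Bool) : expand t a ∈ endPoints := by
  obtain ⟨k, α, rfl⟩ := exists_cellMap_bit ht a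
  exact ⟨α, a, expand_cellMap_bit k α a⟩

/-- The point `t` is the end `bit a` of its cell, and that end is fixed by `s ↦ (bit a + s) / 2`.
Deleting the letter `a` after the prefix therefore doubles the distance to `t`. -/
theorem exists_near_isL {t : ℝ} (ht : t ∈ dyadics) (a : Bool) :
    ∃ δ > 0, ∀ t' c, Near δ t a t' c → IsL (expand t a) (expand t' c) (expand (2 * t' - t) c) := by
  obtain ⟨k, α, hts⟩ := exists_cellMap_bit ht a
  have hbit : t = k + cellMap (α ++ [a]) (bit a) := by
    rw [cellMap_append, cellMap, cellMap, add_self_div_two, hts]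
  obtain ⟨δ, hδ, h⟩ := exists_delta_of_cell hbit (inUnit_bit a)
  refine ⟨δ, hδ, fun t' c hn => ?_⟩
  obtain ⟨w, hw, rfl⟩ := h t' c hn
  have e : 2 * (k + cellMap (α ++ [a]) w) - t = k + cellMap α w := by
    have h1 := cellMap_sub α (cellMap [a] w) (bit a)
    have h2 := cellMap_sub α w (bit a)
    simp only [cellMap] at h1
    rw [hts, cellMap_append]
    simp only [cellMap]
    have h3 : ((bit a + w) / 2 - bit a) / 2 ^ α.length = (w - bit a) / 2 ^ α.length / 2 := by ring
    rw [h3, ← h2] at h1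
    linarith
  rw [e, expand_int_add, expand_int_add, expand_cellMap hw, expand_cellMap hw]
  exact ⟨α, a, expand w c, by rw [hts, expand_cellMap_bit], rfl, rfl⟩

theorem commutesWithShiftAt_cantorHom {f : CircleLift} {t : ℝ} (ht : t ∈ dyadics) (a : Bool)
    (h : ∀ᶠ s in 𝓝 t, f.1 (2 * s - t) = 2 * f.1 s - f.1 t) :
    CommutesWithShiftAt (cantorHom f) (expand t a) := by
  obtain ⟨δ₁, hδ₁, h1⟩ := exists_near_isL ht a
  obtain ⟨δ₂, hδ₂, h2⟩ := exists_near_isL ((f.2.2 t).2 ht) a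
  obtain ⟨δ₃, hδ₃, h3⟩ := exists_near_map f t a hδ₂
  obtain ⟨δ₄, hδ₄, h4⟩ := Metric.eventually_nhds_iff.1 h
  refine eventually_of_near (lt_min (lt_min hδ₁ hδ₃) hδ₄) fun t' c hn => ?_
  have e := h4 (hn.mono (min_le_right _ _)).1
  refine ⟨_, h1 t' c (hn.mono ((min_le_left _ _).trans (min_le_left _ _))), ?_⟩
  rw [cantorHom_expand, cantorHom_expand, cantorHom_expand, e]
  exact h2 _ _ (h3 t' c (hn.mono ((min_le_left _ _).trans (min_le_right _ _))))

/-- At the first differing digit the points lie in the lower and the upper half of a cell. They can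
have the same real value only at the midpoint, approached from the left and from the right
respectively. -/
theorem lt_of_expand_lt {s s' : ℝ} {a a' : Bool} (hs : InUnit s a) (hs' : InUnit s' a')
    (h : toLex (expand s a) < toLex (expand s' a')) :
    s ≤ s' ∧ (s = s' → a = true ∧ a' = false) := by
  obtain ⟨i, h1, h2⟩ := h
  replace h1 : ∀ j < i, expand s a j = expand s' a' j := h1
  replace h2 : expand s a i < expand s' a' i := h2
  induction i generalizing s s' with
  | zero =>
    obtain ⟨α, w, hα, hw, rfl⟩ := exists_cellMap_eq hs 1
    obtain ⟨β, w', hβ, hw', rfl⟩ := exists_cellMap_eq hs' 1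
    obtain ⟨b, rfl⟩ := List.length_eq_one_iff.1 hα
    obtain ⟨b', rfl⟩ := List.length_eq_one_iff.1 hβ
    rw [expand_cellMap hw, expand_cellMap hw', prepend_singleton_zero, prepend_singleton_zero,
      Bool.lt_iff] at h2
    obtain ⟨rfl, rfl⟩ := h2
    obtain ⟨h3, h4, h5⟩ := hw
    obtain ⟨h3', h4', h5'⟩ := hw'
    simp only [cellMap, bit_true, bit_false]
    refine ⟨by linarith, fun h => ⟨?_, ?_⟩⟩
    · cases a
      · exact absurd (by linarith : w = 1) h5
      · rfl
    · cases a'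
      · rfl
      · exact absurd (by linarith : w' = 0) h5'
  | succ i ih =>
    obtain ⟨α, w, hα, hw, rfl⟩ := exists_cellMap_eq hs 1
    obtain ⟨β, w', hβ, hw', rfl⟩ := exists_cellMap_eq hs' 1
    obtain ⟨b, rfl⟩ := List.length_eq_one_iff.1 hα
    obtain ⟨b', rfl⟩ := List.length_eq_one_iff.1 hβ
    rw [expand_cellMap hw, expand_cellMap hw'] at h1 h2
    obtain rfl : b = b' := by
      simpa only [prepend_singleton_zero] using h1 0 (Nat.succ_pos i)
    rw [prepend_singleton_succ, prepend_singleton_succ] at h2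
    have := ih hw hw' (fun j hj => by
      simpa only [prepend_singleton_succ] using h1 (j + 1) (Nat.succ_lt_succ hj)) h2
    exact ⟨(cellMap_strictMono _).monotone this.1,
      fun h => this.2 ((cellMap_strictMono _).injective h)⟩

/-- Preserving the cell rules out passing through an integer, where the order of the circle breaks.
Within the cell the lift is increasing and keeps sides. -/
theorem orderPreservingAt_cantorHom {f : CircleLift} {α : List Bool} {ψ : Cantor}
    (h : ∀ w c, InUnit w c → ∃ w', InUnit w' c ∧ f.1 (cellMap α w) = cellMap α w') :
    OrderPreservingAt (cantorHom f) (prepend α ψ) := by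
  refine ⟨range (prepend α), (isOpen_cone α).mem_nhds ⟨ψ, rfl⟩, ?_⟩
  rintro _ ⟨x, rfl⟩ _ ⟨y, rfl⟩ hxy
  obtain ⟨w, c, hw, rfl⟩ := exists_expand_eq x
  obtain ⟨z, d, hz, rfl⟩ := exists_expand_eq y
  obtain ⟨w', hw', ew⟩ := h w c hw
  obtain ⟨z', hz', ez⟩ := h z d hz
  rw [← expand_cellMap hw, ← expand_cellMap hz] at hxy
  have key := lt_of_expand_lt (hw.map α) (hz.map α) hxy
  rcases lt_trichotomy (toLex (cantorHom f (prepend α (expand w c))))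
    (toLex (cantorHom f (prepend α (expand z d)))) with h1 | h1 | h1
  · exact h1
  · rw [← expand_cellMap hw, ← expand_cellMap hz] at h1
    rw [(cantorHom f).injective (toLex.injective h1)] at hxy
    exact absurd hxy (lt_irrefl _)
  · rw [← expand_cellMap hw, ← expand_cellMap hz, cantorHom_expand, cantorHom_expand, ew, ez] at h1
    have key' := lt_of_expand_lt (hz'.map α) (hw'.map α) h1
    rw [← ew, ← ez] at key'
    -- A reversal would force equal real coordinates, and then the two comparisons demand opposite
    -- values of the side `c`.
    have e := le_antisymm key.1 (f.1.le_iff_le.1 key'.1)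
    have h2 := (key.2 e).1
    have h3 := (key'.2 (congrArg f.1 e.symm)).2
    rw [h2] at h3
    exact absurd h3 (by decide)

/-! ### Brin's group and Thompson's group `V` inside `V𝒜` -/

/-- The word `0 ^ k 1`. -/
def coneWord : ℕ → List Bool
  | 0 => [true]
  | k + 1 => false :: coneWord k

theorem cellMap_coneWord (k : ℕ) (s : ℝ) : cellMap (coneWord k) s = width k * (1 + s) := by
  induction k with
  | zero => simp [coneWord, cellMap, width]; ring
  | succ k ih =>
    simp only [coneWord, cellMap, bit_false, ih, width, pow_succ]; ring

/-- The interval of `chart k` consists of the numbers whose fractional expansion begins with `0 ^ k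
1`, so insertion on the circle and on the Cantor set use the same lift. -/
theorem chart_eq_cellMap (k : ℕ) (j : ℤ) (r : ℝ) :
    chart k j r = j + cellMap (coneWord k) (theta r) := by
  rw [cellMap_coneWord, chart]

theorem disjoint_cone {k l : ℕ} (h : k ≠ l) :
    Disjoint (range (prepend (coneWord k))) (range (prepend (coneWord l))) := by
  have key : ∀ k l (ψ φ : Cantor), prepend (coneWord k) ψ = prepend (coneWord l) φ → k = l := by
    intro k
    induction k with
    | zero =>
      intro l ψ φ h
      rcases l with _ | l
      · rfl
      · rw [coneWord, coneWord, prepend_cons false] at h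
        have := congrFun h 0
        rw [prepend_singleton_zero, prepend_singleton_zero] at this
        simp at this
    | succ k ih =>
      intro l ψ φ h
      rcases l with _ | l
      · rw [coneWord, coneWord, prepend_cons false] at h
        have := congrFun h 0
        rw [prepend_singleton_zero, prepend_singleton_zero] at this
        simp at this
      · rw [coneWord, coneWord, prepend_cons, prepend_cons _ (coneWord l)] at h
        rw [ih l ψ φ (prepend_injective _ h)]
  rw [Set.disjoint_left]
  rintro _ ⟨ψ, rfl⟩ ⟨φ, hφ⟩
  exact h (key k l ψ φ hφ.symm)

theorem isClosed_cone (α : List Bool) : IsClosed (range (prepend α)) :=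
  (isCompact_range (continuous_prepend α)).isClosed

theorem insertHom_cellMap (k : ℕ) (f : ℝ ≃o ℝ) {w : ℝ} {c : Bool} (hw : InUnit w c) :
    ∃ w', InUnit w' c ∧ insertHom k f (cellMap (coneWord k) w) = cellMap (coneWord k) w' := by
  have h1 := insertHom_left_endpoint k f 0
  have h2 := insertHom_right_endpoint k f 0
  rw [Int.cast_zero, zero_add] at h1 h2
  rcases hw.1.eq_or_lt with rfl | h0
  · refine ⟨0, hw, ?_⟩
    rw [cellMap_coneWord, add_zero, mul_one, h1]
  rcases hw.2.1.eq_or_lt with rfl | h3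
  · refine ⟨1, hw, ?_⟩
    rw [cellMap_coneWord, one_add_one_eq_two, mul_comm, h2]
  obtain ⟨r, rfl⟩ := exists_theta_eq h0 h3
  refine ⟨theta (f r), ⟨(theta_pos _).le, (theta_lt_one _).le, ?_⟩, ?_⟩
  · cases c
    · exact (theta_lt_one _).ne
    · exact (theta_pos _).ne'
  · have := insertHom_chart k f 0 r
    rwa [chart_eq_cellMap, chart_eq_cellMap, Int.cast_zero, zero_add, zero_add] at this

/-- Each endpoint of the interval gives two points of the Cantor set, and the one facing outwards
sees only the identity. What remains is the first and the last point of the cone of `0 ^ k 1`. -/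
theorem sing_cantorHom_brinLift_subset (k : ℕ) (f : BrinA) :
    sing ThompsonV (cantorHom (brinLift k f)) ⊆
      {expand (width k) false, expand (2 * width k) true} := by
  intro x hx
  obtain ⟨t, a, -, rfl⟩ := exists_expand_eq x
  have hw := width_mem_dyadics k
  by_cases h1 : ∃ j : ℤ, t = j + width k
  · obtain ⟨j, rfl⟩ := h1
    cases a
    · rw [expand_int_add]; exact mem_insert _ _
    · obtain ⟨δ, hδ, h⟩ :=
        Metric.mem_nhdsWithin_iff.1 (eventually_insertHom_left k (brinIso f) j)
      refine absurd hx (expand_notMem_sing hδ (g := 1) (one_mem _) fun t' c hn => ?_)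
      exact h ⟨hn.1, (hn.2 (add_mem (intCast_mem _ _) hw)).2.1 rfl⟩
  by_cases h2 : ∃ j : ℤ, t = j + 2 * width k
  · obtain ⟨j, rfl⟩ := h2
    cases a
    · obtain ⟨δ, hδ, h⟩ :=
        Metric.mem_nhdsWithin_iff.1 (eventually_insertHom_right k (brinIso f) j)
      refine absurd hx (expand_notMem_sing hδ (g := 1) (one_mem _) fun t' c hn => ?_)
      exact h ⟨hn.1, (hn.2 (add_mem (intCast_mem _ _) (mul_mem two_mem_dyadics hw))).1 rfl⟩
    · rw [expand_int_add]; exact mem_insert_of_mem _ rfl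
  · refine absurd hx (expand_notMem_sing_of_dyadicPLAt (dyadicPLAt_insertHom k (brinIso_mem f)
      (fun j hj => h1 ⟨j, hj⟩) fun j hj => h2 ⟨j, hj⟩) a)

theorem expand_width (k : ℕ) :
    expand (width k) false = prepend (coneWord k) (fun _ => false) ∧
      expand (2 * width k) true = prepend (coneWord k) (fun _ => true) := by
  rw [← expand_bit false, ← expand_bit true, ← expand_cellMap (inUnit_bit _),
    ← expand_cellMap (inUnit_bit _), cellMap_coneWord, cellMap_coneWord, bit_false, bit_true,
    add_zero, mul_one, one_add_one_eq_two, mul_comm]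
  exact ⟨rfl, rfl⟩

theorem cantorHom_brinLift_mem (k : ℕ) (f : BrinA) : cantorHom (brinLift k f) ∈ GroupVA := by
  have hsub := sing_cantorHom_brinLift_subset k f
  have hw := width_mem_dyadics k
  obtain ⟨N, -, hN⟩ := f.2.2
  refine ⟨(toFinite _).subset hsub, hsub.trans ?_, fun p hp => ⟨?_, ?_⟩⟩
  · rintro p (rfl | rfl)
    · exact expand_mem_endPoints hw _
    · exact expand_mem_endPoints (mul_mem two_mem_dyadics hw) _
  · rcases hsub hp with rfl | rfl
    · rw [(expand_width k).1]
      exact orderPreservingAt_cantorHom fun w c hw => insertHom_cellMap k (brinIso f) hw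
    · rw [(expand_width k).2]
      exact orderPreservingAt_cantorHom fun w c hw => insertHom_cellMap k (brinIso f) hw
  · rcases hsub hp with rfl | rfl
    · refine commutesWithShiftAt_cantorHom hw _ ?_
      have h1 := insertHom_doubling_left k (f := brinIso f) hN 0
      have h2 := insertHom_left_endpoint k (brinIso f) 0
      rw [Int.cast_zero, zero_add] at h1 h2
      rw [brinLift_coe, h2]
      exact h1
    · refine commutesWithShiftAt_cantorHom (mul_mem two_mem_dyadics hw) _ ?_
      have h1 := insertHom_doubling_right k (f := brinIso f) hN 0
      have h2 := insertHom_right_endpoint k (brinIso f) 0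
      rw [Int.cast_zero, zero_add] at h1 h2
      rw [brinLift_coe, h2]
      exact h1

/-- The `k`-th copy of Brin's group in `V𝒜`. -/
noncomputable def brinToVA (k : ℕ) : BrinA →* GroupVA :=
  (cantorHom.comp (brinLift k)).codRestrict GroupVA (cantorHom_brinLift_mem k)

theorem brinToVA_injective (k : ℕ) : Function.Injective (brinToVA k) := by
  rw [injective_iff_map_eq_one]
  intro f hf
  exact brinLift_eq_one_of_int (exists_int_of_cantorHom_eq_one (congrArg Subtype.val hf))

theorem homeoSupport_brinToVA_subset (k : ℕ) (f : BrinA) :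
    homeoSupport (brinToVA k f).1 ⊆ range (prepend (coneWord k)) := by
  refine closure_minimal ?_ (isClosed_cone _)
  intro x hx
  obtain ⟨t, a, -, rfl⟩ := exists_expand_eq x
  rcases chart_cases k t with ⟨j, r, rfl⟩ | h
  · have hr : InUnit (theta r) a := by
      refine ⟨(theta_pos _).le, (theta_lt_one _).le, ?_⟩
      cases a
      · exact (theta_lt_one _).ne
      · exact (theta_pos _).ne'
    rw [chart_eq_cellMap, expand_int_add, expand_cellMap hr]
    exact ⟨_, rfl⟩
  · refine absurd ?_ hx
    refine (cantorHom_expand (brinLift k f) t a).trans ?_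
    rw [brinLift_coe, insertHom_of_forall_ne _ h]

/-! ### Copies of `V` in cones. -/

open Classical in
/-- The map that acts as `h` on the cone of the sequences that begin with `α`, and is the identity
elsewhere. -/
noncomputable def coneFun (α : List Bool) (h : Cantor → Cantor) (x : Cantor) : Cantor :=
  if x ∈ range (prepend α) then prepend α (h fun k => x (k + α.length)) else x

theorem prepend_shift (α : List Bool) (ψ : Cantor) :
    (fun k => prepend α ψ (k + α.length)) = ψ := by
  funext k; simp [prepend]

theorem coneFun_prepend (α : List Bool) (h : Cantor → Cantor) (ψ : Cantor) :
    coneFun α h (prepend α ψ) = prepend α (h ψ) := by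
  rw [coneFun, if_pos ⟨ψ, rfl⟩, prepend_shift]

theorem coneFun_of_notMem {α : List Bool} (h : Cantor → Cantor) {x : Cantor}
    (hx : x ∉ range (prepend α)) : coneFun α h x = x := if_neg hx

theorem coneFun_comp (α : List Bool) (g h : Cantor → Cantor) (x : Cantor) :
    coneFun α g (coneFun α h x) = coneFun α (fun y => g (h y)) x := by
  by_cases hx : x ∈ range (prepend α)
  · obtain ⟨ψ, rfl⟩ := hx
    simp only [coneFun_prepend]
  · simp only [coneFun_of_notMem _ hx]

theorem coneFun_id (α : List Bool) (x : Cantor) : coneFun α (fun y => y) x = x := by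
  by_cases hx : x ∈ range (prepend α)
  · obtain ⟨ψ, rfl⟩ := hx
    simp only [coneFun_prepend]
  · simp only [coneFun_of_notMem _ hx]

theorem continuous_shift (n : ℕ) : Continuous fun (x : Cantor) (k : ℕ) => x (k + n) :=
  continuous_pi fun _ => continuous_apply _

theorem continuous_coneFun (α : List Bool) {h : Cantor → Cantor} (hh : Continuous h) :
    Continuous (coneFun α h) := by
  classical
  refine Continuous.if (p := fun x => x ∈ range (prepend α)) (fun x hx => ?_)
    ((continuous_prepend α).comp (hh.comp (continuous_shift α.length))) continuous_id
  have : frontier {x | x ∈ range (prepend α)} = ∅ :=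
    IsClopen.frontier_eq ⟨isClosed_cone α, isOpen_cone α⟩
  rw [this] at hx
  exact absurd hx (notMem_empty x)

/-- The homomorphism that inserts a homeomorphism of the Cantor set into the cone of `α`. -/
noncomputable def coneHom (α : List Bool) : (Cantor ≃ₜ Cantor) →* (Cantor ≃ₜ Cantor) :=
  MonoidHom.mk' (fun h =>
    { toFun := coneFun α h
      invFun := coneFun α h.symm
      left_inv := fun x => by simp [coneFun_comp, coneFun_id]
      right_inv := fun x => by simp [coneFun_comp, coneFun_id]
      continuous_toFun := continuous_coneFun α h.continuous
      continuous_invFun := continuous_coneFun α h.symm.continuous })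
    (fun g h => by ext x : 1; exact (coneFun_comp α g h x).symm)

theorem coneHom_prepend (α : List Bool) (h : Cantor ≃ₜ Cantor) (ψ : Cantor) :
    coneHom α h (prepend α ψ) = prepend α (h ψ) := coneFun_prepend α h ψ

theorem coneHom_of_notMem {α : List Bool} (h : Cantor ≃ₜ Cantor) {x : Cantor}
    (hx : x ∉ range (prepend α)) : coneHom α h x = x := coneFun_of_notMem h hx

theorem coneHom_mem_thompsonV (α : List Bool) {h : Cantor ≃ₜ Cantor} (hh : h ∈ ThompsonV) :
    coneHom α h ∈ ThompsonV := by
  intro x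
  by_cases hx : x ∈ range (prepend α)
  · obtain ⟨ψ, rfl⟩ := hx
    obtain ⟨μ, ν, hψ⟩ := hh ψ
    refine ⟨α ++ μ, α ++ ν, ?_⟩
    have ht := (continuous_shift α.length).tendsto (prepend α ψ)
    rw [prepend_shift] at ht
    filter_upwards [ht.eventually hψ, (isOpen_cone α).mem_nhds ⟨ψ, rfl⟩]
    rintro _ h1 ⟨φ, rfl⟩
    rw [prepend_shift] at h1
    obtain ⟨ρ, h1, h2⟩ := h1
    refine ⟨ρ, ?_, ?_⟩
    · rw [prepend_append, h1]
    · rw [prepend_append, coneHom_prepend, h2]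
  · refine ⟨[], [], ?_⟩
    filter_upwards [(isClosed_cone α).isOpen_compl.mem_nhds hx] with y hy
    refine ⟨y, ?_, ?_⟩
    · funext k; simp [prepend]
    · rw [coneHom_of_notMem h hy]; funext k; simp [prepend]

theorem thompsonV_le_groupVA : ThompsonV ≤ GroupVA := fun f hf => by
  have : sing ThompsonV f = ∅ := sing_of_mem hf
  simp [GroupVA, MemVA, this]

/-- The `k`-th copy of Thompson's group `V` in `V𝒜`. -/
noncomputable def thompsonToVA (k : ℕ) : ThompsonV →* GroupVA :=
  ((coneHom (coneWord k)).comp ThompsonV.subtype).codRestrict GroupVA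
    fun h => thompsonV_le_groupVA (coneHom_mem_thompsonV _ h.2)

theorem thompsonToVA_injective (k : ℕ) : Function.Injective (thompsonToVA k) := by
  intro g h hgh
  ext ψ : 2
  have := congrArg (fun F : GroupVA => F.1 (prepend (coneWord k) ψ)) hgh
  have h2 : prepend (coneWord k) (g.1 ψ) = prepend (coneWord k) (h.1 ψ) := by
    rw [← coneHom_prepend, ← coneHom_prepend]; exact this
  exact prepend_injective _ h2

theorem homeoSupport_thompsonToVA_subset (k : ℕ) (h : ThompsonV) :
    homeoSupport (thompsonToVA k h).1 ⊆ range (prepend (coneWord k)) := by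
  refine closure_minimal ?_ (isClosed_cone _)
  intro x hx
  by_contra hx'
  exact hx (coneHom_of_notMem h.1 hx')

/-! ### The rational numbers in `𝒜` and `ℚ / ℤ` in `V` -/

/-- `ℚ` acts on the line by lifts of elements of Thompson's group `T`, with `1` acting as the unit
translation. -/
theorem exists_rat_circleLift : ∃ i : Multiplicative ℚ →* CircleLift,
    (∀ q, (i q).1 ∈ DyadicIso) ∧
    (∀ (k : ℤ) (t : ℝ), (i (Multiplicative.ofAdd (k : ℚ))).1 t = t + k) ∧
    ∀ q : ℚ, (i (Multiplicative.ofAdd q)).1 0 = 0 → q = 0 := by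
  obtain ⟨i, h1, h2⟩ := exists_rat_action
  -- The unit translation is the image of `1 ∈ ℚ`, so commutativity of `ℚ` suffices.
  have hcomm : ∀ (q : Multiplicative ℚ) (t : ℝ), (i q).1 (t + 1) = (i q).1 t + 1 := by
    intro q t
    have := congrArg (fun F : DyadicIso => F.1 t)
      ((map_mul i q (Multiplicative.ofAdd ((1 : ℤ) : ℚ))).symm.trans
        ((congrArg i (mul_comm _ _)).trans (map_mul i _ q)))
    change (i q).1 ((i (Multiplicative.ofAdd ((1 : ℤ) : ℚ))).1 t) =
      (i (Multiplicative.ofAdd ((1 : ℤ) : ℚ))).1 ((i q).1 t) at this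
    rw [h1, h1] at this
    simpa using this
  exact ⟨(DyadicIso.subtype.comp i).codRestrict CircleLift
    fun q => isDyadic_circleLift (i q).2 (hcomm q), fun q => (i q).2, h1, h2⟩

/-- Brin's group contains the additive group of the rational numbers. -/
theorem exists_rat_hom_brinA : ∃ i : Multiplicative ℚ →* BrinA, Function.Injective i := by
  obtain ⟨i, h0, -, h2⟩ := exists_rat_circleLift
  refine ⟨MonoidHom.mk' (fun q => ⟨(i q).1.toHomeomorph, h0 q, 1, one_pos,
    fun t _ => (i q).2.1 t⟩) fun q r => ?_, ?_⟩
  · ext t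
    change (i (q * r)).1 t = (i q).1 ((i r).1 t)
    rw [map_mul]; rfl
  · rw [injective_iff_map_eq_one]
    intro q hq
    exact h2 q.toAdd (congrArg (fun F : BrinA => F.1 0) hq)

/-- Thompson's group `V` contains `ℚ / ℤ`. -/
theorem exists_addCircle_hom_thompsonV :
    ∃ j : Multiplicative (AddCircle (1 : ℚ)) →* ThompsonV, Function.Injective j := by
  obtain ⟨i, h0, h1, h2⟩ := exists_rat_circleLift
  -- If `q` acts trivially on the Cantor set, it moves `0` by an integer `k`; then `q - k` fixes `0`
  -- and vanishes.
  have hker : ∀ q : ℚ, cantorHom (i (Multiplicative.ofAdd q)) = 1 ↔ ∃ k : ℤ, q = k := by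
    intro q
    constructor
    · intro h
      obtain ⟨k, hk⟩ := exists_int_of_cantorHom_eq_one h 0
      refine ⟨k, sub_eq_zero.1 (h2 _ ?_)⟩
      rw [sub_eq_neg_add, ofAdd_add, map_mul]
      change (i (Multiplicative.ofAdd (-(k : ℚ)))).1 ((i (Multiplicative.ofAdd q)).1 0) = 0
      have := h1 (-k)
      rw [Int.cast_neg] at this
      rw [this, hk]
      push_cast; ring
    · rintro ⟨k, rfl⟩
      exact cantorHom_eq_one_of_int k (h1 k)
  let φ : ℚ →+ Additive ThompsonV :=
    AddMonoidHom.mk' (fun q => Additive.ofMul ⟨cantorHom (i (Multiplicative.ofAdd q)),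
      cantorHom_mem_thompsonV (h0 _)⟩) fun q r => by
        rw [← ofMul_mul]
        congr 1
        ext x : 2
        exact congrArg (fun F : Cantor ≃ₜ Cantor => F x)
          ((congrArg cantorHom (map_mul i (Multiplicative.ofAdd q) (Multiplicative.ofAdd r))).trans
            (map_mul cantorHom _ _))
  have hφ : ∀ q, φ q = 0 ↔ ∃ k : ℤ, q = k := fun q => by
    rw [← hker]
    exact ⟨fun h => congrArg (fun F : Additive ThompsonV => F.toMul.1) h, fun h => Subtype.ext h⟩
  have hle : AddSubgroup.zmultiples (1 : ℚ) ≤ φ.ker := by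
    rintro _ ⟨k, rfl⟩
    exact (hφ _).2 ⟨k, by simp⟩
  let ψ : AddCircle (1 : ℚ) →+ Additive ThompsonV := QuotientAddGroup.lift _ φ hle
  refine ⟨MonoidHom.mk' (fun x => (ψ x.toAdd).toMul) fun x y => by rw [toAdd_mul, map_add]; rfl, ?_⟩
  rw [injective_iff_map_eq_one]
  intro x hx
  obtain ⟨q, hq⟩ := QuotientAddGroup.mk_surjective x.toAdd
  have h3 : ψ x.toAdd = 0 := hx
  rw [← hq] at h3
  obtain ⟨k, rfl⟩ := (hφ q).1 h3
  change x.toAdd = 0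
  rw [← hq]
  refine (QuotientAddGroup.eq_zero_iff _).2 ⟨k, by simp⟩

/-! ### Direct sums of disjointly supported groups of homeomorphisms -/

theorem mem_of_fixes_compl {X : Type} [TopologicalSpace X] {f : X ≃ₜ X} {S : Set X}
    (hf : ∀ x, x ∉ S → f x = x) {x : X} (hx : x ∈ S) : f x ∈ S := by
  by_contra h
  exact h (by rwa [f.injective (hf _ h)])

theorem commute_of_disjoint {X : Type} [TopologicalSpace X] {f g : X ≃ₜ X} {S U : Set X}
    (hf : ∀ x, x ∉ S → f x = x) (hg : ∀ x, x ∉ U → g x = x) (h : Disjoint S U) :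
    f * g = g * f := by
  ext x
  rw [Homeomorph.mul_apply, Homeomorph.mul_apply]
  by_cases hx : x ∈ S
  · rw [hg x (Set.disjoint_left.1 h hx), hg _ (Set.disjoint_left.1 h (mem_of_fixes_compl hf hx))]
  · rw [hf x hx]
    by_cases hx' : x ∈ U
    · exact hf _ (Set.disjoint_right.1 h (mem_of_fixes_compl hg hx'))
    · rw [hg x hx', hf x hx]

/-- Injective homomorphisms from a commutative group to a group of homeomorphisms whose images have
pairwise disjoint supports combine to an injective homomorphism from the direct sum. -/
theorem exists_directSum_hom {X : Type} [TopologicalSpace X] (K : Subgroup (X ≃ₜ X)) {M : Type}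
    [AddCommGroup M] (A : ℕ → Multiplicative M →* K) (hA : ∀ n, Function.Injective (A n))
    (S : ℕ → Set X) (hS : ∀ n a x, x ∉ S n → (A n a).1 x = x)
    (hdisj : ∀ m n, m ≠ n → Disjoint (S m) (S n)) :
    ∃ Φ : Multiplicative (⨁ _ : ℕ, M) →* K, Function.Injective Φ ∧
      ∀ n r, Φ (Multiplicative.ofAdd (DirectSum.of (fun _ : ℕ => M) n r)) =
        A n (Multiplicative.ofAdd r) := by
  let s : Set K := ⋃ n, range (A n)
  have hcomm : ∀ x ∈ s, ∀ y ∈ s, x * y = y * x := by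
    intro x hx y hy
    obtain ⟨m, a, rfl⟩ := mem_iUnion.1 hx
    obtain ⟨n, b, rfl⟩ := mem_iUnion.1 hy
    by_cases h : m = n
    · subst h
      rw [← map_mul, mul_comm, map_mul]
    · exact Subtype.ext (commute_of_disjoint (hS m a) (hS n b) (hdisj m n h))
  -- `DirectSum.toAddMonoid` needs a commutative target, which is supplied by the subgroup generated
  -- by the commuting images.
  have hcl := Subgroup.isMulCommutative_closure hcomm
  let _ : CommGroup (Subgroup.closure s) :=
    { (inferInstance : Group (Subgroup.closure s)) with mul_comm := hcl.is_comm.comm }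
  let B : ∀ n : ℕ, M →+ Additive (Subgroup.closure s) := fun n =>
    AddMonoidHom.mk' (fun r => Additive.ofMul ⟨A n (Multiplicative.ofAdd r),
      Subgroup.subset_closure (mem_iUnion.2 ⟨n, _, rfl⟩)⟩) fun q r => by
        rw [← ofMul_mul]
        congr 1
        exact Subtype.ext (map_mul (A n) _ _)
  let Ψ : (⨁ _ : ℕ, M) →+ Additive (Subgroup.closure s) := DirectSum.toAddMonoid B
  let Φ : Multiplicative (⨁ _ : ℕ, M) →* K :=
    MonoidHom.mk' (fun x => (Ψ x.toAdd).toMul.1) fun x y => by rw [toAdd_mul, map_add]; rfl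
  have hof : ∀ n r, Φ (Multiplicative.ofAdd (DirectSum.of (fun _ : ℕ => M) n r)) =
      A n (Multiplicative.ofAdd r) := by
    intro n r
    change (Ψ (DirectSum.of (fun _ : ℕ => M) n r)).toMul.1 = _
    rw [DirectSum.toAddMonoid_of]; rfl
  -- On `S n` a sum acts through its `n`-th component alone, so each component can be recovered.
  have hval : ∀ (x : ⨁ _ : ℕ, M) (n : ℕ), ∀ p ∈ S n,
      (Φ (Multiplicative.ofAdd x)).1 p = (A n (Multiplicative.ofAdd (x n))).1 p := by
    intro x
    induction x using DirectSum.induction_on with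
    | zero =>
      intro n p _
      rw [ofAdd_zero, map_one, DirectSum.zero_apply, ofAdd_zero, map_one]
    | of m r =>
      intro n p hp
      rw [hof]
      by_cases h : m = n
      · subst h
        rw [DirectSum.of_eq_same]
      · rw [DirectSum.of_eq_of_ne _ _ _ (Ne.symm h), ofAdd_zero, map_one]
        exact hS m _ p (Set.disjoint_right.1 (hdisj m n h) hp)
    | add x y hx hy =>
      intro n p hp
      rw [ofAdd_add, map_mul, DirectSum.add_apply, ofAdd_add, map_mul]
      change (Φ (Multiplicative.ofAdd x)).1 ((Φ (Multiplicative.ofAdd y)).1 p) =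
        (A n (Multiplicative.ofAdd (x n))).1 ((A n (Multiplicative.ofAdd (y n))).1 p)
      rw [hy n p hp, hx n _ (mem_of_fixes_compl (hS n _) hp)]
  refine ⟨Φ, ?_, hof⟩
  rw [injective_iff_map_eq_one]
  intro x hx
  have h0 : ∀ n, x.toAdd n = 0 := by
    intro n
    have h1 : A n (Multiplicative.ofAdd (x.toAdd n)) = 1 := by
      ext p
      by_cases hp : p ∈ S n
      · rw [← hval _ n p hp]
        exact congrArg (fun F : K => F.1 p) hx
      · exact hS n _ p hp
    exact (injective_iff_map_eq_one _).1 (hA n) _ h1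
  exact DFinsupp.ext h0

theorem notMem_imp_of_homeoSupport_subset {X : Type} [TopologicalSpace X] {f : X ≃ₜ X} {S : Set X}
    (h : homeoSupport f ⊆ S) {x : X} (hx : x ∉ S) : f x = x := by
  by_contra hne
  exact hx (h (subset_closure hne))

/-! ### Countable abelian groups -/

/-- A cyclic subgroup can be detected by a homomorphism to `ℚ ⊕ ℚ / ℤ`. -/
theorem exists_hom_injOn_zmultiples {Q : Type*} [AddCommGroup Q] (x : Q) :
    ∃ h : Q →+ ℚ × AddCircle (1 : ℚ), ∀ k : ℤ, h (k • x) = 0 → k • x = 0 := by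
  by_cases hx : addOrderOf x = 0
  · have hinj : Function.Injective (zmultiplesHom Q x) := by
      rw [injective_iff_map_eq_zero]
      intro k hk
      rw [zmultiplesHom_apply, ← addOrderOf_dvd_iff_zsmul_eq_zero, hx] at hk
      simpa using hk
    -- For infinite order, `k • x ↦ k` is defined on the cyclic subgroup and extends because
    -- divisible groups are injective.
    obtain ⟨h, hh⟩ := (Module.Baer.of_divisible ℚ).extension_property_addMonoidHom
      (zmultiplesHom Q x) hinj (zmultiplesHom ℚ 1)
    refine ⟨(AddMonoidHom.inl ℚ (AddCircle (1 : ℚ))).comp h, fun k hk => ?_⟩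
    have h1 := DFunLike.congr_fun hh k
    have h2 : h (k • x) = 0 := congrArg Prod.fst hk
    simp only [AddMonoidHom.comp_apply, zmultiplesHom_apply] at h1
    rw [h2] at h1
    have : k = 0 := by simpa using h1.symm
    rw [this, zero_smul]
  · set d := addOrderOf x with hd
    have hd0 : (d : ℚ) ≠ 0 := by exact_mod_cast hx
    -- For finite order `d` the generator goes to the class of `1 / d`, which has the same
    -- annihilator.
    let y : AddCircle (1 : ℚ) := ((1 / d : ℚ) : AddCircle (1 : ℚ))
    have hy : ∀ k : ℤ, k • y = 0 ↔ k • x = 0 := by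
      intro k
      rw [← addOrderOf_dvd_iff_zsmul_eq_zero (x := x), ← hd, ← AddCircle.coe_zsmul,
        AddCircle.coe_eq_zero_iff]
      constructor
      · rintro ⟨n, hn⟩
        refine ⟨n, ?_⟩
        rw [zsmul_eq_mul, zsmul_eq_mul, mul_one, mul_one_div, eq_div_iff hd0] at hn
        rw [mul_comm]
        exact_mod_cast hn.symm
      · rintro ⟨n, rfl⟩
        refine ⟨n, ?_⟩
        rw [zsmul_eq_mul, zsmul_eq_mul]
        push_cast
        field_simp
    have hf : zmultiplesHom Q x (d : ℤ) = 0 := by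
      rw [zmultiplesHom_apply, ← addOrderOf_dvd_iff_zsmul_eq_zero]
    have hg : zmultiplesHom (AddCircle (1 : ℚ)) y (d : ℤ) = 0 := by
      rw [zmultiplesHom_apply, hy, ← addOrderOf_dvd_iff_zsmul_eq_zero]
    have hinj : Function.Injective (ZMod.lift d ⟨zmultiplesHom Q x, hf⟩) := by
      rw [ZMod.lift_injective]
      intro k hk
      rw [ZMod.intCast_zmod_eq_zero_iff_dvd]
      exact addOrderOf_dvd_iff_zsmul_eq_zero.2 hk
    obtain ⟨h, hh⟩ := (Module.Baer.of_divisible (AddCircle (1 : ℚ))).extension_property_addMonoidHom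
      _ hinj (ZMod.lift d ⟨zmultiplesHom _ y, hg⟩)
    refine ⟨(AddMonoidHom.inr ℚ (AddCircle (1 : ℚ))).comp h, fun k hk => ?_⟩
    have h1 := DFunLike.congr_fun hh (k : ZMod d)
    simp only [AddMonoidHom.comp_apply, ZMod.lift_coe, zmultiplesHom_apply] at h1
    have h2 : h (k • x) = 0 := congrArg Prod.snd hk
    rw [h2] at h1
    exact (hy k).1 h1.symm

/-- Every countable abelian group embeds into a countable direct sum of copies of `ℚ ⊕ ℚ / ℤ`. -/
theorem exists_injective_directSum (G : Type*) [AddCommGroup G] [Countable G] :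
    ∃ φ : G →+ ⨁ _ : ℕ, ℚ × AddCircle (1 : ℚ), Function.Injective φ := by
  classical
  obtain ⟨g, hg⟩ := exists_surjective_nat G
  let H : ℕ → AddSubgroup G := fun n => AddSubgroup.closure (g '' Iio n)
  have hmono : Monotone H := fun m n h =>
    AddSubgroup.closure_mono (image_mono (Iio_subset_Iio h))
  have hmem : ∀ n, g n ∈ H (n + 1) := fun n =>
    AddSubgroup.subset_closure ⟨n, Nat.lt_succ_self n, rfl⟩
  -- `H (n + 1)` is cyclic over `H n`, so a homomorphism that detects this cyclic quotient also
  -- vanishes on `H n`. The vanishing makes the family of components finitely supported at each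
  -- element; the detection allows descent from `H (n + 1)` to `H n`.
  have hstep : ∀ n, ∃ h : G →+ ℚ × AddCircle (1 : ℚ),
      (∀ x ∈ H n, h x = 0) ∧ ∀ x ∈ H (n + 1), h x = 0 → x ∈ H n := by
    intro n
    obtain ⟨h, hh⟩ := exists_hom_injOn_zmultiples (QuotientAddGroup.mk' (H n) (g n))
    refine ⟨h.comp (QuotientAddGroup.mk' (H n)), fun x hx => ?_, fun x hx hx0 => ?_⟩
    · rw [AddMonoidHom.comp_apply, QuotientAddGroup.mk'_apply,
        (QuotientAddGroup.eq_zero_iff x).2 hx, map_zero]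
    · have hcl : H (n + 1) ≤ H n ⊔ AddSubgroup.zmultiples (g n) := by
        refine (AddSubgroup.closure_le _).2 ?_
        rintro _ ⟨m, hm, rfl⟩
        rcases (Nat.lt_succ_iff.1 hm).eq_or_lt with rfl | hm
        · exact le_sup_right (a := H m) (AddSubgroup.mem_zmultiples (g m))
        · exact le_sup_left (b := AddSubgroup.zmultiples (g n))
            (AddSubgroup.subset_closure ⟨m, hm, rfl⟩)
      obtain ⟨y, hy, _, ⟨k, rfl⟩, rfl⟩ := AddSubgroup.mem_sup.1 (hcl hx)
      have e : QuotientAddGroup.mk' (H n) (y + k • g n) =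
          k • QuotientAddGroup.mk' (H n) (g n) := by
        rw [map_add, map_zsmul, add_eq_right]
        exact (QuotientAddGroup.eq_zero_iff y).2 hy
      have h1 : QuotientAddGroup.mk' (H n) (y + k • g n) = 0 := by
        rw [e]
        refine hh k ?_
        rw [← e]
        exact hx0
      exact (QuotientAddGroup.eq_zero_iff _).1 h1
  choose h h1 h2 using hstep
  have hfin : ∀ x : G, ∃ N, ∀ n, N ≤ n → h n x = 0 := by
    intro x
    obtain ⟨m, rfl⟩ := hg x
    exact ⟨m + 1, fun n hn => h1 n _ (hmono hn (hmem m))⟩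
  choose N hN using hfin
  let φ : G → ⨁ _ : ℕ, ℚ × AddCircle (1 : ℚ) := fun x =>
    DirectSum.mk _ (Finset.range (N x)) fun n => h n x
  have hφ : ∀ x n, φ x n = h n x := by
    intro x n
    by_cases hn : n ∈ Finset.range (N x)
    · exact DirectSum.mk_apply_of_mem hn
    · rw [hN x n (by simpa using hn)]
      exact DirectSum.mk_apply_of_notMem hn
  refine ⟨AddMonoidHom.mk' φ fun x y => ?_, ?_⟩
  · refine DFinsupp.ext fun n => ?_
    rw [DirectSum.add_apply, hφ, hφ, hφ, map_add]
  · rw [injective_iff_map_eq_zero]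
    intro x hx
    have h3 : ∀ n, h n x = 0 := fun n => by
      rw [← hφ]; exact DFunLike.congr_fun hx n
    have h4 : ∀ n, x ∈ H n → x = 0 := by
      intro n
      induction n with
      | zero =>
        intro h5
        have : H 0 = ⊥ := by simp [H]
        rw [this] at h5
        exact AddSubgroup.mem_bot.1 h5
      | succ n ih => exact fun h5 => ih (h2 n x h5 (h3 n))
    obtain ⟨m, rfl⟩ := hg x
    exact h4 _ (hmem m)

/-- Every countable torsion-free abelian group embeds into a countable direct sum of copies
of `ℚ`. -/
theorem exists_injective_directSum_rat (G : Type*) [AddCommGroup G] [Countable G]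
    [IsAddTorsionFree G] : ∃ φ : G →+ ⨁ _ : ℕ, ℚ, Function.Injective φ := by
  classical
  -- The divisible hull is a countable rational vector space, so a basis can be indexed by natural
  -- numbers.
  let b := Module.Basis.ofVectorSpace ℚ (DivisibleHull G)
  have : Countable (DivisibleHull G) := by
    have hs : Function.Surjective fun p : G × ℕ+ => DivisibleHull.mk p.1 p.2 := fun x => by
      induction x with
      | mk m s => exact ⟨(m, s), rfl⟩
    exact hs.countable
  obtain ⟨e, he⟩ := exists_injective_nat (Module.Basis.ofVectorSpaceIndex ℚ (DivisibleHull G))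
  let ψ : DivisibleHull G →+ (ℕ →₀ ℚ) :=
    (Finsupp.lmapDomain ℚ ℚ e).toAddMonoidHom.comp b.repr.toLinearMap.toAddMonoidHom
  have hψ : Function.Injective ψ :=
    (Finsupp.mapDomain_injective he).comp b.repr.injective
  refine ⟨((finsuppLequivDFinsupp ℚ).toLinearMap.toAddMonoidHom.comp ψ).comp
    (DivisibleHull.coeAddMonoidHom G), ?_⟩
  exact ((finsuppLequivDFinsupp ℚ).injective.comp hψ).comp DivisibleHull.coe_injective

/-! ### The embeddings into `T𝒜` and `V𝒜` -/

/-- The sum of a copy of Brin's group and of a copy of Thompson's group `V` in `V𝒜`. -/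
theorem exists_prod_hom_groupVA (i : Multiplicative ℚ →* BrinA) (hi : Function.Injective i)
    (j : Multiplicative (AddCircle (1 : ℚ)) →* ThompsonV) (hj : Function.Injective j) {k l : ℕ}
    (hkl : k ≠ l) :
    ∃ A : Multiplicative (ℚ × AddCircle (1 : ℚ)) →* GroupVA, Function.Injective A ∧
      (∀ r s, A (Multiplicative.ofAdd (r, s)) =
        brinToVA k (i (Multiplicative.ofAdd r)) * thompsonToVA l (j (Multiplicative.ofAdd s))) ∧
      ∀ a x, x ∉ range (prepend (coneWord k)) ∪ range (prepend (coneWord l)) → (A a).1 x = x := by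
  have hα : ∀ f x, x ∉ range (prepend (coneWord k)) → (brinToVA k f).1 x = x := fun f _ hx =>
    notMem_imp_of_homeoSupport_subset (homeoSupport_brinToVA_subset k f) hx
  have hβ : ∀ h x, x ∉ range (prepend (coneWord l)) → (thompsonToVA l h).1 x = x := fun h _ hx =>
    notMem_imp_of_homeoSupport_subset (homeoSupport_thompsonToVA_subset l h) hx
  have hcomm : ∀ f h, brinToVA k f * thompsonToVA l h = thompsonToVA l h * brinToVA k f :=
    fun f h => Subtype.ext (commute_of_disjoint (hα f) (hβ h) (disjoint_cone hkl))
  refine ⟨MonoidHom.mk' (fun a => brinToVA k (i (Multiplicative.ofAdd a.toAdd.1)) *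
    thompsonToVA l (j (Multiplicative.ofAdd a.toAdd.2))) fun a b => ?_, ?_, fun _ _ => rfl, ?_⟩
  · rw [toAdd_mul, Prod.fst_add, Prod.snd_add, ofAdd_add, ofAdd_add, map_mul, map_mul, map_mul,
      map_mul, mul_assoc, mul_assoc]
    congr 1
    rw [← mul_assoc, ← mul_assoc, hcomm]
  · rw [injective_iff_map_eq_one]
    intro a ha
    have ha' : brinToVA k (i (Multiplicative.ofAdd a.toAdd.1)) *
      thompsonToVA l (j (Multiplicative.ofAdd a.toAdd.2)) = 1 := ha
    -- On the cone of `coneWord k` the second factor is the identity, so the first factor alone must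
    -- be trivial there.
    have h1 : brinToVA k (i (Multiplicative.ofAdd a.toAdd.1)) = 1 := by
      ext x : 2
      by_cases hx : x ∈ range (prepend (coneWord k))
      · have := congrArg (fun F : GroupVA => F.1 x) ha'
        have h2 := hβ (j (Multiplicative.ofAdd a.toAdd.2)) x
          (Set.disjoint_left.1 (disjoint_cone hkl) hx)
        change (brinToVA k _).1 ((thompsonToVA l _).1 x) = x at this
        rwa [h2] at this
      · exact hα _ x hx
    rw [h1, one_mul] at ha'
    have h3 := (injective_iff_map_eq_one _).1 hi _
      ((injective_iff_map_eq_one _).1 (brinToVA_injective k) _ h1)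
    have h4 := (injective_iff_map_eq_one _).1 hj _
      ((injective_iff_map_eq_one _).1 (thompsonToVA_injective l) _ ha')
    exact Prod.ext h3 h4
  · intro a x hx
    rw [mem_union, not_or] at hx
    change (brinToVA k _).1 ((thompsonToVA l _).1 x) = x
    rw [hβ _ x hx.2, hα _ x hx.1]

theorem exists_injective_of_additive {G K M : Type*} [CommGroup G] [AddCommGroup M] [Group K]
    (Φ : Multiplicative M →* K) (hΦ : Function.Injective Φ)
    (h : ∃ φ : Additive G →+ M, Function.Injective φ) :
    ∃ φ : G →* K, Function.Injective φ := by
  obtain ⟨φ, hφ⟩ := h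
  exact ⟨MonoidHom.mk' (fun g => Φ (Multiplicative.ofAdd (φ (Additive.ofMul g)))) fun a b => by
    rw [ofMul_mul, map_add, ofAdd_add, map_mul], hΦ.comp hφ⟩

theorem mainTheorem9 :
    -- `T𝒜` contains `⨁_ω ℚ`, through disjointly supported copies of `𝒜`, which contains `ℚ`
    (∃ (i : Multiplicative ℚ →* BrinA) (α : ℕ → (BrinA →* GroupTA))
        (Φ : Multiplicative (⨁ _ : ℕ, ℚ) →* GroupTA),
      Function.Injective i ∧
      (∀ n, Function.Injective (α n)) ∧
      (∀ m n, m ≠ n → ∀ a b, Disjoint (homeoSupport (α m a).1) (homeoSupport (α n b).1)) ∧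
      Function.Injective Φ ∧
      (∀ (n : ℕ) (r : ℚ), Φ (Multiplicative.ofAdd (DirectSum.of (fun _ : ℕ => ℚ) n r)) =
        α n (i (Multiplicative.ofAdd r)))) ∧
    -- `V𝒜` contains `⨁_ω (ℚ ⊕ ℚ/ℤ)`, through disjointly supported copies of `𝒜`, which contains
    -- `ℚ`, and of `V`, which contains `ℚ/ℤ`
    (∃ (i : Multiplicative ℚ →* BrinA) (j : Multiplicative (AddCircle (1 : ℚ)) →* ThompsonV)
        (α : ℕ → (BrinA →* GroupVA)) (β : ℕ → (ThompsonV →* GroupVA))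
        (Φ : Multiplicative (⨁ _ : ℕ, ℚ × AddCircle (1 : ℚ)) →* GroupVA),
      Function.Injective i ∧ Function.Injective j ∧
      (∀ n, Function.Injective (α n)) ∧ (∀ n, Function.Injective (β n)) ∧
      (∀ m n, m ≠ n → ∀ a b, Disjoint (homeoSupport (α m a).1) (homeoSupport (α n b).1)) ∧
      (∀ m n, m ≠ n → ∀ a b, Disjoint (homeoSupport (β m a).1) (homeoSupport (β n b).1)) ∧
      (∀ m n a b, Disjoint (homeoSupport (α m a).1) (homeoSupport (β n b).1)) ∧
      Function.Injective Φ ∧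
      (∀ (n : ℕ) (r : ℚ) (s : AddCircle (1 : ℚ)),
        Φ (Multiplicative.ofAdd
            (DirectSum.of (fun _ : ℕ => ℚ × AddCircle (1 : ℚ)) n (r, s))) =
          α n (i (Multiplicative.ofAdd r)) * β n (j (Multiplicative.ofAdd s)))) ∧
    -- every countable torsion-free abelian group embeds into `T𝒜`
    (∀ (G : Type*) [CommGroup G] [Countable G] [IsMulTorsionFree G],
      ∃ φ : G →* GroupTA, Function.Injective φ) ∧
    -- every countable abelian group embeds into `V𝒜`
    (∀ (G : Type*) [CommGroup G] [Countable G],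
      ∃ φ : G →* GroupVA, Function.Injective φ) := by
  obtain ⟨i, hi⟩ := exists_rat_hom_brinA
  obtain ⟨j, hj⟩ := exists_addCircle_hom_thompsonV
  have hTA : ∀ m n, m ≠ n → ∀ a b, Disjoint (homeoSupport (brinToTA (2 * m + 1) a).1)
      (homeoSupport (brinToTA (2 * n + 1) b).1) :=
    fun m n h a b => disjoint_homeoSupport_brinToTA h a b
  obtain ⟨ΦT, hΦT, hΦT'⟩ := exists_directSum_hom GroupTA
    (fun n => (brinToTA (2 * n + 1)).comp i) (fun n => (brinToTA_injective _).comp hi)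
    (fun n => toCircle '' Icc (width (2 * n + 1)) (2 * width (2 * n + 1)))
    (fun n a x hx => notMem_imp_of_homeoSupport_subset (homeoSupport_brinToTA_subset _ _) hx)
    (fun m n h => disjoint_toCircle_image_of_ne h)
  -- Cones are closed and distinct ones are disjoint, so no indices need to be skipped: odd ones
  -- serve `𝒜` and even ones serve `V`.
  choose A hA hA' hA'' using fun n : ℕ =>
    exists_prod_hom_groupVA i hi j hj (show 2 * n + 1 ≠ 2 * n by omega)
  obtain ⟨ΦV, hΦV, hΦV'⟩ := exists_directSum_hom GroupVA A hA _ hA'' (fun m n h => by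
    refine Disjoint.union_left (Disjoint.union_right ?_ ?_) (Disjoint.union_right ?_ ?_) <;>
      exact disjoint_cone (by omega))
  have hα := homeoSupport_brinToVA_subset
  have hβ := homeoSupport_thompsonToVA_subset
  refine ⟨⟨i, fun n => brinToTA (2 * n + 1), ΦT, hi, fun n => brinToTA_injective _, hTA, hΦT,
      hΦT'⟩,
    ⟨i, j, fun n => brinToVA (2 * n + 1), fun n => thompsonToVA (2 * n), ΦV, hi, hj,
      fun n => brinToVA_injective _, fun n => thompsonToVA_injective _,
      fun m n h a b => (disjoint_cone (by omega)).mono (hα _ a) (hα _ b),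
      fun m n h a b => (disjoint_cone (by omega)).mono (hβ _ a) (hβ _ b),
      fun m n a b => (disjoint_cone (by omega)).mono (hα _ a) (hβ _ b), hΦV,
      fun n r s => by rw [hΦV', hA']⟩,
    fun G _ hG _ => ?_, fun G _ hG => ?_⟩
  · have : Countable (Additive G) := hG
    exact exists_injective_of_additive ΦT hΦT (exists_injective_directSum_rat _)
  · have : Countable (Additive G) := hG
    exact exists_injective_of_additive ΦV hΦV (exists_injective_directSum _)
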